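/- **Conventions.** A CSS code $\mathcal C$ is a complex of finite-dimensional $\mathbb F_2$-vector spaces with distinguished bases $C_2\xrightarrow{H_2^T}C_1\xrightarrow{H_1}C_0$, $H_1H_2^T=0$. Put $size(\mathcal C)=\dim C_1$, $\dim(\mathcal C)=\dim(\ker H_1/\operatorname{im}H_2^T)$, and $d(\mathcal C)=\min(d_X,d_Z)$, where $d_X$ (resp. $d_Z$) is the least Hamming weight of a vector in $\ker H_1\setminus\operatorname{im}H_2^T$ (resp. $\ker H_2\setminus \operatorname{im}H_1^T$), and $0$ if there is none. The code is LDPC with constant $w$ if $H_1$ and $H_2$ have at most $w$ non-zero entries in each row and each column. It is local in dimension $n$ with constant $A$ if there is an injection $f$ from the basis of $C_1$ to $\{x\in\mathbb Z^n:\sum_i|x_i|<A\,size(\mathcal C)^{1/n}\}$ such that $\|f(e_i)-f(e_j)\|_1\le A$ whenever $e_i\ne e_j$ both occur in a common row of $H_1$ or of $H_2$. A triangulated $d$-manifold $M$ is a finite simplicial complex in which the open star of every vertex is homeomorphic to $\mathbb R^d$; $vol(M)$ is its number of $d$-simplices; $H_k(M)$ is simplicial homology with coefficients in $\mathbb F_2$;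 $sys_k(M)$ is the least number of $k$-simplices in the support of a $k$-cycle that is not a boundary, and $0$ if $H_k(M)=0$. $M$ is local in dimension $n$ with constant $A$ if there is a continuous map $F$ from $M$ to a ball of volume $vol(M)$ in $\mathbb R^n$ that is $A$-coarse: for the standard triangulation of $\mathbb R^n$ that cuts each unit lattice cube into $n!$ simplices, the image of each closed simplex of $M$ meets at most $A$ closed simplices of $\mathbb R^n$, and the preimage of each closed simplex of $\mathbb R^n$ meets at most $A$ closed simplices of $M$ (simplices of all dimensions are counted). **Theorem.** 1. For all $n\ge2$, $w$ and $A$ there is a constant $K>0$ such that every LDPC code (with constant $w$) of size $V$ that is local in dimension $n$ (with constant $A$) satisfies $$\dim(\mathcal C)\,d(\mathcal C)^{2/(n-1)}\le K\,V.$$ 2. Hence distance $V^{(n-1)/n}$ forces dimension at most $V^{(n-2)/n}$, up to polylogarithmic factors: for all $n\ge2$, $w$, $A$ and $a,c>0$ there is $b>0$ such that every code as in 1 of size $V\ge3$ with $d(\mathcal C)\ge c\,V^{(n-1)/n}(\log V)^{-a}$ satisfies $$\dim(\mathcal C)\le V^{(n-2)/n}(\log V)^{b}.$$ 3. For all $n\ge2$,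 $d\ge2$, $0<k<d$ and $A$ there is a constant $K>0$ such that every triangulated $d$-manifold $M$ that is local in dimension $n$ (with constant $A$) satisfies $$\dim H_k(M)\cdot\min\big(sys_k(M),sys_{d-k}(M)\big)^{2/(n-1)}\le K\,vol(M).$$ -/

import Mathlib

open MeasureTheory

/-! ### Two-step complexes of `𝔽₂`-vector spaces given by matrices -/

section TwoStep

variable {α β γ : Type*} [Fintype β] [Fintype γ]

/-- For matrices `P` and `Q` over `𝔽₂` with `P * Q = 0`, the dimension of the homology
`ker P / im Q` of the complex `𝔽₂^γ → 𝔽₂^β → 𝔽₂^α`. -/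
noncomputable def homologyDim (P : Matrix α β (ZMod 2)) (Q : Matrix β γ (ZMod 2)) : ℕ :=
  Module.finrank (ZMod 2)
    (↥(LinearMap.ker P.mulVecLin) ⧸
      (LinearMap.range Q.mulVecLin).submoduleOf (LinearMap.ker P.mulVecLin))

/-- The minimal Hamming weight of a vector of `ker P` outside `im Q`; it is `0` by convention
if there is no such vector. -/
noncomputable def minWeight (P : Matrix α β (ZMod 2)) (Q : Matrix β γ (ZMod 2)) : ℕ :=
  sInf {w : ℕ | ∃ v : β → ZMod 2,
    v ∈ LinearMap.ker P.mulVecLin ∧ v ∉ LinearMap.range Q.mulVecLin ∧ hammingNorm v = w}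

/-- All rows and all columns of the matrix have at most `w` non-zero entries. -/
def Matrix.IsSparse (w : ℕ) (H : Matrix α β (ZMod 2)) : Prop :=
  (∀ a, {b | H a b ≠ 0}.encard ≤ w) ∧ ∀ b, {a | H a b ≠ 0}.encard ≤ w

end TwoStep

/-! ### CSS quantum codes -/

/-- A CSS quantum code `C₂ → C₁ → C₀` over `𝔽₂` with boundary maps `H₂ᵀ` and `H₁`, where
`Cᵢ = 𝔽₂^(ιᵢ)` with its distinguished basis indexed by `ιᵢ`. -/
structure CSSCode (ι₂ ι₁ ι₀ : Type*) [Fintype ι₂] [Fintype ι₁] [Fintype ι₀] where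
  H₂ : Matrix ι₂ ι₁ (ZMod 2)
  H₁ : Matrix ι₀ ι₁ (ZMod 2)
  mul_transpose : H₁ * H₂.transpose = 0

namespace CSSCode

variable {ι₂ ι₁ ι₀ : Type*} [Fintype ι₂] [Fintype ι₁] [Fintype ι₀]

/-- The number of qubits, `dim C₁`. -/
def size (_C : CSSCode ι₂ ι₁ ι₀) : ℕ := Fintype.card ι₁

/-- `dim (ker H₁ / im H₂ᵀ)`. -/
noncomputable def dim (C : CSSCode ι₂ ι₁ ι₀) : ℕ := homologyDim C.H₁ C.H₂.transpose

noncomputable def distX (C : CSSCode ι₂ ι₁ ι₀) : ℕ := minWeight C.H₁ C.H₂.transpose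

noncomputable def distZ (C : CSSCode ι₂ ι₁ ι₀) : ℕ := minWeight C.H₂ C.H₁.transpose

noncomputable def dist (C : CSSCode ι₂ ι₁ ι₀) : ℕ := min C.distX C.distZ

/-- Low density parity check with sparsity constant `w`. -/
def IsLDPC (w : ℕ) (C : CSSCode ι₂ ι₁ ι₀) : Prop := C.H₁.IsSparse w ∧ C.H₂.IsSparse w

/-- Two distinct basis vectors of `C₁` occur together in a row of `H₁` or of `H₂`. -/
def PartOfCheck (C : CSSCode ι₂ ι₁ ι₀) (i j : ι₁) : Prop :=
  i ≠ j ∧ ((∃ r, C.H₁ r i ≠ 0 ∧ C.H₁ r j ≠ 0) ∨ ∃ r, C.H₂ r i ≠ 0 ∧ C.H₂ r j ≠ 0)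

end CSSCode

/-- The lattice points of `ℤⁿ` of `ℓ¹`-norm less than `A V^(1/n)`. -/
def latticeCube (n : ℕ) (A V : ℝ) : Set (Fin n → ℤ) :=
  {x | ∑ l, |(x l : ℝ)| < A * V ^ ((1 : ℝ) / n)}

/-- The code is local in dimension `n`, with locality constant `A`. -/
def CSSCode.IsLocal {ι₂ ι₁ ι₀ : Type*} [Fintype ι₂] [Fintype ι₁] [Fintype ι₀]
    (n : ℕ) (A : ℝ) (C : CSSCode ι₂ ι₁ ι₀) : Prop :=
  ∃ f : ι₁ → (Fin n → ℤ), Function.Injective f ∧ (∀ i, f i ∈ latticeCube n A C.size) ∧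
    ∀ i j, C.PartOfCheck i j → ∑ l, |(f i l : ℝ) - f j l| ≤ A

/-! ### Finite simplicial complexes: chains, volume, systoles -/

namespace AbstractSimplicialComplex

variable {ι : Type*} [Fintype ι]

/-- The `k`-simplices `M(k)`. -/
def Simplex (M : AbstractSimplicialComplex ι) (k : ℕ) : Type _ :=
  {s : Finset ι // s ∈ M.faces ∧ s.card = k + 1}

noncomputable instance (M : AbstractSimplicialComplex ι) (k : ℕ) : Fintype (M.Simplex k) :=
  @Fintype.ofFinite _ (inferInstanceAs (Finite {s : Finset ι // s ∈ M.faces ∧ s.card = k + 1}))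

open Classical in
/-- The matrix of `∂ₖ : Cₖ(M) → Cₖ₋₁(M)` over `𝔽₂`. For `k = 0` the inclusion is never strict, so
that the matrix is zero, as it should be. -/
noncomputable def boundary (M : AbstractSimplicialComplex ι) (k : ℕ) :
    Matrix (M.Simplex (k - 1)) (M.Simplex k) (ZMod 2) :=
  fun τ σ => if τ.1 ⊂ σ.1 then 1 else 0

/-- `dim Hₖ(M; 𝔽₂)`. -/
noncomputable def bettiTwo (M : AbstractSimplicialComplex ι) (k : ℕ) : ℕ :=
  homologyDim (M.boundary k) (M.boundary (k + 1))

/-- The `k`-systole: the least number of `k`-simplices in a `k`-cycle mod 2 that is not a boundary,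
and `0` if `Hₖ(M; 𝔽₂) = 0`. -/
noncomputable def systole (M : AbstractSimplicialComplex ι) (k : ℕ) : ℕ :=
  minWeight (M.boundary k) (M.boundary (k + 1))

/-- The volume of a `d`-dimensional complex: its number of `d`-simplices. -/
noncomputable def vol (M : AbstractSimplicialComplex ι) (d : ℕ) : ℕ :=
  Fintype.card (M.Simplex d)

/-! ### Geometric realization and triangulated manifolds -/

/-- The closed simplex in `ℝ^ι` spanned by the basis vectors in `s`. -/
def closedSimplex (s : Finset ι) : Set (ι → ℝ) :=
  {x | x ∈ stdSimplex ℝ ι ∧ ∀ i, i ∉ s → x i = 0}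

/-- The closed simplices of the geometric realization. -/
def cells (M : AbstractSimplicialComplex ι) : Set (Set (ι → ℝ)) :=
  closedSimplex '' M.faces

/-- The geometric realization, as a subspace of `ℝ^ι`. -/
def realization (M : AbstractSimplicialComplex ι) : Set (ι → ℝ) :=
  ⋃₀ M.cells

/-- The open star of a vertex: the union of the relative interiors of the simplices that contain
it, i.e. the set of points with positive barycentric coordinate at this vertex. -/
def openStar (M : AbstractSimplicialComplex ι) (v : ι) : Set (ι → ℝ) :=
  {x ∈ M.realization | 0 < x v}

/-- A (finite) triangulated `d`-manifold: all open vertex stars are homeomorphic to `ℝᵈ`. -/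
def IsTriangulatedManifold (M : AbstractSimplicialComplex ι) (d : ℕ) : Prop :=
  ∀ v : ι, Nonempty (M.openStar v ≃ₜ EuclideanSpace ℝ (Fin d))

end AbstractSimplicialComplex

/-! ### Coarse maps and local complexes -/

/-- A map is `A`-coarse with respect to the families `X` and `Y` of closed simplices of its domain
and codomain if the image of a simplex meets at most `A` simplices and the preimage of a simplex
meets at most `A` simplices. -/
def IsCoarse {α β : Type*} (A : ℕ) (X : Set (Set α)) (Y : Set (Set β)) (F : α → β) : Prop :=
  (∀ σ ∈ X, {τ ∈ Y | (τ ∩ F '' σ).Nonempty}.encard ≤ A) ∧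
    ∀ τ ∈ Y, {σ ∈ X | (σ ∩ F ⁻¹' τ).Nonempty}.encard ≤ A

/-- A point of `ℤⁿ` as a point of `ℝⁿ`. -/
noncomputable def latticePoint {n : ℕ} (x : Fin n → ℤ) : EuclideanSpace ℝ (Fin n) :=
  WithLp.toLp 2 fun i => (x i : ℝ)

/-- The closed simplices (of all dimensions) of the standard triangulation of `ℝⁿ`, which cuts each
unit cube `x + [0,1]ⁿ`, `x ∈ ℤⁿ`, into the `n!` simplices
`conv {x, x + e_{π 1}, x + e_{π 1} + e_{π 2}, …, x + e_1 + ⋯ + e_n}`, `π` a permutation.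
The vertex sets of its simplices are the non-empty chains in `ℤⁿ`, for the coordinatewise order,
that are contained in one unit cube. -/
def standardCells (n : ℕ) : Set (Set (EuclideanSpace ℝ (Fin n))) :=
  {S | ∃ c : Finset (Fin n → ℤ), c.Nonempty ∧ IsChain (· ≤ ·) (c : Set (Fin n → ℤ)) ∧
    (∀ x ∈ c, ∀ y ∈ c, ∀ i, y i - x i ≤ 1) ∧ S = convexHull ℝ (latticePoint '' (c : Set _))}

/-- The `d`-dimensional complex `M` is local in dimension `n`, with coarseness constant `A`: there
is a continuous `A`-coarse map of its realization to a ball of volume `vol M` in `ℝⁿ`, where `ℝⁿ`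
carries the standard triangulation. -/
def AbstractSimplicialComplex.IsLocal {ι : Type*} [Fintype ι] (d n A : ℕ)
    (M : AbstractSimplicialComplex ι) : Prop :=
  ∃ (F : (ι → ℝ) → EuclideanSpace ℝ (Fin n)) (c : EuclideanSpace ℝ (Fin n)) (r : ℝ),
    ContinuousOn F M.realization ∧
    volume (Metric.closedBall c r) = (M.vol d : ENNReal) ∧
    Set.MapsTo F M.realization (Metric.closedBall c r) ∧
    IsCoarse A M.cells (standardCells n) F

/-! Both tradeoffs are instances of one statement on two-step complexes `𝔽₂^γ → 𝔽₂^β → 𝔽₂^α` whose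
basis vectors ("qubits") have positions in `ℤⁿ`, with boundedly many qubits at each position and
checks of bounded range: `exists_dim_distance_bound`. Its proof is the argument of Bravyi, Poulin
and Terhal.

* A region of qubits is `Correctable` if every cycle supported on it is a boundary. By linear
  duality (`Correctable.exists_clean`) every cycle is homologous to one that avoids a region that is
  correctable for the dual complex. Hence a correctable region may be enlarged by a correctable
  shell (`Correctable.expand`), and if the qubits outside a set `C` are the union of a region that
  is correctable for the complex and of one that is correctable for the dual complex, then the
  homology has dimension at most `#C` (`homologyDim_le_card`).
* Regions with fewer qubits than the distance are correctable. Growing boxes by shells, one obtains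
  that boxes whose surface contains fewer qubits than the distance `D`, that is of side length of
  order `D^(1/(n-1))`, are correctable (`correctable_boxRegion`). In a grid of boxes of this size
  the cells are correctable, and so are the walls between them, away from the edges of codimension
  two. So the dimension is at most the number of qubits near the skeleton of codimension two, and
  for some translation of the grid this is at most a multiple of `V / D^(2/(n-1))`.

The bound for codes is immediate, and solving it for the dimension gives the statement up to
polylogarithmic factors.

For a triangulated manifold `M` with a coarse map to `ℝⁿ`, the complex is `C_{k+1} → C_k → C_{k-1}`,
and the position of a simplex is the integral part of the image of its barycentre. Coarseness
bounds the density of simplices, as a unit cube contains a bounded number of standard simplices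
(`IsCoarse.card_position_le`), and the range of the boundary maps, as the connected image of a
simplex meets few standard simplices (`IsCoarse.abs_position_sub_le`). The distance of the complex
is the minimum of the `k`-systole and of the least weight of a nontrivial `k`-cocycle. The latter
is at least a constant times the `(d - k)`-systole, by a form of Poincaré duality that stays close
to the support of the cocycle (`exists_dual_cycle`): zigzags through the double complex of functions
on pairs of simplices `s ⊆ t`, with the coboundary in `s` and the boundary in `t`. Its rows are
exact because simplices are acyclic, and its columns because the local homology of `M` is that of
`ℝᵈ`.

That the links of barycentres of simplices have the homology of spheres has to be extracted from
the homeomorphisms of the open vertex stars with `ℝᵈ`. The star of a simplex is a cone over such a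
link, so that a homeomorphism of neighbourhoods makes each of two links a homotopy retract of the
other (`IsConeOver.exists_homotopy_retract`). Simplicial homology is made functorial for continuous
maps by Vietoris complexes: subdividing, applying the map to the vertices of small simplices, and
moving each point to a vertex with the largest barycentric coordinate are maps with acyclic
carriers, as Vietoris complexes of convex sets are acyclic (`exists_homology_retract`). -/

open AbstractSimplicialComplex (closedSimplex)

/-! ### Augmented simplicial chains and acyclic carriers -/

open Classical in
/-- The boundary operator of the augmented simplicial chain complex mod 2 of the full simplex on
`X`. The chains are the finitely supported functions on *all* finite subsets of `X`; the empty set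
is the simplex of dimension `-1`, so that the homology of a subcomplex is its reduced homology. -/
noncomputable def bd {X : Type*} : (Finset X →₀ ZMod 2) →ₗ[ZMod 2] (Finset X →₀ ZMod 2) :=
  Finsupp.linearCombination (ZMod 2) fun s => ∑ x ∈ s, Finsupp.single (s.erase x) 1

/-- The chains of the complex `K` that are supported on simplices with `q` vertices. -/
noncomputable def chains {X : Type*} (K : Set (Finset X)) (q : ℕ) :
    Submodule (ZMod 2) (Finset X →₀ ZMod 2) :=
  Finsupp.supported (ZMod 2) (ZMod 2) {s | s ∈ K ∧ s.card = q}

/-- The reduced homology of `K` vanishes on chains of simplices with `q` vertices. -/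
def ExactAt {X : Type*} (K : Set (Finset X)) (q : ℕ) : Prop :=
  ∀ z ∈ chains K q, bd z = 0 → ∃ c ∈ chains K (q + 1), bd c = z

section Chains

variable {X Y Z : Type*}

theorem chain_add_self (z : Finset X →₀ ZMod 2) : z + z = 0 := by
  ext s; exact CharTwo.add_self_eq_zero _

theorem chain_eq_of_add_eq_zero {z w : Finset X →₀ ZMod 2} (h : z + w = 0) : z = w := by
  have := congrArg (· + w) h
  simpa [add_assoc, chain_add_self] using this

theorem single_mem_chains {K : Set (Finset X)} {s : Finset X} {q : ℕ} (hs : s ∈ K)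
    (hq : s.card = q) (a : ZMod 2) : Finsupp.single s a ∈ chains K q :=
  Finsupp.single_mem_supported _ _ ⟨hs, hq⟩

theorem mem_chains {K : Set (Finset X)} {q : ℕ} {z : Finset X →₀ ZMod 2} :
    z ∈ chains K q ↔ ∀ s, z s ≠ 0 → s ∈ K ∧ s.card = q := by
  simp only [chains, Finsupp.mem_supported, Set.subset_def, Finset.mem_coe,
    Finsupp.mem_support_iff, Set.mem_ofPred_eq]

theorem chains_mono {K L : Set (Finset X)} (h : K ⊆ L) (q : ℕ) : chains K q ≤ chains L q :=
  Finsupp.supported_mono fun _ hs => ⟨h hs.1, hs.2⟩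

/-- A property of chains may be checked on simplices. -/
theorem chains_induction {K : Set (Finset X)} {q : ℕ} {p : (Finset X →₀ ZMod 2) → Prop}
    (h0 : p 0) (hadd : ∀ x y, p x → p y → p (x + y))
    (hsingle : ∀ s ∈ K, s.card = q → p (Finsupp.single s 1)) {z : Finset X →₀ ZMod 2}
    (hz : z ∈ chains K q) : p z := by
  rw [chains, Finsupp.supported_eq_span_single] at hz
  induction hz using Submodule.span_induction with
  | mem x hx => obtain ⟨s, hs, rfl⟩ := hx; exact hsingle s hs.1 hs.2
  | zero => exact h0
  | add x y _ _ hx hy => exact hadd x y hx hy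
  | smul a x _ hx =>
    obtain rfl | rfl : a = 0 ∨ a = 1 := by revert a; decide
    · rwa [zero_smul]
    · rwa [one_smul]

theorem bd_single [DecidableEq X] (s : Finset X) :
    bd (Finsupp.single s 1) = ∑ x ∈ s, Finsupp.single (s.erase x) (1 : ZMod 2) := by
  rw [bd, Finsupp.linearCombination_single, one_smul]
  congr!

open Classical in
theorem bd_bd (z : Finset X →₀ ZMod 2) : bd (bd z) = 0 := by
  induction z using Finsupp.induction_linear with
  | zero => simp
  | add f g hf hg => simp [hf, hg]
  | single s a =>
    have ha : Finsupp.single s a = a • Finsupp.single s (1 : ZMod 2) := by simp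
    rw [ha, map_smul, map_smul, bd_single, map_sum]
    simp only [bd_single]
    rw [Finset.sum_sigma', Finset.sum_involution (fun p _ => ⟨p.2, p.1⟩), smul_zero]
    · rintro ⟨x, y⟩ _
      rw [Finset.erase_right_comm]
      exact chain_add_self _
    · rintro ⟨x, y⟩ h _ heq
      simp only [Finset.mem_sigma, Finset.mem_erase, Sigma.mk.injEq, heq_eq_eq] at h heq
      exact h.2.1 heq.1
    · rintro ⟨x, y⟩ h
      simp only [Finset.mem_sigma, Finset.mem_erase] at h ⊢
      exact ⟨h.2.2, h.2.1.symm, h.1⟩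
    · rintro ⟨x, y⟩ _
      rfl

open Classical in
theorem bd_mem_chains {K : Set (Finset X)} (hK : IsLowerSet K) {q : ℕ} {z : Finset X →₀ ZMod 2}
    (hz : z ∈ chains K (q + 1)) : bd z ∈ chains K q := by
  refine chains_induction (p := fun z => bd z ∈ chains K q) (by simp)
    (fun x y hx hy => by simpa using add_mem hx hy) (fun s hs hq => ?_) hz
  rw [bd_single]
  refine sum_mem fun x hx => single_mem_chains (hK (Finset.erase_subset x s) hs) ?_ 1
  rw [Finset.card_erase_of_mem hx, hq, Nat.add_sub_cancel]

open Classical in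
/-- A cone has vanishing reduced homology. -/
theorem exactAt_of_cone {K : Set (Finset X)} (v : X) (hv : ∀ s ∈ K, insert v s ∈ K) (q : ℕ) :
    ExactAt K q := by
  let κ : (Finset X →₀ ZMod 2) →ₗ[ZMod 2] (Finset X →₀ ZMod 2) :=
    Finsupp.linearCombination (ZMod 2) fun s => if v ∈ s then 0 else Finsupp.single (insert v s) 1
  have hκ (s : Finset X) :
      κ (Finsupp.single s 1) = if v ∈ s then 0 else Finsupp.single (insert v s) 1 := by simp [κ]
  have key (z : Finset X →₀ ZMod 2) (hz : z ∈ chains K q) :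
      κ z ∈ chains K (q + 1) ∧ bd (κ z) + κ (bd z) = z := by
    refine chains_induction (p := fun z => κ z ∈ chains K (q + 1) ∧ bd (κ z) + κ (bd z) = z)
      (by simp) (fun x y hx hy => ⟨by simpa using add_mem hx.1 hy.1, ?_⟩) (fun s hs hq => ⟨?_, ?_⟩)
      hz
    · calc bd (κ (x + y)) + κ (bd (x + y))
          = (bd (κ x) + κ (bd x)) + (bd (κ y) + κ (bd y)) := by simp only [map_add]; abel
        _ = x + y := by rw [hx.2, hy.2]
    · rw [hκ]
      split_ifs with h
      · exact zero_mem _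
      · exact single_mem_chains (hv s hs) (by rw [Finset.card_insert_of_notMem h, hq]) 1
    · rw [bd_single, map_sum]
      simp only [hκ]
      by_cases h : v ∈ s
      · rw [if_pos h, map_zero, zero_add, Finset.sum_eq_single v]
        · simp [Finset.insert_erase h]
        · intro y _ hy
          rw [if_pos (Finset.mem_erase.2 ⟨hy.symm, h⟩)]
        · exact fun h' => absurd h h'
      · rw [if_neg h, bd_single, Finset.sum_insert h, Finset.erase_insert h, add_assoc,
          ← Finset.sum_add_distrib, Finset.sum_eq_zero, add_zero]
        intro y hy
        have hne : v ≠ y := fun e => h (e ▸ hy)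
        rw [if_neg (fun h' => h (Finset.mem_of_mem_erase h')), Finset.erase_insert_of_ne hne]
        exact chain_add_self _
  intro z hz hz0
  refine ⟨κ z, (key z hz).1, ?_⟩
  simpa [hz0] using (key z hz).2

theorem exactAt_powerset {s : Finset X} (hs : s.Nonempty) (q : ℕ) : ExactAt {t | t ⊆ s} q := by
  classical
  obtain ⟨v, hv⟩ := hs
  exact exactAt_of_cone (K := {t | t ⊆ s}) v (fun t ht => Finset.insert_subset hv ht) q

open Classical in
/-- Recursive choice of primitives over the simplices, by increasing dimension. -/
noncomputable def carrierLift (Φ : Finset X → Set (Finset Y)) (e : ℕ)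
    (r : (Finset X →₀ ZMod 2) →ₗ[ZMod 2] (Finset Y →₀ ZMod 2)) (g : Finset Y →₀ ZMod 2)
    (s : Finset X) : Finset Y →₀ ZMod 2 :=
  if s = ∅ then g else Classical.epsilon fun c => c ∈ chains (Φ s) (e + s.card) ∧
    bd c = r (Finsupp.single s 1) + ∑ x : s, carrierLift Φ e r g (s.erase x)
termination_by s.card
decreasing_by exact Finset.card_lt_card (Finset.erase_ssubset x.2)

open Classical in
/-- The common core of the acyclic carrier theorems: if the sets `Φ s` have vanishing reduced
homology, then `bd ∘ g = r + g ∘ bd` can be solved with `g s` supported on `Φ s`. -/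
theorem exists_carrierLift {K : Set (Finset X)} (hK : IsLowerSet K) {Φ : Finset X → Set (Finset Y)}
    (hΦ : Monotone Φ) (hex : ∀ s ∈ K, s.Nonempty → ∀ q, ExactAt (Φ s) q) (e : ℕ)
    (r : (Finset X →₀ ZMod 2) →ₗ[ZMod 2] (Finset Y →₀ ZMod 2)) (g₀ : Finset Y →₀ ZMod 2)
    (hg : g₀ ∈ chains (Φ ∅) e) (hg' : bd g₀ = r (Finsupp.single ∅ 1))
    (hr : ∀ s ∈ K, s.Nonempty → r (Finsupp.single s 1) ∈ chains (Φ s) (e + (s.card - 1)))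
    (hr' : ∀ s ∈ K, bd (r (Finsupp.single s 1)) = r (bd (Finsupp.single s 1))) :
    ∃ g : (Finset X →₀ ZMod 2) →ₗ[ZMod 2] (Finset Y →₀ ZMod 2), g (Finsupp.single ∅ 1) = g₀ ∧
      ∀ s ∈ K, g (Finsupp.single s 1) ∈ chains (Φ s) (e + s.card) ∧
        bd (g (Finsupp.single s 1)) = r (Finsupp.single s 1) + g (bd (Finsupp.single s 1)) := by
  let g : (Finset X →₀ ZMod 2) →ₗ[ZMod 2] (Finset Y →₀ ZMod 2) :=
    Finsupp.linearCombination (ZMod 2) (carrierLift Φ e r g₀)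
  have hgs (s : Finset X) : g (Finsupp.single s 1) = carrierLift Φ e r g₀ s := by simp [g]
  have h0 : g (Finsupp.single ∅ 1) = g₀ := by rw [hgs, carrierLift, if_pos rfl]
  refine ⟨g, h0, fun s => ?_⟩
  induction hn : s.card using Nat.strong_induction_on generalizing s with
  | _ n ih =>
    subst hn
    intro hs
    rcases s.eq_empty_or_nonempty with rfl | hne
    · rw [h0]
      refine ⟨by simpa using hg, ?_⟩
      rw [hg', bd_single]; simp
    have hsum : g (bd (Finsupp.single s 1)) = ∑ x : s, carrierLift Φ e r g₀ (s.erase x) := by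
      rw [bd_single, map_sum, ← Finset.sum_coe_sort]
      exact Finset.sum_congr rfl fun x _ => hgs _
    have hface (x : X) (hx : x ∈ s) := ih (s.erase x).card
      (Finset.card_lt_card (Finset.erase_ssubset hx)) (s.erase x) rfl
      (hK (Finset.erase_subset x s) hs)
    have hmem : g (bd (Finsupp.single s 1)) ∈ chains (Φ s) (e + (s.card - 1)) := by
      rw [bd_single, map_sum]
      refine sum_mem fun x hx => chains_mono (hΦ (Finset.erase_subset x s)) _ ?_
      have := (hface x hx).1
      rwa [Finset.card_erase_of_mem hx] at this
    have hcyc : bd (g (bd (Finsupp.single s 1))) = r (bd (Finsupp.single s 1)) := by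
      have h2 : bd (g (bd (Finsupp.single s 1))) =
          r (bd (Finsupp.single s 1)) + g (bd (bd (Finsupp.single s 1))) := by
        rw [bd_single]
        simp only [map_sum]
        rw [← Finset.sum_add_distrib]
        exact Finset.sum_congr rfl fun x hx => (hface x hx).2
      rwa [bd_bd, map_zero, add_zero] at h2
    have hcard : e + (s.card - 1) + 1 = e + s.card := by
      have := hne.card_pos; omega
    have hE := hex s hs hne _ _ (add_mem (hr s hs hne) hmem)
      (by rw [map_add, hr' s hs, hcyc, chain_add_self])
    rw [hcard] at hE
    rw [hsum] at hE ⊢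
    rw [hgs, carrierLift, if_neg hne.ne_empty]
    exact Classical.epsilon_spec hE

/-- `φ` is an augmentation-preserving chain map on the complex `K` that sends each simplex `s` of
`K` to a chain of `Φ s`. -/
structure IsCarried (K : Set (Finset X)) (Φ : Finset X → Set (Finset Y))
    (φ : (Finset X →₀ ZMod 2) →ₗ[ZMod 2] (Finset Y →₀ ZMod 2)) : Prop where
  empty : φ (Finsupp.single ∅ 1) = Finsupp.single ∅ 1
  mem : ∀ s ∈ K, φ (Finsupp.single s 1) ∈ chains (Φ s) s.card
  comm : ∀ s ∈ K, bd (φ (Finsupp.single s 1)) = φ (bd (Finsupp.single s 1))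

theorem exists_isCarried {K : Set (Finset X)} (hK : IsLowerSet K) {Φ : Finset X → Set (Finset Y)}
    (hΦ : Monotone Φ) (hex : ∀ s ∈ K, s.Nonempty → ∀ q, ExactAt (Φ s) q) (h0 : ∅ ∈ Φ ∅) :
    ∃ φ, IsCarried K Φ φ := by
  classical
  obtain ⟨φ, h1, h2⟩ := exists_carrierLift hK hΦ hex 0 0 (Finsupp.single ∅ 1)
    (single_mem_chains h0 rfl 1) (by simp [bd_single]) (fun s _ _ => zero_mem _) (by simp)
  refine ⟨φ, h1, fun s hs => ?_, fun s hs => ?_⟩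
  · simpa using (h2 s hs).1
  · simpa using (h2 s hs).2

namespace IsCarried

theorem mono {K K' : Set (Finset X)} {Φ Φ' : Finset X → Set (Finset Y)}
    {φ : (Finset X →₀ ZMod 2) →ₗ[ZMod 2] (Finset Y →₀ ZMod 2)} (h : IsCarried K Φ φ)
    (hK : K' ⊆ K) (hΦ : ∀ s ∈ K', Φ s ⊆ Φ' s) : IsCarried K' Φ' φ where
  empty := h.empty
  mem s hs := chains_mono (hΦ s hs) _ (h.mem s (hK hs))
  comm s hs := h.comm s (hK hs)

theorem map_mem {K : Set (Finset X)} {Φ : Finset X → Set (Finset Y)}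
    {φ : (Finset X →₀ ZMod 2) →ₗ[ZMod 2] (Finset Y →₀ ZMod 2)} (h : IsCarried K Φ φ)
    {L : Set (Finset Y)} (hL : ∀ s ∈ K, Φ s ⊆ L) {q : ℕ} {z : Finset X →₀ ZMod 2}
    (hz : z ∈ chains K q) : φ z ∈ chains L q := by
  refine chains_induction (p := fun z => φ z ∈ chains L q) (by simp)
    (fun x y hx hy => by simpa using add_mem hx hy) (fun s hs hq => ?_) hz
  exact chains_mono (hL s hs) _ (hq ▸ h.mem s hs)

theorem bd_map {K : Set (Finset X)} {Φ : Finset X → Set (Finset Y)}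
    {φ : (Finset X →₀ ZMod 2) →ₗ[ZMod 2] (Finset Y →₀ ZMod 2)} (h : IsCarried K Φ φ)
    {q : ℕ} {z : Finset X →₀ ZMod 2} (hz : z ∈ chains K q) : bd (φ z) = φ (bd z) :=
  chains_induction (p := fun z => bd (φ z) = φ (bd z)) (by simp)
    (fun x y hx hy => by simp [hx, hy]) (fun s hs _ => h.comm s hs) hz

theorem comp {K : Set (Finset X)} {L : Set (Finset Y)} {Φ : Finset X → Set (Finset Y)}
    {Ψ : Finset Y → Set (Finset Z)} {Θ : Finset X → Set (Finset Z)}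
    {φ : (Finset X →₀ ZMod 2) →ₗ[ZMod 2] (Finset Y →₀ ZMod 2)}
    {ψ : (Finset Y →₀ ZMod 2) →ₗ[ZMod 2] (Finset Z →₀ ZMod 2)} (hψ : IsCarried L Ψ ψ)
    (hφ : IsCarried K Φ φ) (hL : ∀ s ∈ K, Φ s ⊆ L) (hΘ : ∀ s ∈ K, ∀ t ∈ Φ s, Ψ t ⊆ Θ s) :
    IsCarried K Θ (ψ ∘ₗ φ) where
  empty := by rw [LinearMap.comp_apply, hφ.empty, hψ.empty]
  mem s hs := (hψ.mono (hL s hs) (fun _ _ => subset_rfl)).map_mem (hΘ s hs) (hφ.mem s hs)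
  comm s hs := by
    rw [LinearMap.comp_apply, LinearMap.comp_apply, ← hφ.comm s hs]
    exact hψ.bd_map (chains_mono (hL s hs) _ (hφ.mem s hs))

theorem id (K : Set (Finset X)) : IsCarried K (fun s => {t | t ⊆ s}) LinearMap.id where
  empty := rfl
  mem s _ := single_mem_chains (Finset.Subset.refl s) rfl 1
  comm _ _ := rfl

/-- Two chain maps with a common acyclic carrier induce the same map in homology. -/
theorem homologous {K : Set (Finset X)} (hK : IsLowerSet K) {Φ : Finset X → Set (Finset Y)}
    (hΦ : Monotone Φ) (hex : ∀ s ∈ K, s.Nonempty → ∀ q, ExactAt (Φ s) q)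
    {φ ψ : (Finset X →₀ ZMod 2) →ₗ[ZMod 2] (Finset Y →₀ ZMod 2)} (hφ : IsCarried K Φ φ)
    (hψ : IsCarried K Φ ψ) {L : Set (Finset Y)} (hL : ∀ s ∈ K, Φ s ⊆ L) {q : ℕ}
    {z : Finset X →₀ ZMod 2} (hz : z ∈ chains K q) (hz0 : bd z = 0) :
    ∃ c ∈ chains L (q + 1), bd c = φ z + ψ z := by
  obtain ⟨g, -, hg⟩ := exists_carrierLift hK hΦ hex 1 (φ + ψ) 0 (zero_mem _)
    (by simp [hφ.empty, hψ.empty, chain_add_self])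
    (fun s hs hne => by
      have h1 : 1 + (s.card - 1) = s.card := by have := hne.card_pos; omega
      rw [h1]
      exact add_mem (hφ.mem s hs) (hψ.mem s hs))
    (fun s hs => by simp [hφ.comm s hs, hψ.comm s hs])
  have key : g z ∈ chains L (q + 1) ∧ bd (g z) = (φ + ψ) z + g (bd z) := by
    refine chains_induction
      (p := fun z => g z ∈ chains L (q + 1) ∧ bd (g z) = (φ + ψ) z + g (bd z)) (by simp)
      (fun x y hx hy => ⟨by simpa using add_mem hx.1 hy.1, ?_⟩) (fun s hs hq => ⟨?_, (hg s hs).2⟩)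
      hz
    · simp only [map_add, hx.2, hy.2]; abel
    · have := chains_mono (hL s hs) _ (hg s hs).1
      rwa [hq, add_comm] at this
  exact ⟨g z, key.1, by simpa [hz0] using key.2⟩

end IsCarried

end Chains

/-! ### Vietoris complexes and homotopy invariance of simplicial homology -/

/-- The Vietoris complex of a set `S` at scale `ε`: the finite subsets of `S` whose points have
pairwise distances less than `ε`. -/
def vietoris {E : Type*} [PseudoMetricSpace E] (ε : ℝ) (S : Set E) : Set (Finset E) :=
  {s | (∀ x ∈ s, x ∈ S) ∧ ∀ x ∈ s, ∀ y ∈ s, dist x y < ε}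

section Vietoris

theorem monotone_powerset_image {X Y : Type*} [DecidableEq Y] (f : X → Y) :
    Monotone fun s : Finset X => {t | t ⊆ s.image f} :=
  fun _ _ h _ ht => Finset.Subset.trans ht (Finset.image_subset_image h)

theorem exists_isCarried_image {X Y : Type*} [DecidableEq Y] {K : Set (Finset X)}
    (hK : IsLowerSet K) (f : X → Y) :
    ∃ φ, IsCarried K (fun s => {t | t ⊆ s.image f}) φ :=
  exists_isCarried hK (monotone_powerset_image f)
    (fun _ _ hs q => exactAt_powerset (hs.image f) q) (Finset.empty_subset _)

/-- Chain maps induced by the ends of a chain of pairwise contiguous vertex maps agree in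
homology. -/
theorem homologous_of_contiguous {X Y : Type*} [DecidableEq Y] {K : Set (Finset X)}
    (hK : IsLowerSet K)
    {L : Set (Finset Y)} (hL : IsLowerSet L) (f : ℕ → X → Y)
    (h0 : ∀ s ∈ K, s.image (f 0) ∈ L) (N : ℕ)
    (hf : ∀ j < N, ∀ s ∈ K, s.image (f j) ∪ s.image (f (j + 1)) ∈ L)
    {φ ψ : (Finset X →₀ ZMod 2) →ₗ[ZMod 2] (Finset Y →₀ ZMod 2)}
    (hφ : IsCarried K (fun s => {t | t ⊆ s.image (f 0)}) φ)
    (hψ : IsCarried K (fun s => {t | t ⊆ s.image (f N)}) ψ)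
    {q : ℕ} {z : Finset X →₀ ZMod 2} (hz : z ∈ chains K q) (hz0 : bd z = 0) :
    ∃ c ∈ chains L (q + 1), bd c = φ z + ψ z := by
  induction N generalizing ψ with
  | zero =>
    exact IsCarried.homologous hK (monotone_powerset_image _)
      (fun _ _ hs q => exactAt_powerset (hs.image _) q) hφ hψ
      (fun s hs t ht => hL ht (h0 s hs)) hz hz0
  | succ N ih =>
    obtain ⟨θ, hθ⟩ := exists_isCarried_image hK (f N)
    obtain ⟨c, hc, hc'⟩ := ih (fun j hj => hf j (hj.trans N.lt_succ_self)) hθ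
    obtain ⟨e, he, he'⟩ := IsCarried.homologous (φ := θ) (ψ := ψ)
      (Φ := fun s => {t | t ⊆ s.image (f N) ∪ s.image (f (N + 1))}) hK
      (fun _ _ h _ ht => Finset.Subset.trans ht
        (Finset.union_subset_union (Finset.image_subset_image h) (Finset.image_subset_image h)))
      (fun _ _ hs q => exactAt_powerset ((hs.image _).mono Finset.subset_union_left) q)
      (hθ.mono subset_rfl fun s _ t ht => Finset.Subset.trans ht Finset.subset_union_left)
      (hψ.mono subset_rfl fun s _ t ht => Finset.Subset.trans ht Finset.subset_union_right)
      (L := L) (fun s hs t ht => hL ht (hf N N.lt_succ_self s hs)) hz hz0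
    refine ⟨c + e, add_mem hc he, ?_⟩
    rw [map_add, hc', he']
    calc φ z + θ z + (θ z + ψ z) = φ z + (θ z + θ z) + ψ z := by abel
      _ = φ z + ψ z := by rw [chain_add_self, add_zero]

variable {E F : Type*} [PseudoMetricSpace E] [PseudoMetricSpace F]

theorem isLowerSet_vietoris (ε : ℝ) (S : Set E) : IsLowerSet (vietoris ε S) :=
  fun _ _ h hs => ⟨fun x hx => hs.1 x (h hx), fun x hx y hy => hs.2 x (h hx) y (h hy)⟩

theorem vietoris_mono {ε δ : ℝ} (h : δ ≤ ε) {S T : Set E} (hST : S ⊆ T) :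
    vietoris δ S ⊆ vietoris ε T :=
  fun _ hs => ⟨fun x hx => hST (hs.1 x hx), fun x hx y hy => (hs.2 x hx y hy).trans_le h⟩

theorem exists_image_mem_vietoris [DecidableEq F] {S : Set E} (hS : IsCompact S) {f : E → F}
    (hf : ContinuousOn f S) {T : Set F} (hT : Set.MapsTo f S T) {η : ℝ} (hη : 0 < η) :
    ∃ δ > 0, ∀ s ∈ vietoris δ S, s.image f ∈ vietoris η T := by
  obtain ⟨δ, hδ, h⟩ := Metric.uniformContinuousOn_iff.1
    (hS.uniformContinuousOn_of_continuous hf) η hη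
  refine ⟨δ, hδ, fun s hs => ⟨?_, ?_⟩⟩
  · simp only [Finset.mem_image]
    rintro _ ⟨x, hx, rfl⟩
    exact hT (hs.1 x hx)
  · simp only [Finset.mem_image]
    rintro _ ⟨x, hx, rfl⟩ _ ⟨y, hy, rfl⟩
    exact h x (hs.1 x hx) y (hs.1 y hy) (hs.2 x hx y hy)

/-- Homotopic maps of a compact set agree on the homology of Vietoris complexes of sufficiently
small scale. -/
theorem homologous_of_homotopy [DecidableEq F] {S : Set E} (hS : IsCompact S) {T : Set F}
    {H : ℝ × E → F}
    (hH : ContinuousOn H (Set.Icc 0 1 ×ˢ S)) (hT : Set.MapsTo H (Set.Icc 0 1 ×ˢ S) T)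
    {η : ℝ} (hη : 0 < η) :
    ∃ δ₀ > 0, ∀ δ ≤ δ₀, ∀ φ ψ : (Finset E →₀ ZMod 2) →ₗ[ZMod 2] (Finset F →₀ ZMod 2),
      IsCarried (vietoris δ S) (fun s => {t | t ⊆ s.image fun x => H (0, x)}) φ →
      IsCarried (vietoris δ S) (fun s => {t | t ⊆ s.image fun x => H (1, x)}) ψ →
      ∀ q, ∀ z ∈ chains (vietoris δ S) q, bd z = 0 →
        ∃ c ∈ chains (vietoris η T) (q + 1), bd c = φ z + ψ z := by
  obtain ⟨δ₀, hδ₀, h⟩ := Metric.uniformContinuousOn_iff.1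
    ((isCompact_Icc.prod hS).uniformContinuousOn_of_continuous hH) η hη
  refine ⟨δ₀, hδ₀, fun δ hδ φ ψ hφ hψ q z hz hz0 => ?_⟩
  obtain ⟨N, hN⟩ := exists_nat_one_div_lt hδ₀
  have hN0 : (0 : ℝ) < (N : ℝ) + 1 := by positivity
  have hI (j : ℕ) (hj : j ≤ N + 1) : ((j : ℝ) / ((N : ℝ) + 1)) ∈ Set.Icc (0 : ℝ) 1 := by
    refine ⟨by positivity, (div_le_one hN0).2 ?_⟩
    exact_mod_cast hj
  have hstep (j k : ℕ) (hj : j ≤ N + 1) (hk : k ≤ N + 1)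
      (hjk : |((j : ℝ) / ((N : ℝ) + 1)) - (k : ℝ) / ((N : ℝ) + 1)| < δ₀)
      (s : Finset E) (hs : s ∈ vietoris δ S) (x : E) (hx : x ∈ s) (y : E) (hy : y ∈ s) :
      dist (H ((j : ℝ) / ((N : ℝ) + 1), x)) (H ((k : ℝ) / ((N : ℝ) + 1), y)) < η := by
    refine h _ ⟨hI j hj, hs.1 x hx⟩ _ ⟨hI k hk, hs.1 y hy⟩ ?_
    rw [Prod.dist_eq, max_lt_iff]
    exact ⟨hjk, (hs.2 x hx y hy).trans_le hδ⟩
  have hself (j : ℕ) : |((j : ℝ) / ((N : ℝ) + 1)) - (j : ℝ) / ((N : ℝ) + 1)| < δ₀ := by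
    simpa using hδ₀
  have hsucc (j : ℕ) : |((j : ℝ) / ((N : ℝ) + 1)) - ((j + 1 : ℕ) : ℝ) / ((N : ℝ) + 1)| < δ₀ := by
    rw [← sub_div, Nat.cast_add_one, sub_add_cancel_left, abs_div, abs_neg, abs_one,
      abs_of_pos hN0]
    exact hN
  refine homologous_of_contiguous (isLowerSet_vietoris δ S) (isLowerSet_vietoris η T)
    (fun j x => H ((j : ℝ) / ((N : ℝ) + 1), x)) ?_ (N + 1) ?_ (φ := φ) (ψ := ψ) ?_ ?_ hz hz0
  · intro s hs
    constructor
    · simp only [Finset.mem_image]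
      rintro _ ⟨x, hx, rfl⟩
      exact hT ⟨hI 0 (Nat.zero_le _), hs.1 x hx⟩
    · simp only [Finset.mem_image]
      rintro _ ⟨x, hx, rfl⟩ _ ⟨y, hy, rfl⟩
      exact hstep 0 0 (Nat.zero_le _) (Nat.zero_le _) (hself 0) s hs x hx y hy
  · intro j hj s hs
    constructor
    · simp only [Finset.mem_union, Finset.mem_image]
      rintro _ (⟨x, hx, rfl⟩ | ⟨x, hx, rfl⟩)
      · exact hT ⟨hI j hj.le, hs.1 x hx⟩
      · exact hT ⟨hI (j + 1) hj, hs.1 x hx⟩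
    · simp only [Finset.mem_union, Finset.mem_image]
      rintro _ (⟨x, hx, rfl⟩ | ⟨x, hx, rfl⟩) _ (⟨y, hy, rfl⟩ | ⟨y, hy, rfl⟩)
      · exact hstep j j hj.le hj.le (hself j) s hs x hx y hy
      · exact hstep j (j + 1) hj.le hj (hsucc j) s hs x hx y hy
      · rw [dist_comm]
        exact hstep j (j + 1) hj.le hj (hsucc j) s hs y hy x hx
      · exact hstep (j + 1) (j + 1) hj hj (hself _) s hs x hx y hy
  · simpa using hφ
  · have h1 : (((N + 1 : ℕ) : ℝ) / ((N : ℝ) + 1)) = 1 := by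
      rw [Nat.cast_add_one, div_self hN0.ne']
    simpa only [h1] using hψ

/-- Vietoris complexes of convex sets have vanishing reduced homology: a cycle is contracted by
small homothetic steps towards a point. -/
theorem exactAt_vietoris {V : Type*} [NormedAddCommGroup V] [NormedSpace ℝ V] {S : Set V}
    (hS : Convex ℝ S) (hne : S.Nonempty) {ε : ℝ} (hε : 0 < ε) (q : ℕ) :
    ExactAt (vietoris ε S) q := by
  classical
  intro z hz hz0
  obtain ⟨x₀, hx₀⟩ := hne
  rw [mem_chains] at hz
  let P : Finset V := z.support.biUnion id
  let K : Set (Finset V) := {t | ∃ s ∈ z.support, t ⊆ s}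
  have hK : IsLowerSet K := fun a b h ⟨s, hs, has⟩ => ⟨s, hs, Finset.Subset.trans h has⟩
  have hzK : z ∈ chains K q := mem_chains.2 fun s hs =>
    ⟨⟨s, Finsupp.mem_support_iff.2 hs, Finset.Subset.refl s⟩, (hz s hs).2⟩
  have hKV : K ⊆ vietoris ε S := fun t ⟨s, hs, hts⟩ =>
    isLowerSet_vietoris ε S hts (hz s (Finsupp.mem_support_iff.1 hs)).1
  have hKP (t : Finset V) (ht : t ∈ K) (x : V) (hx : x ∈ t) : x ∈ P := by
    obtain ⟨s, hs, hts⟩ := ht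
    exact Finset.mem_biUnion.2 ⟨s, hs, hts hx⟩
  -- the distances within the simplices of `z` are bounded away from `ε`
  obtain ⟨ε', hε', hd⟩ : ∃ ε' < ε, ∀ t ∈ K, ∀ x ∈ t, ∀ y ∈ t, dist x y ≤ ε' := by
    have h1 : ∀ᶠ e in nhdsWithin ε (Set.Iio ε),
        ∀ p ∈ P ×ˢ P, dist p.1 p.2 < ε → dist p.1 p.2 ≤ e := by
      rw [Filter.eventually_all_finset]
      intro p _
      by_cases hp : dist p.1 p.2 < ε
      · filter_upwards [mem_nhdsWithin_of_mem_nhds (Ioi_mem_nhds hp)] with e he _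
        exact le_of_lt he
      · exact Filter.Eventually.of_forall fun e h => absurd h hp
    obtain ⟨e, he, he'⟩ := (h1.and self_mem_nhdsWithin).exists
    exact ⟨e, he', fun t ht x hx y hy => he (x, y)
      (Finset.mem_product.2 ⟨hKP t ht x hx, hKP t ht y hy⟩) ((hKV ht).2 x hx y hy)⟩
  obtain ⟨R, hR⟩ : ∃ R, ∀ x ∈ P, dist x x₀ ≤ R := by
    obtain ⟨R, hR⟩ := (P.image fun x => dist x x₀).bddAbove
    exact ⟨R, fun x hx => hR (Finset.mem_coe.2 (Finset.mem_image_of_mem _ hx))⟩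
  obtain ⟨N, hN⟩ := exists_nat_gt (max R 0 / (ε - ε'))
  have hεε : 0 < ε - ε' := sub_pos.2 hε'
  have hN0 : (0 : ℝ) < N := lt_of_le_of_lt (by positivity) hN
  have hRN : max R 0 / N < ε - ε' := by
    rw [div_lt_iff₀ hεε] at hN
    rw [div_lt_iff₀ hN0]
    linarith
  let f : ℕ → V → V := fun j x => AffineMap.lineMap x x₀ ((j : ℝ) / N)
  have hI (j : ℕ) (hj : j ≤ N) : (0 : ℝ) ≤ (j : ℝ) / N ∧ (j : ℝ) / N ≤ 1 :=
    ⟨by positivity, (div_le_one hN0).2 (by exact_mod_cast hj)⟩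
  have hfS (j : ℕ) (hj : j ≤ N) (t : Finset V) (ht : t ∈ K) (x : V) (hx : x ∈ t) : f j x ∈ S :=
    hS.lineMap_mem ((hKV ht).1 x hx) hx₀ (hI j hj)
  have hdist (j : ℕ) (hj : j ≤ N) (t : Finset V) (ht : t ∈ K) (x : V) (hx : x ∈ t) (y : V)
      (hy : y ∈ t) : dist (f j x) (f j y) ≤ ε' := by
    have h1 : f j x - f j y = (1 - (j : ℝ) / N) • (x - y) := by
      simp only [f, AffineMap.lineMap_apply_module, sub_smul, smul_sub, one_smul]
      abel
    have := hI j hj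
    rw [dist_eq_norm, h1, norm_smul, Real.norm_of_nonneg (by linarith), ← dist_eq_norm]
    have h2 := hd t ht x hx y hy
    have h3 : 0 ≤ dist x y := dist_nonneg
    nlinarith
  have hnext (j : ℕ) (t : Finset V) (ht : t ∈ K) (y : V) (hy : y ∈ t) :
      dist (f j y) (f (j + 1) y) < ε - ε' := by
    have h1 : f j y - f (j + 1) y = (1 / (N : ℝ)) • (y - x₀) := by
      simp only [f, AffineMap.lineMap_apply_module, Nat.cast_add_one, add_div, sub_smul, smul_sub,
        add_smul, one_smul]
      abel
    rw [dist_eq_norm, h1, norm_smul, Real.norm_of_nonneg (by positivity), ← dist_eq_norm]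
    refine lt_of_le_of_lt ?_ hRN
    rw [one_div, inv_mul_eq_div]
    gcongr
    exact (hR y (hKP t ht y hy)).trans (le_max_left _ _)
  obtain ⟨ψ, hψ⟩ := exists_isCarried_image hK (f N)
  have hid : IsCarried K (fun s => {t | t ⊆ s.image (f 0)}) LinearMap.id := by
    have h0 : f 0 = id := by ext x; simp [f]
    simpa only [h0, Finset.image_id] using IsCarried.id K
  have hstart (s : Finset V) (hs : s ∈ K) : s.image (f 0) ∈ vietoris ε S := by
    constructor
    · simp only [Finset.mem_image]
      rintro _ ⟨x, hx, rfl⟩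
      exact hfS 0 (Nat.zero_le _) s hs x hx
    · simp only [Finset.mem_image]
      rintro _ ⟨x, hx, rfl⟩ _ ⟨y, hy, rfl⟩
      exact (hdist 0 (Nat.zero_le _) s hs x hx y hy).trans_lt hε'
  have hcont (j : ℕ) (hj : j < N) (s : Finset V) (hs : s ∈ K) :
      s.image (f j) ∪ s.image (f (j + 1)) ∈ vietoris ε S := by
    have hcross (x : V) (hx : x ∈ s) (y : V) (hy : y ∈ s) : dist (f j x) (f (j + 1) y) < ε := by
      have := dist_triangle (f j x) (f j y) (f (j + 1) y)
      linarith [hdist j hj.le s hs x hx y hy, hnext j s hs y hy]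
    constructor
    · simp only [Finset.mem_union, Finset.mem_image]
      rintro _ (⟨x, hx, rfl⟩ | ⟨x, hx, rfl⟩)
      · exact hfS j hj.le s hs x hx
      · exact hfS (j + 1) hj s hs x hx
    · simp only [Finset.mem_union, Finset.mem_image]
      rintro _ (⟨x, hx, rfl⟩ | ⟨x, hx, rfl⟩) _ (⟨y, hy, rfl⟩ | ⟨y, hy, rfl⟩)
      · exact (hdist j hj.le s hs x hx y hy).trans_lt hε'
      · exact hcross x hx y hy
      · rw [dist_comm]; exact hcross y hy x hx
      · exact (hdist (j + 1) hj s hs x hx y hy).trans_lt hε'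
  obtain ⟨c, hc, hc'⟩ := homologous_of_contiguous hK (isLowerSet_vietoris ε S) f
    hstart N hcont hid hψ hzK hz0
  have hψz : ψ z ∈ chains {t | t ⊆ {x₀}} q := by
    refine hψ.map_mem (fun s _ t ht => Finset.Subset.trans ht fun y hy => ?_) hzK
    obtain ⟨x, -, rfl⟩ := Finset.mem_image.1 hy
    simp [f, div_self hN0.ne']
  obtain ⟨e, he, he'⟩ := exactAt_powerset (Finset.singleton_nonempty x₀) q _ hψz
    (by rw [hψ.bd_map hzK, hz0, map_zero])
  refine ⟨c + e, add_mem hc (chains_mono (fun t ht => ?_) _ he), ?_⟩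
  · have h1 (x : V) (hx : x ∈ t) : x = x₀ := Finset.mem_singleton.1 (ht hx)
    exact ⟨fun x hx => h1 x hx ▸ hx₀,
      fun x hx y hy => by rw [h1 x hx, h1 y hy, dist_self]; exact hε⟩
  · rw [map_add, hc', he', add_assoc, chain_add_self, add_zero, LinearMap.id_apply]

end Vietoris

/-! ### Simplicial homology of finite polyhedra and continuous maps -/

/-- The vertices at which a point has a non-zero barycentric coordinate. -/
noncomputable def carrier {ι : Type*} [Fintype ι] (x : ι → ℝ) : Finset ι :=
  open Classical in Finset.univ.filter fun i => x i ≠ 0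

/-- The geometric realization of a family of simplices, as a subspace of `ℝ^ι`. -/
def polyhedron {ι : Type*} [Fintype ι] (K : Set (Finset ι)) : Set (ι → ℝ) :=
  {x | x ∈ stdSimplex ℝ ι ∧ carrier x ∈ K}

section Polyhedra

variable {ι ι' : Type*} [Fintype ι] [Fintype ι']

theorem mem_carrier {x : ι → ℝ} {i : ι} : i ∈ carrier x ↔ x i ≠ 0 := by
  simp [carrier]

theorem carrier_subset_iff {x : ι → ℝ} {s : Finset ι} : carrier x ⊆ s ↔ ∀ i, i ∉ s → x i = 0 := by
  simp only [Finset.subset_iff, mem_carrier]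
  exact forall_congr' fun i => not_imp_comm

theorem mem_closedSimplex {s : Finset ι} {x : ι → ℝ} :
    x ∈ closedSimplex s ↔ x ∈ stdSimplex ℝ ι ∧ carrier x ⊆ s := by
  rw [carrier_subset_iff]; rfl

theorem closedSimplex_mono {s t : Finset ι} (h : s ⊆ t) : closedSimplex s ⊆ closedSimplex t :=
  fun _ hx => mem_closedSimplex.2
    ⟨hx.1, Finset.Subset.trans (mem_closedSimplex.1 hx).2 h⟩

theorem convex_closedSimplex (s : Finset ι) : Convex ℝ (closedSimplex s) := by
  intro x hx y hy a b ha hb hab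
  refine ⟨convex_stdSimplex ℝ ι hx.1 hy.1 ha hb hab, fun i hi => ?_⟩
  simp [hx.2 i hi, hy.2 i hi]

theorem closedSimplex_nonempty {s : Finset ι} (hs : s.Nonempty) : (closedSimplex s).Nonempty := by
  classical
  obtain ⟨i, hi⟩ := hs
  refine ⟨Pi.single i 1, single_mem_stdSimplex ℝ i, fun j hj => ?_⟩
  rw [Pi.single_eq_of_ne]
  rintro rfl
  exact hj hi

theorem isClosed_closedSimplex (s : Finset ι) : IsClosed (closedSimplex s) := by
  have : closedSimplex s = stdSimplex ℝ ι ∩ ⋂ i, ⋂ (_ : i ∉ s), {x : ι → ℝ | x i = 0} := by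
    ext x; simp only [Set.mem_inter_iff, Set.mem_iInter]; rfl
  rw [this]
  refine (isClosed_stdSimplex ℝ ι).inter (isClosed_iInter fun i => isClosed_iInter fun _ => ?_)
  exact isClosed_eq (continuous_apply i) continuous_const

theorem isCompact_closedSimplex (s : Finset ι) : IsCompact (closedSimplex s) :=
  (isCompact_stdSimplex ℝ ι).of_isClosed_subset (isClosed_closedSimplex s) fun _ hx => hx.1

theorem closedSimplex_subset_polyhedron {K : Set (Finset ι)} (hK : IsLowerSet K) {s : Finset ι}
    (hs : s ∈ K) : closedSimplex s ⊆ polyhedron K :=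
  fun _ hx => ⟨hx.1, hK (mem_closedSimplex.1 hx).2 hs⟩

theorem isCompact_polyhedron {K : Set (Finset ι)} (hK : IsLowerSet K) :
    IsCompact (polyhedron K) := by
  have : polyhedron K = ⋃ s ∈ K, closedSimplex s := by
    ext x
    simp only [Set.mem_iUnion, exists_prop]
    exact ⟨fun hx => ⟨_, hx.2, mem_closedSimplex.2 ⟨hx.1, Finset.Subset.refl _⟩⟩,
      fun ⟨s, hs, hx⟩ => closedSimplex_subset_polyhedron hK hs hx⟩
  rw [this]
  exact (Set.toFinite K).isCompact_biUnion fun s _ => isCompact_closedSimplex s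

/-- A vertex at which the barycentric coordinate is maximal. -/
noncomputable def topVertex [Nonempty ι] (x : ι → ℝ) : ι := (Finite.exists_max x).choose

theorem le_topVertex [Nonempty ι] (x : ι → ℝ) (j : ι) : x j ≤ x (topVertex x) :=
  (Finite.exists_max x).choose_spec j

theorem one_div_card_le_topVertex [Nonempty ι] {x : ι → ℝ} (hx : x ∈ stdSimplex ℝ ι) :
    1 / (Fintype.card ι : ℝ) ≤ x (topVertex x) := by
  have h0 : (0 : ℝ) < Fintype.card ι := by exact_mod_cast Fintype.card_pos
  rw [div_le_iff₀ h0, ← hx.2]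
  calc ∑ i, x i ≤ ∑ _i : ι, x (topVertex x) := Finset.sum_le_sum fun i _ => le_topVertex x i
    _ = x (topVertex x) * Fintype.card ι := by simp [mul_comm]

theorem dist_apply_lt {x y : ι → ℝ} {ε : ℝ} (h : dist x y < ε) (i : ι) : |x i - y i| < ε :=
  (Real.dist_eq (x i) (y i) ▸ dist_le_pi_dist x y i).trans_lt h

/-- Iterated subdivision: simplices are replaced by chains of small simplices inside them. -/
theorem exists_subdivision {K : Set (Finset ι)} (hK : IsLowerSet K) {δ : ℝ} (hδ : 0 < δ) :
    ∃ φ, IsCarried K (fun s => vietoris δ (closedSimplex s)) φ :=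
  exists_isCarried hK (fun _ _ h => vietoris_mono le_rfl (closedSimplex_mono h))
    (fun _ _ hs q => exactAt_vietoris (convex_closedSimplex _) (closedSimplex_nonempty hs) hδ q)
    ⟨by simp, by simp⟩

theorem image_topVertex_subset [Nonempty ι] [DecidableEq ι] {S : Set (ι → ℝ)}
    (hS : S ⊆ stdSimplex ℝ ι) {ε : ℝ} (hε : ε ≤ 1 / (Fintype.card ι : ℝ))
    {s : Finset (ι → ℝ)} (hs : s ∈ vietoris ε S) {x : ι → ℝ} (hx : x ∈ s) :
    s.image topVertex ⊆ carrier x := by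
  intro i hi
  obtain ⟨y, hy, rfl⟩ := Finset.mem_image.1 hi
  have h1 := one_div_card_le_topVertex (hS (hs.1 y hy))
  have h2 := (abs_lt.1 (dist_apply_lt (hs.2 y hy x hx) (topVertex y))).2
  rw [mem_carrier]
  linarith

/-- At small scale, sending a point to a vertex of maximal barycentric coordinate is a simplicial
map from the Vietoris complex of a polyhedron back to its triangulation. -/
theorem image_topVertex_mem [Nonempty ι] [DecidableEq ι] {K : Set (Finset ι)} (hK : IsLowerSet K)
    (h0 : ∅ ∈ K) {ε : ℝ} (hε : ε ≤ 1 / (Fintype.card ι : ℝ)) {s : Finset (ι → ℝ)}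
    (hs : s ∈ vietoris ε (polyhedron K)) : s.image topVertex ∈ K := by
  rcases s.eq_empty_or_nonempty with rfl | ⟨x, hx⟩
  · simpa using h0
  · exact hK (image_topVertex_subset (fun _ h => h.1) hε hs hx) (hs.1 x hx).2

/-- The map that removes the barycentric coordinates up to `η` and rescales. -/
noncomputable def trim (η : ℝ) (x : ι → ℝ) : ι → ℝ :=
  fun i => max (x i - η) 0 / ∑ j, max (x j - η) 0

theorem trim_sum_pos [Nonempty ι] {η : ℝ} (hη : η < 1 / (Fintype.card ι : ℝ)) {x : ι → ℝ}
    (hx : x ∈ stdSimplex ℝ ι) : 0 < ∑ j, max (x j - η) 0 := by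
  refine Finset.sum_pos' (fun i _ => le_max_right _ _) ⟨topVertex x, Finset.mem_univ _, ?_⟩
  exact lt_max_of_lt_left (by linarith [one_div_card_le_topVertex hx])

theorem trim_mem_stdSimplex [Nonempty ι] {η : ℝ} (hη : η < 1 / (Fintype.card ι : ℝ)) {x : ι → ℝ}
    (hx : x ∈ stdSimplex ℝ ι) : trim η x ∈ stdSimplex ℝ ι := by
  have h := trim_sum_pos hη hx
  refine ⟨fun i => div_nonneg (le_max_right _ _) h.le, ?_⟩
  simp only [trim]
  rw [← Finset.sum_div, div_self h.ne']

theorem mem_carrier_trim [Nonempty ι] {η : ℝ} (hη : η < 1 / (Fintype.card ι : ℝ)) {x : ι → ℝ}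
    (hx : x ∈ stdSimplex ℝ ι) {i : ι} : i ∈ carrier (trim η x) ↔ η < x i := by
  rw [mem_carrier, trim, div_ne_zero_iff, and_iff_left (trim_sum_pos hη hx).ne', Ne,
    max_eq_right_iff, not_le, sub_pos]

theorem continuousOn_trim [Nonempty ι] {η : ℝ} (hη : η < 1 / (Fintype.card ι : ℝ)) :
    ContinuousOn (trim η) (stdSimplex ℝ ι) := by
  refine continuousOn_pi.2 fun i => ContinuousOn.div ?_ ?_ fun x hx => (trim_sum_pos hη hx).ne'
  · exact Continuous.continuousOn (by fun_prop)
  · exact Continuous.continuousOn (by fun_prop)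

/-- Approximating small simplices of a polyhedron by simplices of its triangulation and subdividing
the result does not change homology classes. -/
theorem subdivision_topVertex_homologous [Nonempty ι] [DecidableEq ι] {K : Set (Finset ι)}
    (hK : IsLowerSet K)
    (h0 : ∅ ∈ K) {δ : ℝ} (hδ : 0 < δ) :
    ∃ ε₀ > 0, ∀ ε ≤ ε₀, ∀ ρ φ,
      IsCarried (vietoris ε (polyhedron K)) (fun s => {t | t ⊆ s.image topVertex}) ρ →
      IsCarried K (fun s => vietoris δ (closedSimplex s)) φ →
      ∀ q, ∀ z ∈ chains (vietoris ε (polyhedron K)) q, bd z = 0 →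
        ∃ c ∈ chains (vietoris δ (polyhedron K)) (q + 1), bd c = φ (ρ z) + z := by
  obtain ⟨η, hη0, hη⟩ : ∃ η : ℝ, 0 < η ∧ η < 1 / (Fintype.card ι : ℝ) := by
    refine exists_between ?_
    have : (0 : ℝ) < Fintype.card ι := by exact_mod_cast Fintype.card_pos
    positivity
  have hc := isCompact_polyhedron hK
  have hsub : polyhedron K ⊆ stdSimplex ℝ ι := fun _ h => h.1
  have htrim (x : ι → ℝ) (hx : x ∈ polyhedron K) : carrier (trim η x) ⊆ carrier x := by
    intro i hi
    rw [mem_carrier_trim hη hx.1] at hi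
    exact mem_carrier.2 (hη0.trans hi).ne'
  have htK : Set.MapsTo (trim η) (polyhedron K) (polyhedron K) := fun x hx =>
    ⟨trim_mem_stdSimplex hη hx.1, hK (htrim x hx) hx.2⟩
  have hcont : ContinuousOn (trim η) (polyhedron K) := (continuousOn_trim hη).mono hsub
  -- the straight-line homotopy from the identity to the trimming map
  let H : ℝ × (ι → ℝ) → (ι → ℝ) := fun p => (1 - p.1) • p.2 + p.1 • trim η p.2
  have hH : ContinuousOn H (Set.Icc 0 1 ×ˢ polyhedron K) := by
    have h1 : ContinuousOn (fun p : ℝ × (ι → ℝ) => trim η p.2) (Set.Icc 0 1 ×ˢ polyhedron K) :=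
      hcont.comp continuousOn_snd fun p hp => hp.2
    fun_prop
  have hHK : Set.MapsTo H (Set.Icc 0 1 ×ˢ polyhedron K) (polyhedron K) := by
    rintro ⟨t, x⟩ ⟨ht, hx⟩
    refine closedSimplex_subset_polyhedron hK hx.2 (convex_closedSimplex _
      (mem_closedSimplex.2 ⟨hx.1, Finset.Subset.refl _⟩)
      (mem_closedSimplex.2 ⟨(htK hx).1, htrim x hx⟩) (sub_nonneg.2 ht.2) ht.1 (by ring))
  obtain ⟨ε₁, hε₁, h1⟩ := homologous_of_homotopy hc hH hHK hδ
  obtain ⟨ε₂, hε₂, h2⟩ := exists_image_mem_vietoris hc hcont htK hδ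
  refine ⟨min (min ε₁ ε₂) η, by positivity, fun ε hε ρ φ hρ hφ q z hz hz0 => ?_⟩
  have hεη : ε ≤ η := hε.trans (min_le_right _ _)
  have hε1 : ε ≤ ε₁ := hε.trans ((min_le_left _ _).trans (min_le_left _ _))
  have hε2 : ε ≤ ε₂ := hε.trans ((min_le_left _ _).trans (min_le_right _ _))
  have hV := isLowerSet_vietoris ε (polyhedron K)
  obtain ⟨τ, hτ⟩ := exists_isCarried_image hV (trim η)
  have hH0 : (fun x => H (0, x)) = id := by ext x; simp [H]
  have hH1 : (fun x => H (1, x)) = trim η := by ext x; simp [H]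
  obtain ⟨c, hc, hc'⟩ := h1 ε hε1 LinearMap.id τ
    (by simpa only [hH0, Finset.image_id] using IsCarried.id _) (by simpa only [hH1] using hτ)
    q z hz hz0
  -- a common carrier of the trimming map and of subdivided approximation
  let Θ : Finset (ι → ℝ) → Finset ι := fun s => s.biUnion fun x => carrier (trim η x)
  have hΘ : Monotone Θ := fun s t h => Finset.biUnion_subset_biUnion_of_subset_left _ h
  have hΘK (s : Finset (ι → ℝ)) (hs : s ∈ vietoris ε (polyhedron K)) : Θ s ∈ K := by
    rcases s.eq_empty_or_nonempty with rfl | ⟨x, hx⟩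
    · simpa [Θ] using h0
    · refine hK (Finset.biUnion_subset.2 fun y hy i hi => ?_) (hs.1 x hx).2
      rw [mem_carrier_trim hη (hs.1 y hy).1] at hi
      have := (abs_lt.1 (dist_apply_lt (hs.2 y hy x hx) i)).2
      rw [mem_carrier]
      linarith
  have hΘne (s : Finset (ι → ℝ)) (hs : s ∈ vietoris ε (polyhedron K)) (hne : s.Nonempty) :
      (Θ s).Nonempty := by
    obtain ⟨x, hx⟩ := hne
    refine ⟨topVertex x, Finset.mem_biUnion.2 ⟨x, hx, ?_⟩⟩
    rw [mem_carrier_trim hη (hs.1 x hx).1]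
    exact hη.trans_le (one_div_card_le_topVertex (hs.1 x hx).1)
  have htop (s : Finset (ι → ℝ)) (hs : s ∈ vietoris ε (polyhedron K)) :
      s.image topVertex ⊆ Θ s := by
    intro i hi
    obtain ⟨x, hx, rfl⟩ := Finset.mem_image.1 hi
    refine Finset.mem_biUnion.2 ⟨x, hx, ?_⟩
    rw [mem_carrier_trim hη (hs.1 x hx).1]
    exact hη.trans_le (one_div_card_le_topVertex (hs.1 x hx).1)
  have hφρ : IsCarried (vietoris ε (polyhedron K))
      (fun s => vietoris δ (closedSimplex (Θ s))) (φ ∘ₗ ρ) :=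
    hφ.comp hρ (fun s hs t ht => hK (Finset.Subset.trans ht (htop s hs)) (hΘK s hs))
      fun s hs t ht => vietoris_mono le_rfl
        (closedSimplex_mono (Finset.Subset.trans ht (htop s hs)))
  have hτ' : IsCarried (vietoris ε (polyhedron K))
      (fun s => vietoris δ (closedSimplex (Θ s))) τ := by
    refine hτ.mono subset_rfl fun s hs t ht => ?_
    refine isLowerSet_vietoris _ _ ht ⟨fun y hy => ?_,
      (h2 s (vietoris_mono hε2 subset_rfl hs)).2⟩
    obtain ⟨x, hx, rfl⟩ := Finset.mem_image.1 hy
    exact mem_closedSimplex.2 ⟨(htK (hs.1 x hx)).1,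
      Finset.subset_biUnion_of_mem (fun x => carrier (trim η x)) hx⟩
  obtain ⟨e, he, he'⟩ := IsCarried.homologous hV
    (fun _ _ h => vietoris_mono le_rfl (closedSimplex_mono (hΘ h)))
    (fun s hs hne q => exactAt_vietoris (convex_closedSimplex _)
      (closedSimplex_nonempty (hΘne s hs hne)) hδ q) hφρ hτ'
    (L := vietoris δ (polyhedron K))
    (fun s hs => vietoris_mono le_rfl (closedSimplex_subset_polyhedron hK (hΘK s hs))) hz hz0
  refine ⟨c + e, add_mem hc he, ?_⟩
  rw [map_add, hc', he', LinearMap.id_apply, LinearMap.comp_apply]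
  calc z + τ z + (φ (ρ z) + τ z) = φ (ρ z) + z + (τ z + τ z) := by abel
    _ = φ (ρ z) + z := by rw [chain_add_self, add_zero]

/-- If a polyhedron `|K|` is a homotopy retract of a polyhedron `|L|`, then the reduced simplicial
homology of `K` is a retract of that of `L`. -/
theorem exists_homology_retract [Nonempty ι] [Nonempty ι'] {K : Set (Finset ι)}
    {L : Set (Finset ι')} (hK : IsLowerSet K) (hK0 : ∅ ∈ K) (hL : IsLowerSet L) (hL0 : ∅ ∈ L)
    {f : (ι → ℝ) → (ι' → ℝ)} {g : (ι' → ℝ) → (ι → ℝ)} (hf : ContinuousOn f (polyhedron K))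
    (hfL : Set.MapsTo f (polyhedron K) (polyhedron L)) (hg : ContinuousOn g (polyhedron L))
    (hgK : Set.MapsTo g (polyhedron L) (polyhedron K)) {H : ℝ × (ι → ℝ) → (ι → ℝ)}
    (hH : ContinuousOn H (Set.Icc 0 1 ×ˢ polyhedron K))
    (hHK : Set.MapsTo H (Set.Icc 0 1 ×ˢ polyhedron K) (polyhedron K))
    (hH0 : ∀ x ∈ polyhedron K, H (0, x) = x) (hH1 : ∀ x ∈ polyhedron K, H (1, x) = g (f x)) :
    ∃ (a : (Finset ι →₀ ZMod 2) →ₗ[ZMod 2] (Finset ι' →₀ ZMod 2))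
      (b : (Finset ι' →₀ ZMod 2) →ₗ[ZMod 2] (Finset ι →₀ ZMod 2)),
      (∀ q, ∀ z ∈ chains K q, a z ∈ chains L q ∧ bd (a z) = a (bd z)) ∧
      (∀ q, ∀ z ∈ chains L q, b z ∈ chains K q ∧ bd (b z) = b (bd z)) ∧
      ∀ q, ∀ z ∈ chains K q, bd z = 0 → ∃ c ∈ chains K (q + 1), bd c = b (a z) + z := by
  classical
  have hcK := isCompact_polyhedron hK
  have hcL := isCompact_polyhedron hL
  have hη : (0 : ℝ) < 1 / (Fintype.card ι : ℝ) := by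
    have : (0 : ℝ) < Fintype.card ι := by exact_mod_cast Fintype.card_pos
    positivity
  have hη' : (0 : ℝ) < 1 / (Fintype.card ι' : ℝ) := by
    have : (0 : ℝ) < Fintype.card ι' := by exact_mod_cast Fintype.card_pos
    positivity
  set η : ℝ := 1 / (Fintype.card ι : ℝ) with hηdef
  -- the scales are chosen in the order `η`, `δ'`, `ε`, `δ`
  obtain ⟨δ', hδ', hgV⟩ := exists_image_mem_vietoris hcL hg hgK hη
  obtain ⟨ε₀, hε₀, hsub⟩ := subdivision_topVertex_homologous hL hL0 hδ'
  set ε : ℝ := min (min ε₀ δ') (1 / (Fintype.card ι' : ℝ)) with hεdef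
  have hε : 0 < ε := by positivity
  have hεε₀ : ε ≤ ε₀ := (min_le_left _ _).trans (min_le_left _ _)
  have hεδ' : ε ≤ δ' := (min_le_left _ _).trans (min_le_right _ _)
  have hεL : ε ≤ 1 / (Fintype.card ι' : ℝ) := min_le_right _ _
  obtain ⟨δ₁, hδ₁, hfV⟩ := exists_image_mem_vietoris hcK hf hfL hε
  obtain ⟨δ₂, hδ₂, hhom⟩ := homologous_of_homotopy hcK hH hHK hη
  set δ : ℝ := min (min δ₁ δ₂) η with hδdef
  have hδ : 0 < δ := by positivity
  have hδδ₁ : δ ≤ δ₁ := (min_le_left _ _).trans (min_le_left _ _)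
  have hδδ₂ : δ ≤ δ₂ := (min_le_left _ _).trans (min_le_right _ _)
  have hδη : δ ≤ η := min_le_right _ _
  obtain ⟨sd, hsd⟩ := exists_subdivision hK hδ
  obtain ⟨sd', hsd'⟩ := exists_subdivision hL hδ'
  obtain ⟨F, hF⟩ := exists_isCarried_image (isLowerSet_vietoris δ (polyhedron K)) f
  obtain ⟨G, hG⟩ := exists_isCarried_image (isLowerSet_vietoris δ' (polyhedron L)) g
  obtain ⟨ρ, hρ⟩ := exists_isCarried_image (isLowerSet_vietoris η (polyhedron K)) topVertex
  obtain ⟨ρ', hρ'⟩ := exists_isCarried_image (isLowerSet_vietoris ε (polyhedron L)) topVertex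
  have sdK (s) (hs : s ∈ K) : vietoris δ (closedSimplex s) ⊆ vietoris δ (polyhedron K) :=
    vietoris_mono le_rfl (closedSimplex_subset_polyhedron hK hs)
  have sdL (s) (hs : s ∈ L) : vietoris δ' (closedSimplex s) ⊆ vietoris δ' (polyhedron L) :=
    vietoris_mono le_rfl (closedSimplex_subset_polyhedron hL hs)
  have FV (s) (hs : s ∈ vietoris δ (polyhedron K)) :
      {t | t ⊆ s.image f} ⊆ vietoris ε (polyhedron L) := fun t ht =>
    isLowerSet_vietoris _ _ ht (hfV s (vietoris_mono hδδ₁ subset_rfl hs))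
  have GV (s) (hs : s ∈ vietoris δ' (polyhedron L)) :
      {t | t ⊆ s.image g} ⊆ vietoris η (polyhedron K) := fun t ht =>
    isLowerSet_vietoris _ _ ht (hgV s hs)
  have ρK (s) (hs : s ∈ vietoris η (polyhedron K)) : {t | t ⊆ s.image topVertex} ⊆ K :=
    fun t ht => hK ht (image_topVertex_mem hK hK0 le_rfl hs)
  have ρL (s) (hs : s ∈ vietoris ε (polyhedron L)) : {t | t ⊆ s.image topVertex} ⊆ L :=
    fun t ht => hL ht (image_topVertex_mem hL hL0 hεL hs)
  have hVε : vietoris ε (polyhedron L) ⊆ vietoris δ' (polyhedron L) :=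
    vietoris_mono hεδ' subset_rfl
  have hVδ : vietoris δ (polyhedron K) ⊆ vietoris η (polyhedron K) :=
    vietoris_mono hδη subset_rfl
  refine ⟨ρ' ∘ₗ F ∘ₗ sd, ρ ∘ₗ G ∘ₗ sd', fun q z hz => ?_, fun q z hz => ?_, fun q z hz hz0 => ?_⟩
  · have h1 := hsd.map_mem sdK hz
    have h2 := hF.map_mem FV h1
    simp only [LinearMap.comp_apply]
    exact ⟨hρ'.map_mem ρL h2, by rw [hρ'.bd_map h2, hF.bd_map h1, hsd.bd_map hz]⟩
  · have h1 := hsd'.map_mem sdL hz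
    have h2 := hG.map_mem GV h1
    simp only [LinearMap.comp_apply]
    exact ⟨hρ.map_mem ρK h2, by rw [hρ.bd_map h2, hG.bd_map h1, hsd'.bd_map hz]⟩
  · simp only [LinearMap.comp_apply]
    have hu := hsd.map_mem sdK hz
    have hu0 : bd (sd z) = 0 := by rw [hsd.bd_map hz, hz0, map_zero]
    have hw := hF.map_mem FV hu
    have hw0 : bd (F (sd z)) = 0 := by rw [hF.bd_map hu, hu0, map_zero]
    obtain ⟨c₁, hc₁, hc₁'⟩ := hsub ε hεε₀ ρ' sd' hρ' hsd' q _ hw hw0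
    have hGF : IsCarried (vietoris δ (polyhedron K))
        (fun s => {t | t ⊆ s.image fun x => H (1, x)}) (G ∘ₗ F) := by
      refine hG.comp hF (fun s hs => (FV s hs).trans hVε) fun s hs t ht r hr => ?_
      refine Finset.Subset.trans hr fun y hy => ?_
      obtain ⟨x, hx, rfl⟩ := Finset.mem_image.1 hy
      obtain ⟨w, hw, rfl⟩ := Finset.mem_image.1 (ht hx)
      exact Finset.mem_image.2 ⟨w, hw, hH1 w (hs.1 w hw)⟩
    have hid : IsCarried (vietoris δ (polyhedron K))
        (fun s => {t | t ⊆ s.image fun x => H (0, x)}) LinearMap.id := by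
      refine (IsCarried.id _).mono subset_rfl fun s hs t ht => Finset.Subset.trans ht fun x hx => ?_
      exact Finset.mem_image.2 ⟨x, hx, hH0 x (hs.1 x hx)⟩
    obtain ⟨c₂, hc₂, hc₂'⟩ := hhom δ hδδ₂ LinearMap.id (G ∘ₗ F) hid hGF q _ hu hu0
    have hρsd : IsCarried K (fun s => {t | t ⊆ s}) (ρ ∘ₗ sd) := by
      refine hρ.comp hsd (fun s hs => (sdK s hs).trans hVδ) fun s hs t ht r hr => ?_
      refine Finset.Subset.trans hr fun i hi => ?_
      obtain ⟨x, hx, rfl⟩ := Finset.mem_image.1 hi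
      refine (mem_closedSimplex.1 (ht.1 x hx)).2 (mem_carrier.2 ?_)
      exact (hη.trans_le (one_div_card_le_topVertex (ht.1 x hx).1)).ne'
    obtain ⟨c₃, hc₃, hc₃'⟩ := IsCarried.homologous (Φ := fun s => {t | t ⊆ s})
      (φ := ρ ∘ₗ sd) (ψ := LinearMap.id) (L := K) hK
      (fun _ _ h _ ht => Finset.Subset.trans ht h) (fun s _ hs q => exactAt_powerset hs q)
      hρsd (IsCarried.id K) (fun s hs t ht => hK ht hs) hz hz0
    have hGc₁ := hG.map_mem GV hc₁
    refine ⟨ρ (G c₁) + ρ c₂ + c₃,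
      add_mem (add_mem (hρ.map_mem ρK hGc₁) (hρ.map_mem ρK hc₂)) hc₃, ?_⟩
    rw [map_add, map_add, hc₃', hρ.bd_map hGc₁, hG.bd_map hc₁, hρ.bd_map hc₂, hc₁', hc₂']
    simp only [map_add, LinearMap.comp_apply, LinearMap.id_apply]
    calc _ = ρ (G (sd' (ρ' (F (sd z))))) + z + (ρ (G (F (sd z))) + ρ (G (F (sd z))))
          + (ρ (sd z) + ρ (sd z)) := by abel
      _ = _ := by rw [chain_add_self, chain_add_self, add_zero, add_zero]

end Polyhedra

/-! ### Links and local homeomorphisms -/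

/-- `S` is the cone with apex `b` over the set `L`, and `t` is its radial coordinate. -/
structure IsConeOver {E : Type*} [NormedAddCommGroup E] [NormedSpace ℝ E] (S L : Set E) (b : E)
    (t : E → ℝ) : Prop where
  cont : Continuous t
  apex_mem : b ∈ S
  apex : t b = 0
  le_one : ∀ z ∈ S, t z ≤ 1
  mem : ∀ y ∈ L, ∀ τ ∈ Set.Icc (0 : ℝ) 1, b + τ • (y - b) ∈ S
  radius : ∀ y ∈ L, ∀ τ ∈ Set.Icc (0 : ℝ) 1, t (b + τ • (y - b)) = τ
  pos : ∀ z ∈ S, z ≠ b → 0 < t z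
  proj : ∀ z ∈ S, z ≠ b → b + (t z)⁻¹ • (z - b) ∈ L

section Cones

variable {E F : Type*} [NormedAddCommGroup E] [NormedSpace ℝ E] [NormedAddCommGroup F]
  [NormedSpace ℝ F]

namespace IsConeOver

theorem exists_radius_lt {S L : Set E} {b : E} {t : E → ℝ} (h : IsConeOver S L b t)
    (hL : IsCompact L) {V : Set E} (hV : V ∈ nhdsWithin b S) :
    ∃ ρ > 0, ∀ z ∈ S, t z < ρ → z ∈ V := by
  obtain ⟨ε, hε, hεV⟩ := Metric.mem_nhdsWithin_iff.1 hV
  have hcont : Continuous fun y => y - b := by fun_prop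
  obtain ⟨D, hD⟩ := (hL.image hcont).isBounded.exists_norm_le
  have hD1 : 0 < max D 1 := by positivity
  refine ⟨ε / max D 1, by positivity, fun z hz htz => hεV ⟨?_, hz⟩⟩
  by_cases hzb : z = b
  · rw [hzb]; exact Metric.mem_ball_self hε
  have h0 := h.pos z hz hzb
  have h1 := hD _ (Set.mem_image_of_mem _ (h.proj z hz hzb))
  rw [add_sub_cancel_left, norm_smul, norm_inv, Real.norm_of_nonneg h0.le] at h1
  rw [inv_mul_le_iff₀ h0] at h1
  rw [lt_div_iff₀ hD1] at htz
  rw [Metric.mem_ball, dist_eq_norm]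
  calc ‖z - b‖ ≤ t z * D := h1
    _ ≤ t z * max D 1 := by gcongr; exact le_max_left _ _
    _ < ε := htz

theorem continuousOn_proj {S L : Set E} {b : E} {t : E → ℝ} (h : IsConeOver S L b t) :
    ContinuousOn (fun z => b + (t z)⁻¹ • (z - b)) {z | z ∈ S ∧ z ≠ b} := by
  have h1 : ContinuousOn (fun z => (t z)⁻¹) {z | z ∈ S ∧ z ≠ b} :=
    h.cont.continuousOn.inv₀ fun z hz => (h.pos z hz.1 hz.2).ne'
  fun_prop

/-- Local topological invariance of links: if two cones over compact sets `L` and `L'` have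
homeomorphic neighbourhoods of their apices, then `L` is a homotopy retract of `L'`. The maps push
a small copy of one link to the other cone and project it radially; pushing back and forth is
homotopic to the identity by moving points radially in between. -/
theorem exists_homotopy_retract {S L : Set E} {b : E} {t : E → ℝ} {S' L' : Set F} {b' : F}
    {t' : F → ℝ} (h : IsConeOver S L b t) (h' : IsConeOver S' L' b' t') (hL : IsCompact L)
    (hL' : IsCompact L') {g : E → F} {g' : F → E} {V : Set E} {V' : Set F}
    (hV : V ∈ nhdsWithin b S) (hV' : V' ∈ nhdsWithin b' S') (hg : ContinuousOn g V)
    (hg' : ContinuousOn g' V') (hgS : Set.MapsTo g V S') (hgS' : Set.MapsTo g' V' S)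
    (hb : g b = b') (hb' : g' b' = b) (hinv : ∀ z ∈ V, g' (g z) = z)
    (hinv' : ∀ w ∈ V', g (g' w) = w) :
    ∃ (f : E → F) (f' : F → E) (H : ℝ × E → E), ContinuousOn f L ∧ Set.MapsTo f L L' ∧
      ContinuousOn f' L' ∧ Set.MapsTo f' L' L ∧ ContinuousOn H (Set.Icc 0 1 ×ˢ L) ∧
      Set.MapsTo H (Set.Icc 0 1 ×ˢ L) L ∧ (∀ x ∈ L, H (0, x) = x) ∧
      ∀ x ∈ L, H (1, x) = f' (f x) := by
  obtain ⟨r', hr', hrV'⟩ := h'.exists_radius_lt hL' hV'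
  -- small neighbourhoods of `b` are mapped into the cone of radius `r'`
  have hsmall : {z ∈ V | t' (g z) < r'} ∈ nhdsWithin b S := by
    have hbV : b ∈ V := mem_of_mem_nhdsWithin h.apex_mem hV
    have h1 : ContinuousWithinAt (fun z => t' (g z)) V b :=
      h'.cont.continuousAt.comp_continuousWithinAt (hg b hbV)
    have h2 : ∀ᶠ z in nhdsWithin b V, t' (g z) < r' :=
      h1.eventually (Iio_mem_nhds (by simpa only [hb, h'.apex] using hr'))
    exact Filter.inter_mem hV (nhdsWithin_le_of_mem hV h2)
  obtain ⟨r, hr, hrV⟩ := h.exists_radius_lt hL hsmall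
  obtain ⟨ε, hε0, hεr, hε1⟩ : ∃ ε : ℝ, 0 < ε ∧ ε < r ∧ ε ≤ 1 :=
    ⟨min (r / 2) 1, by positivity, (min_le_left _ _).trans_lt (by linarith), min_le_right _ _⟩
  obtain ⟨ε', hε0', hεr', hε1'⟩ : ∃ ε : ℝ, 0 < ε ∧ ε < r' ∧ ε ≤ 1 :=
    ⟨min (r' / 2) 1, by positivity, (min_le_left _ _).trans_lt (by linarith), min_le_right _ _⟩
  let P : Set E := {z | z ∈ S ∧ t z < r ∧ z ≠ b}
  let P' : Set F := {w | w ∈ S' ∧ t' w < r' ∧ w ≠ b'}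
  have hgP : Set.MapsTo g P P' := by
    rintro z ⟨hz, hzr, hzb⟩
    have hzV := hrV z hz hzr
    refine ⟨hgS hzV.1, hzV.2, fun e => hzb ?_⟩
    rw [← hinv z hzV.1, e, hb']
  have hgP' (w : F) (hw : w ∈ P') : g' w ∈ S ∧ g' w ≠ b := by
    have hwV := hrV' w hw.1 hw.2.1
    refine ⟨hgS' hwV, fun e => hw.2.2 ?_⟩
    rw [← hinv' w hwV, e, hb]
  have hcg : ContinuousOn g P := hg.mono fun z hz => (hrV z hz.1 hz.2.1).1
  have hcg' : ContinuousOn g' P' := hg'.mono fun w hw => hrV' w hw.1 hw.2.1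
  let ψ : E → F := fun z => b' + (t' (g z))⁻¹ • (g z - b')
  let φ : F → E := fun w => b + (t (g' w))⁻¹ • (g' w - b)
  have hψ : ContinuousOn ψ P :=
    h'.continuousOn_proj.comp hcg fun z hz => ⟨(hgP hz).1, (hgP hz).2.2⟩
  have hφ : ContinuousOn φ P' := h.continuousOn_proj.comp hcg' hgP'
  have hψL : Set.MapsTo ψ P L' := fun z hz => h'.proj _ (hgP hz).1 (hgP hz).2.2
  have hφL : Set.MapsTo φ P' L := fun w hw => h.proj _ (hgP' w hw).1 (hgP' w hw).2
  let p : E → E := fun y => b + ε • (y - b)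
  have hp : Set.MapsTo p L P := by
    intro y hy
    have h1 := h.radius y hy ε ⟨hε0.le, hε1⟩
    refine ⟨h.mem y hy ε ⟨hε0.le, hε1⟩, h1.trans_lt hεr, fun e => hε0.ne' ?_⟩
    rw [← h1]
    exact (congrArg t e).trans h.apex
  have hpc : Continuous p := by fun_prop
  have hP' (y : F) (hy : y ∈ L') (τ : ℝ) (h0 : 0 < τ) (hτ : τ < r') (h1 : τ ≤ 1) :
      b' + τ • (y - b') ∈ P' := by
    have h2 := h'.radius y hy τ ⟨h0.le, h1⟩
    refine ⟨h'.mem y hy τ ⟨h0.le, h1⟩, h2.trans_lt hτ, fun e => h0.ne' ?_⟩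
    rw [← h2]
    exact (congrArg t' e).trans h'.apex
  let f : E → F := fun y => ψ (p y)
  have hf : ContinuousOn f L := hψ.comp hpc.continuousOn hp
  have hfL : Set.MapsTo f L L' := hψL.comp hp
  have htp : ContinuousOn (fun y => t' (g (p y))) L :=
    h'.cont.comp_continuousOn (hcg.comp hpc.continuousOn hp)
  let q : ℝ × E → F := fun x =>
    b' + ((1 - x.1) * t' (g (p x.2)) + x.1 * ε') • (f x.2 - b')
  have hq : Set.MapsTo q (Set.Icc 0 1 ×ˢ L) P' := by
    rintro ⟨τ, y⟩ ⟨hτ, hy⟩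
    change τ ∈ Set.Icc (0 : ℝ) 1 at hτ
    change y ∈ L at hy
    have h1 := hgP (hp hy)
    have h2 := h'.pos _ h1.1 h1.2.2
    have h3 := h'.le_one _ h1.1
    have h4 := h1.2.1
    -- a convex combination of two radii in `(0, min r' 1]`
    have hlin (a c : ℝ) (ha : a < c) (h : ε' < c) : (1 - τ) * a + τ * ε' < c := by
      rcases hτ.1.eq_or_lt with h0 | h0
      · rw [← h0]; linarith
      · nlinarith [mul_le_mul_of_nonneg_left ha.le (sub_nonneg.2 hτ.2), mul_lt_mul_of_pos_left h h0]
    have hlin1 : (1 - τ) * t' (g (p y)) + τ * ε' ≤ 1 := by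
      nlinarith [mul_le_mul_of_nonneg_left h3 (sub_nonneg.2 hτ.2),
        mul_le_mul_of_nonneg_left hε1' hτ.1]
    have hlin0 : 0 < (1 - τ) * t' (g (p y)) + τ * ε' := by
      rcases hτ.1.eq_or_lt with h0 | h0
      · rw [← h0]; linarith
      · nlinarith [mul_nonneg (sub_nonneg.2 hτ.2) h2.le, mul_pos h0 hε0']
    exact hP' _ (hfL hy) _ hlin0 (hlin _ _ h4 hεr') hlin1
  have hqc : ContinuousOn q (Set.Icc 0 1 ×ˢ L) := by
    have h1 : ContinuousOn (fun x : ℝ × E => t' (g (p x.2))) (Set.Icc 0 1 ×ˢ L) :=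
      htp.comp continuousOn_snd fun x hx => hx.2
    have h2 : ContinuousOn (fun x : ℝ × E => f x.2) (Set.Icc 0 1 ×ˢ L) :=
      hf.comp continuousOn_snd fun x hx => hx.2
    have h3 : ContinuousOn (fun x : ℝ × E => (1 - x.1) * t' (g (p x.2)) + x.1 * ε')
        (Set.Icc 0 1 ×ˢ L) :=
      ((continuousOn_const.sub continuousOn_fst).mul h1).add
        (continuousOn_fst.mul continuousOn_const)
    exact continuousOn_const.add (h3.smul (h2.sub continuousOn_const))
  refine ⟨f, fun y => φ (b' + ε' • (y - b')), fun x => φ (q x), hf, hfL, ?_, ?_, ?_, ?_, ?_, ?_⟩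
  · exact hφ.comp (Continuous.continuousOn (by fun_prop)) fun y hy => hP' y hy ε' hε0' hεr' hε1'
  · exact fun y hy => hφL (hP' y hy ε' hε0' hεr' hε1')
  · exact hφ.comp hqc hq
  · exact hφL.comp hq
  · intro y hy
    have h1 := hgP (hp hy)
    have h2 := h'.pos _ h1.1 h1.2.2
    have h3 : q (0, y) = g (p y) := by
      simp only [q, f, ψ, sub_zero, one_mul, zero_mul, add_zero, add_sub_cancel_left]
      rw [smul_smul, mul_inv_cancel₀ h2.ne', one_smul, add_sub_cancel]
    have h4 : g' (g (p y)) = p y := hinv _ (hrV _ (hp hy).1 (hp hy).2.1).1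
    simp only [h3, φ, h4]
    rw [show t (p y) = ε from h.radius y hy ε ⟨hε0.le, hε1⟩]
    simp only [p, add_sub_cancel_left]
    rw [smul_smul, inv_mul_cancel₀ hε0.ne', one_smul, add_sub_cancel]
  · intro y hy
    simp [q]

end IsConeOver

end Cones

section Star

variable {ι : Type*}

/-- The simplices that lie in a common simplex of `K` with `s`. -/
def closedStar (K : Set (Finset ι)) (s : Finset ι) : Set (Finset ι) :=
  {u | ∃ T ∈ K, u ⊆ T ∧ s ⊆ T}

/-- The simplices of the closed star of `s` that do not contain `s`: the join of the boundary of
`s` with the link of `s`, which is the link of the barycentre of `s`. -/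
def starBoundary (K : Set (Finset ι)) (s : Finset ι) : Set (Finset ι) :=
  {u | u ∈ closedStar K s ∧ ¬ s ⊆ u}

theorem isLowerSet_closedStar (K : Set (Finset ι)) (s : Finset ι) :
    IsLowerSet (closedStar K s) :=
  fun _ _ h ⟨T, hT, hu, hs⟩ => ⟨T, hT, Finset.Subset.trans h hu, hs⟩

theorem isLowerSet_starBoundary (K : Set (Finset ι)) (s : Finset ι) :
    IsLowerSet (starBoundary K s) :=
  fun _ _ h hu => ⟨isLowerSet_closedStar K s h hu.1, fun hs => hu.2 (Finset.Subset.trans hs h)⟩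

theorem empty_mem_starBoundary {K : Set (Finset ι)} {s : Finset ι} (hs : s ∈ K)
    (hne : s.Nonempty) : ∅ ∈ starBoundary K s :=
  ⟨⟨s, hs, Finset.empty_subset _, Finset.Subset.refl _⟩,
    fun h => hne.ne_empty (Finset.subset_empty.1 h)⟩

/-- The barycentre of a simplex. -/
noncomputable def barycentre (s : Finset ι) : ι → ℝ :=
  open Classical in fun i => if i ∈ s then (s.card : ℝ)⁻¹ else 0

theorem barycentre_apply_mem {s : Finset ι} {i : ι} (hi : i ∈ s) :
    barycentre s i = (s.card : ℝ)⁻¹ := if_pos hi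

theorem barycentre_apply_notMem {s : Finset ι} {i : ι} (hi : i ∉ s) : barycentre s i = 0 :=
  if_neg hi

theorem barycentre_mem_closedSimplex [Fintype ι] {s : Finset ι} (hs : s.Nonempty) :
    barycentre s ∈ closedSimplex s := by
  classical
  have h0 : (s.card : ℝ) ≠ 0 := by exact_mod_cast hs.card_pos.ne'
  refine ⟨⟨fun i => ?_, ?_⟩, fun i hi => barycentre_apply_notMem hi⟩
  · rw [barycentre]; positivity
  · simp [barycentre, h0]

variable [Fintype ι]

/-- The closed star of a simplex is the cone over its boundary, from the barycentre. -/
theorem isConeOver_closedStar (K : Set (Finset ι)) {s : Finset ι} (hsK : s ∈ K)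
    (hs : s.Nonempty) :
    IsConeOver (polyhedron (closedStar K s)) (polyhedron (starBoundary K s)) (barycentre s)
      (fun z => 1 - s.card * s.inf' hs z) := by
  classical
  set m : ℝ := (s.card : ℝ) with hm
  have hm0 : 0 < m := by rw [hm]; exact_mod_cast hs.card_pos
  have hbary := (mem_closedSimplex.1 (barycentre_mem_closedSimplex hs))
  have hbs (i : ι) (hi : i ∈ s) : barycentre s i = m⁻¹ := barycentre_apply_mem hi
  have hinf0 (z : ι → ℝ) (hz : z ∈ stdSimplex ℝ ι) : 0 ≤ s.inf' hs z :=
    (Finset.le_inf'_iff hs _).2 fun i _ => hz.1 i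
  have hpos (z : ι → ℝ) (hz : z ∈ stdSimplex ℝ ι) (hzb : z ≠ barycentre s) :
      0 < 1 - m * s.inf' hs z := by
    by_contra hcon
    have hle (i : ι) (hi : i ∈ s) : m⁻¹ ≤ z i := by
      have h1 : s.inf' hs z ≤ z i := Finset.inf'_le _ hi
      rw [inv_le_iff_one_le_mul₀ hm0]
      nlinarith
    have hge (i : ι) (_ : i ∈ Finset.univ) : barycentre s i ≤ z i := by
      by_cases hi : i ∈ s
      · rw [hbs i hi]; exact hle i hi
      · rw [barycentre_apply_notMem hi]; exact hz.1 i
    have := (Finset.sum_eq_sum_iff_of_le hge).1 (by rw [hz.2, hbary.1.2])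
    exact hzb (funext fun i => (this i (Finset.mem_univ i)).symm)
  have hsub (c : ι → ℝ) (z : ι → ℝ) (hz : carrier z ∈ closedStar K s)
      (hc : ∀ i, i ∉ s → z i = 0 → c i = 0) : carrier c ∈ closedStar K s := by
    obtain ⟨T, hT, hzT, hsT⟩ := hz
    refine ⟨T, hT, carrier_subset_iff.2 fun i hi => hc i (fun h => hi (hsT h)) ?_, hsT⟩
    exact carrier_subset_iff.1 hzT i hi
  refine ⟨?_, ⟨hbary.1, s, hsK, hbary.2, Finset.Subset.refl _⟩, ?_, ?_, ?_, ?_, ?_, ?_⟩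
  · have : Continuous fun z : ι → ℝ => s.inf' hs z :=
      Continuous.finset_inf'_apply hs fun i _ => continuous_apply i
    fun_prop
  · have : s.inf' hs (barycentre s) = m⁻¹ := by
      rw [Finset.inf'_congr hs rfl hbs, Finset.inf'_const]
    simp only [this]
    rw [mul_inv_cancel₀ hm0.ne', sub_self]
  · intro z hz
    have := mul_nonneg hm0.le (hinf0 z hz.1)
    linarith
  · intro y hy τ hτ
    refine ⟨?_, hsub _ y hy.2.1 fun i hi hyi => ?_⟩
    · exact (convex_stdSimplex ℝ ι).add_smul_sub_mem hbary.1 hy.1 hτ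
    · simp [barycentre_apply_notMem hi, hyi]
  · intro y hy τ hτ
    obtain ⟨i₀, hi₀, hyi₀⟩ := Finset.not_subset.1 hy.2.2
    have hy0 : y i₀ = 0 := by simpa [mem_carrier] using hyi₀
    have h1 : s.inf' hs (barycentre s + τ • (y - barycentre s)) = (1 - τ) * m⁻¹ := by
      refine le_antisymm ((Finset.inf'_le _ hi₀).trans_eq ?_) ((Finset.le_inf'_iff hs _).2 ?_)
      · simp only [Pi.add_apply, Pi.smul_apply, Pi.sub_apply, smul_eq_mul, hbs i₀ hi₀, hy0]; ring
      · intro i hi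
        simp only [Pi.add_apply, Pi.smul_apply, Pi.sub_apply, smul_eq_mul, hbs i hi]
        nlinarith [mul_nonneg hτ.1 (hy.1.1 i)]
    rw [h1]
    field_simp
    ring
  · exact fun z hz hzb => hpos z hz.1 hzb
  · intro z hz hzb
    have ht := hpos z hz.1 hzb
    obtain ⟨i₀, hi₀, hmin⟩ := s.exists_mem_eq_inf' hs z
    set μ := s.inf' hs z with hμ
    have hval (i : ι) (hi : i ∈ s) :
        (barycentre s + (1 - m * μ)⁻¹ • (z - barycentre s)) i = (1 - m * μ)⁻¹ * (z i - μ) := by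
      simp only [Pi.add_apply, Pi.smul_apply, Pi.sub_apply, smul_eq_mul, hbs i hi]
      have := ht.ne'
      field_simp
      ring
    have hval' (i : ι) (hi : i ∉ s) :
        (barycentre s + (1 - m * μ)⁻¹ • (z - barycentre s)) i = (1 - m * μ)⁻¹ * z i := by
      simp [barycentre_apply_notMem hi]
    refine ⟨⟨fun i => ?_, ?_⟩, hsub _ z hz.2 fun i hi hzi => ?_, fun hcon => ?_⟩
    · by_cases hi : i ∈ s
      · rw [hval i hi]
        exact mul_nonneg (inv_nonneg.2 ht.le) (sub_nonneg.2 (Finset.inf'_le _ hi))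
      · rw [hval' i hi]
        exact mul_nonneg (inv_nonneg.2 ht.le) (hz.1.1 i)
    · simp only [Pi.add_apply, Pi.smul_apply, Pi.sub_apply, smul_eq_mul, Finset.sum_add_distrib,
        ← Finset.mul_sum, Finset.sum_sub_distrib, hz.1.2, hbary.1.2]
      ring
    · rw [hval' i hi, hzi, mul_zero]
    · have := mem_carrier.1 (hcon hi₀)
      rw [hval i₀ hi₀, hmin, sub_self, mul_zero] at this
      exact this rfl

end Star

/-! ### The local homology of triangulated manifolds -/

/-- `K` has the reduced homology mod 2 of a sphere of dimension `d - 1`, whose simplices of top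
dimension have `d` vertices. -/
structure HasSphereHomology {X : Type*} (K : Set (Finset X)) (d : ℕ) : Prop where
  exactAt : ∀ q, q ≠ d → ExactAt K q
  exists_cycle : ∃ z ∈ chains K d, bd z = 0 ∧ ¬ ∃ c ∈ chains K (d + 1), bd c = z
  homologous : ∀ z ∈ chains K d, ∀ w ∈ chains K d, bd z = 0 → bd w = 0 →
    (¬ ∃ c ∈ chains K (d + 1), bd c = z) → (¬ ∃ c ∈ chains K (d + 1), bd c = w) →
      ∃ c ∈ chains K (d + 1), bd c = z + w

theorem chains_eq_zero {X : Type*} {K : Set (Finset X)} {q : ℕ} (h : ∀ s ∈ K, s.card ≠ q)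
    {z : Finset X →₀ ZMod 2} (hz : z ∈ chains K q) : z = 0 := by
  rw [mem_chains] at hz
  ext s
  by_contra hs
  exact h s (hz s hs).1 (hz s hs).2

/-- The boundary of a simplex with `d + 1` vertices is a sphere. -/
theorem hasSphereHomology_boundary (d : ℕ) :
    HasSphereHomology (starBoundary Set.univ (Finset.univ : Finset (Fin (d + 1)))) d := by
  set B := starBoundary Set.univ (Finset.univ : Finset (Fin (d + 1))) with hB
  have hmem (u : Finset (Fin (d + 1))) : u ∈ B ↔ u.card ≠ d + 1 := by
    have hcard : u.card = d + 1 ↔ Finset.univ ⊆ u := by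
      rw [Finset.univ_subset_iff, ← Finset.card_eq_iff_eq_univ, Fintype.card_fin]
    rw [Ne, hcard]
    exact ⟨fun h => h.2, fun h =>
      ⟨⟨Finset.univ, trivial, Finset.subset_univ _, Finset.Subset.refl _⟩, h⟩⟩
  have hfill (q : ℕ) : ExactAt (Set.univ : Set (Finset (Fin (d + 1)))) q :=
    exactAt_of_cone (0 : Fin (d + 1)) (fun _ _ => Set.mem_univ _) q
  have htop (z) (hz : z ∈ chains B (d + 1)) : z = 0 :=
    chains_eq_zero (fun s hs => (hmem s).1 hs) hz
  have huniv (c : Finset (Fin (d + 1)) →₀ ZMod 2) (hc : c ∈ chains Set.univ (d + 1)) :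
      c = 0 ∨ c = Finsupp.single Finset.univ 1 := by
    have h1 : c = Finsupp.single Finset.univ (c Finset.univ) := by
      refine Finsupp.ext fun s => ?_
      by_cases hs : s = Finset.univ
      · rw [hs, Finsupp.single_eq_same]
      · rw [Finsupp.single_eq_of_ne hs]
        by_contra h0
        exact hs (Finset.card_eq_iff_eq_univ s |>.1 (by simpa using (mem_chains.1 hc s h0).2))
    have h2 : ∀ a : ZMod 2, a = 0 ∨ a = 1 := by decide
    rcases h2 (c Finset.univ) with h | h <;> rw [h] at h1
    · left; simpa using h1
    · right; exact h1
  refine ⟨fun q hq z hz hz0 => ?_, ?_, fun z hz w hw hz0 hw0 hzb hwb => ?_⟩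
  · obtain ⟨c, hc, hc'⟩ := hfill q z (chains_mono (Set.subset_univ _) _ hz) hz0
    refine ⟨c, mem_chains.2 fun s hs => ?_, hc'⟩
    have := (mem_chains.1 hc s hs).2
    exact ⟨(hmem s).2 (by omega), this⟩
  · refine ⟨bd (Finsupp.single Finset.univ 1), ?_, bd_bd _, fun ⟨c, hc, hc'⟩ => ?_⟩
    · rw [bd_single]
      refine sum_mem fun x hx => single_mem_chains ((hmem _).2 ?_) ?_ 1
      all_goals rw [Finset.card_erase_of_mem hx, Finset.card_univ, Fintype.card_fin]; omega
    · rw [htop c hc, map_zero, bd_single] at hc'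
      have h1 := DFunLike.congr_fun hc' (Finset.univ.erase 0)
      rw [Finsupp.finsetSum_apply, Finset.sum_eq_single 0] at h1
      · rw [Finsupp.single_eq_same] at h1
        exact zero_ne_one h1
      · intro y _ hy
        refine Finsupp.single_eq_of_ne fun h => hy ?_
        by_contra
        have h2 : y ∈ (Finset.univ : Finset (Fin (d + 1))).erase 0 := by simp [hy]
        rw [h] at h2
        exact Finset.notMem_erase _ _ h2
      · simp
  · have key (z) (hz : z ∈ chains B d) (hz0 : bd z = 0)
        (hzb : ¬ ∃ c ∈ chains B (d + 1), bd c = z) : z = bd (Finsupp.single Finset.univ 1) := by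
      obtain ⟨c, hc, hc'⟩ := hfill d z (chains_mono (Set.subset_univ _) _ hz) hz0
      rcases huniv c hc with rfl | rfl
      · exact absurd ⟨0, zero_mem _, hc'⟩ hzb
      · exact hc'.symm
    exact ⟨0, zero_mem _, by rw [key z hz hz0 hzb, key w hw hw0 hwb, chain_add_self, map_zero]⟩

section Local

variable {ι ι' : Type*} [Fintype ι] [Fintype ι']

/-- Local homology is a topological invariant: simplices whose barycentres have homeomorphic
neighbourhoods have links with the same homology. -/
theorem HasSphereHomology.of_local_homeomorphism {K : Set (Finset ι)} {K' : Set (Finset ι')}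
    {s : Finset ι} {s' : Finset ι'} (hsK : s ∈ K) (hsK' : s' ∈ K') (hs : s.Nonempty)
    (hs' : s'.Nonempty)
    {g : (ι → ℝ) → (ι' → ℝ)} {g' : (ι' → ℝ) → (ι → ℝ)} {V : Set (ι → ℝ)} {V' : Set (ι' → ℝ)}
    (hV : V ∈ nhdsWithin (barycentre s) (polyhedron (closedStar K s)))
    (hV' : V' ∈ nhdsWithin (barycentre s') (polyhedron (closedStar K' s')))
    (hg : ContinuousOn g V) (hg' : ContinuousOn g' V')
    (hgS : Set.MapsTo g V (polyhedron (closedStar K' s')))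
    (hgS' : Set.MapsTo g' V' (polyhedron (closedStar K s)))
    (hb : g (barycentre s) = barycentre s') (hb' : g' (barycentre s') = barycentre s)
    (hinv : ∀ z ∈ V, g' (g z) = z) (hinv' : ∀ w ∈ V', g (g' w) = w) {d : ℕ}
    (hd : HasSphereHomology (starBoundary K' s') d) :
    HasSphereHomology (starBoundary K s) d := by
  have hc := isConeOver_closedStar K hsK hs
  have hc' := isConeOver_closedStar K' hsK' hs'
  have hB := isLowerSet_starBoundary K s
  have hB' := isLowerSet_starBoundary K' s'
  have hk := isCompact_polyhedron hB
  have hk' := isCompact_polyhedron hB'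
  have hne : Nonempty ι := ⟨hs.choose⟩
  have hne' : Nonempty ι' := ⟨hs'.choose⟩
  obtain ⟨f₁, f₂, H, h1, h2, h3, h4, h5, h6, h7, h8⟩ :=
    hc.exists_homotopy_retract hc' hk hk' hV hV' hg hg' hgS hgS' hb hb' hinv hinv'
  obtain ⟨a, b, ha, hb₁, hab⟩ := exists_homology_retract hB (empty_mem_starBoundary hsK hs) hB'
    (empty_mem_starBoundary hsK' hs') h1 h2 h3 h4 h5 h6 h7 h8
  obtain ⟨f₁', f₂', H', h1', h2', h3', h4', h5', h6', h7', h8'⟩ :=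
    hc'.exists_homotopy_retract hc hk' hk hV' hV hg' hg hgS' hgS hb' hb hinv' hinv
  obtain ⟨a', b', ha', hb₁', hab'⟩ := exists_homology_retract hB'
    (empty_mem_starBoundary hsK' hs') hB (empty_mem_starBoundary hsK hs)
    h1' h2' h3' h4' h5' h6' h7' h8'
  -- a cycle whose image is a boundary is a boundary
  have hpull (q : ℕ) (z) (hz : z ∈ chains (starBoundary K s) q) (hz0 : bd z = 0)
      (h : ∃ c ∈ chains (starBoundary K' s') (q + 1), bd c = a z) :
      ∃ c ∈ chains (starBoundary K s) (q + 1), bd c = z := by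
    obtain ⟨c, hc, hc'⟩ := h
    obtain ⟨e, he, he'⟩ := hab q z hz hz0
    refine ⟨b c + e, add_mem (hb₁ _ c hc).1 he, ?_⟩
    rw [map_add, he', (hb₁ _ c hc).2, hc', ← add_assoc, chain_add_self, zero_add]
  have hcyc (q : ℕ) (z) (hz : z ∈ chains (starBoundary K s) q) (hz0 : bd z = 0) :
      bd (a z) = 0 := by rw [(ha q z hz).2, hz0, map_zero]
  refine ⟨fun q hq z hz hz0 => ?_, ?_, fun z hz w hw hz0 hw0 hzb hwb => ?_⟩
  · exact hpull q z hz hz0 (hd.exactAt q hq _ (ha q z hz).1 (hcyc q z hz hz0))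
  · obtain ⟨z, hz, hz0, hzb⟩ := hd.exists_cycle
    refine ⟨a' z, (ha' d z hz).1, by rw [(ha' d z hz).2, hz0, map_zero], fun ⟨c, hc, hc'⟩ => hzb ?_⟩
    obtain ⟨e, he, he'⟩ := hab' d z hz hz0
    refine ⟨b' c + e, add_mem (hb₁' _ c hc).1 he, ?_⟩
    rw [map_add, he', (hb₁' _ c hc).2, hc', ← add_assoc, chain_add_self, zero_add]
  · refine hpull d (z + w) (add_mem hz hw) (by rw [map_add, hz0, hw0, add_zero]) ?_
    rw [map_add]
    exact hd.homologous _ (ha d z hz).1 _ (ha d w hw).1 (hcyc d z hz hz0) (hcyc d w hw hw0)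
      (fun h => hzb (hpull d z hz hz0 h)) (fun h => hwb (hpull d w hw hw0 h))

end Local

/-- The affine isomorphism of `ℝᵈ` with the hyperplane of points with coordinate sum `1` in `ℝᵈ⁺¹`
that sends the origin to the barycentre of the standard simplex: the last `d` coordinates are
translated, and the first one is determined by them. -/
noncomputable def toHyperplane {d : ℕ} (x : EuclideanSpace ℝ (Fin d)) : Fin (d + 1) → ℝ :=
  fun i => ((d : ℝ) + 1)⁻¹ + Fin.cases (-∑ j, x j) (fun j => x j) i

/-- The inverse of `toHyperplane`. -/
noncomputable def ofHyperplane {d : ℕ} (w : Fin (d + 1) → ℝ) : EuclideanSpace ℝ (Fin d) :=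
  WithLp.toLp 2 fun j => w j.succ - ((d : ℝ) + 1)⁻¹

section Hyperplane

variable {d : ℕ}

theorem continuous_toHyperplane : Continuous (toHyperplane (d := d)) := by
  refine continuous_pi fun i => ?_
  refine Fin.cases ?_ (fun j => ?_) i
  · simp only [toHyperplane, Fin.cases_zero]; fun_prop
  · simp only [toHyperplane, Fin.cases_succ]; fun_prop

theorem continuous_ofHyperplane : Continuous (ofHyperplane (d := d)) := by
  unfold ofHyperplane; fun_prop

theorem ofHyperplane_toHyperplane (x : EuclideanSpace ℝ (Fin d)) :
    ofHyperplane (toHyperplane x) = x := by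
  ext j; simp [ofHyperplane, toHyperplane]

theorem sum_toHyperplane (x : EuclideanSpace ℝ (Fin d)) : ∑ i, toHyperplane x i = 1 := by
  have : (d : ℝ) + 1 ≠ 0 := by positivity
  rw [Fin.sum_univ_succ]
  simp only [toHyperplane, Fin.cases_zero, Fin.cases_succ, Finset.sum_add_distrib,
    Finset.sum_const, Finset.card_univ, Fintype.card_fin, nsmul_eq_mul]
  field_simp
  ring

theorem toHyperplane_ofHyperplane {w : Fin (d + 1) → ℝ} (hw : ∑ i, w i = 1) :
    toHyperplane (ofHyperplane w) = w := by
  have hsucc (j : Fin d) : toHyperplane (ofHyperplane w) j.succ = w j.succ := by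
    simp [ofHyperplane, toHyperplane]
  funext i
  refine Fin.cases ?_ hsucc i
  have h1 := sum_toHyperplane (ofHyperplane w)
  rw [Fin.sum_univ_succ, ← hw, Fin.sum_univ_succ] at h1
  simpa [hsucc] using h1

theorem toHyperplane_zero :
    toHyperplane 0 = barycentre (Finset.univ : Finset (Fin (d + 1))) := by
  funext i
  rw [barycentre_apply_mem (Finset.mem_univ i), toHyperplane, Finset.card_univ, Fintype.card_fin,
    Nat.cast_add_one]
  refine Fin.cases ?_ (fun j => ?_) i <;> simp

theorem ofHyperplane_barycentre :
    ofHyperplane (barycentre (Finset.univ : Finset (Fin (d + 1)))) = 0 := by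
  rw [← toHyperplane_zero, ofHyperplane_toHyperplane]

end Hyperplane

namespace AbstractSimplicialComplex

variable {ι : Type*} [Fintype ι]

/-- The faces of a complex together with the empty simplex. -/
def allFaces {ι : Type*} (M : AbstractSimplicialComplex ι) : Set (Finset ι) :=
  {s | s.Nonempty → s ∈ M.faces}

theorem mem_allFaces {ι : Type*} {M : AbstractSimplicialComplex ι} {s : Finset ι}
    (hs : s.Nonempty) : s ∈ M.allFaces ↔ s ∈ M.faces :=
  ⟨fun h => h hs, fun h _ => h⟩

theorem isLowerSet_allFaces {ι : Type*} (M : AbstractSimplicialComplex ι) :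
    IsLowerSet M.allFaces := fun _ _ hts hs hne =>
  (M.isRelLowerSet_faces (hs (hne.mono hts))).2 hts hne

theorem nonempty_of_mem_faces {ι : Type*} {M : AbstractSimplicialComplex ι} {s : Finset ι}
    (hs : s ∈ M.faces) : s.Nonempty := (M.isRelLowerSet_faces hs).1

theorem mem_realization {M : AbstractSimplicialComplex ι} {x : ι → ℝ} :
    x ∈ M.realization ↔ x ∈ stdSimplex ℝ ι ∧ carrier x ∈ M.faces := by
  constructor
  · rintro ⟨_, ⟨s, hs, rfl⟩, hx⟩
    refine ⟨hx.1, ?_⟩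
    refine (M.isLowerSet_allFaces (mem_closedSimplex.1 hx).2 fun _ => hs) ?_
    by_contra h
    rw [Finset.not_nonempty_iff_eq_empty] at h
    have h1 (i : ι) : x i = 0 := carrier_subset_iff.1 h.subset i (Finset.notMem_empty i)
    have h2 := hx.1.2
    simp [h1] at h2
  · rintro ⟨hx, hs⟩
    exact ⟨_, ⟨_, hs, rfl⟩, mem_closedSimplex.2 ⟨hx, Finset.Subset.refl _⟩⟩

theorem mem_polyhedron_closedStar {M : AbstractSimplicialComplex ι} {s : Finset ι} {x : ι → ℝ}
    (hx : x ∈ M.realization) (hs : ∀ i ∈ s, 0 < x i) :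
    x ∈ polyhedron (closedStar M.allFaces s) := by
  rw [mem_realization] at hx
  exact ⟨hx.1, carrier x, fun _ => hx.2, Finset.Subset.refl _,
    fun i hi => mem_carrier.2 (hs i hi).ne'⟩

theorem mem_openStar_of_mem_closedStar {M : AbstractSimplicialComplex ι} {s : Finset ι}
    {x : ι → ℝ} (hx : x ∈ polyhedron (closedStar M.allFaces s)) {v : ι} (hv : v ∈ s)
    (hs : ∀ i ∈ s, 0 < x i) : x ∈ M.openStar v := by
  obtain ⟨h1, T, hT, hxT, -⟩ := hx
  have h0 := hs v hv
  exact ⟨mem_realization.2 ⟨h1, M.isLowerSet_allFaces hxT hT ⟨v, mem_carrier.2 h0.ne'⟩⟩, h0⟩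

theorem eventually_pos_of_barycentre {ι : Type*} {s : Finset ι} (S : Set (ι → ℝ)) :
    ∀ᶠ x in nhdsWithin (barycentre s) S, ∀ i ∈ s, 0 < x i := by
  refine (Filter.eventually_all_finset s).2 fun i hi => ?_
  have h1 : 0 < barycentre s i := by
    rw [barycentre_apply_mem hi]
    have := Finset.card_pos.2 ⟨i, hi⟩
    positivity
  exact ((continuous_apply i).continuousWithinAt.eventually (Ioi_mem_nhds h1))

open Classical in
/-- In a triangulated `d`-manifold the links of barycentres of simplices have the homology of a
sphere of dimension `d - 1`. -/
theorem IsTriangulatedManifold.hasSphereHomology {M : AbstractSimplicialComplex ι} {d : ℕ}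
    (hM : M.IsTriangulatedManifold d) {s : Finset ι} (hs : s ∈ M.faces) :
    HasSphereHomology (starBoundary M.allFaces s) d := by
  have hne := nonempty_of_mem_faces hs
  obtain ⟨v, hv⟩ := id hne
  obtain ⟨h⟩ := hM v
  have hcone := isConeOver_closedStar M.allFaces (fun _ => hs) hne
  have hpos : ∀ i ∈ s, 0 < barycentre s i := by
    intro i hi
    rw [barycentre_apply_mem hi]
    have := Finset.card_pos.2 ⟨i, hi⟩
    positivity
  have hb : barycentre s ∈ M.openStar v := mem_openStar_of_mem_closedStar hcone.apex_mem hv hpos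
  let b : M.openStar v := ⟨barycentre s, hb⟩
  let g : (ι → ℝ) → (Fin (d + 1) → ℝ) := fun z =>
    if hz : z ∈ M.openStar v then toHyperplane (h ⟨z, hz⟩ - h b) else 0
  let g' : (Fin (d + 1) → ℝ) → (ι → ℝ) := fun w => (h.symm (ofHyperplane w + h b) : ι → ℝ)
  have hgv (z : ι → ℝ) (hz : z ∈ M.openStar v) : g z = toHyperplane (h ⟨z, hz⟩ - h b) := dif_pos hz
  have hgc : ContinuousOn g (M.openStar v) := by
    rw [continuousOn_iff_continuous_domRestrict]
    have : (M.openStar v).domRestrict g = fun z => toHyperplane (h z - h b) :=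
      funext fun z => hgv z z.2
    rw [this]
    exact continuous_toHyperplane.comp (h.continuous.sub continuous_const)
  have hg'c : Continuous g' := continuous_subtype_val.comp
    (h.symm.continuous.comp (continuous_ofHyperplane.add continuous_const))
  have hgb : g (barycentre s) = barycentre Finset.univ := by
    rw [hgv _ hb, sub_self, toHyperplane_zero]
  have hgb' : g' (barycentre Finset.univ) = barycentre s := by
    simp only [g', ofHyperplane_barycentre, zero_add, Homeomorph.symm_apply_apply, b]
  have hg'mem (w : Fin (d + 1) → ℝ) : g' w ∈ M.openStar v := (h.symm _).2
  have hmodel (w : Fin (d + 1) → ℝ) (hw : w ∈ stdSimplex ℝ (Fin (d + 1))) :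
      w ∈ polyhedron (closedStar Set.univ (Finset.univ : Finset (Fin (d + 1)))) :=
    ⟨hw, Finset.univ, trivial, Finset.subset_univ _, Finset.Subset.refl _⟩
  let S := polyhedron (closedStar M.allFaces s)
  let V : Set (ι → ℝ) := {z | z ∈ M.openStar v ∧ ∀ i ∈ Finset.univ, 0 < g z i}
  let V' : Set (Fin (d + 1) → ℝ) := {w | w ∈ stdSimplex ℝ (Fin (d + 1)) ∧ ∀ i ∈ s, 0 < g' w i}
  have hstar : M.openStar v ∈ nhdsWithin (barycentre s) S := by
    filter_upwards [eventually_pos_of_barycentre S, self_mem_nhdsWithin] with z hz hzS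
    exact mem_openStar_of_mem_closedStar hzS hv hz
  have hV : V ∈ nhdsWithin (barycentre s) S := by
    refine Filter.inter_mem hstar (nhdsWithin_le_of_mem hstar ?_)
    have h1 := hgc _ hb
    rw [ContinuousWithinAt, hgb, ← nhdsWithin_univ] at h1
    exact h1.eventually (eventually_pos_of_barycentre Set.univ)
  have hV' : V' ∈ nhdsWithin (barycentre (Finset.univ : Finset (Fin (d + 1))))
      (polyhedron (closedStar Set.univ Finset.univ)) := by
    have h1 : Filter.Tendsto g' (nhds (barycentre (Finset.univ : Finset (Fin (d + 1)))))
        (nhdsWithin (barycentre s) Set.univ) := by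
      rw [nhdsWithin_univ, ← hgb']; exact hg'c.continuousAt
    have h2 := h1.eventually (eventually_pos_of_barycentre (s := s) Set.univ)
    filter_upwards [nhdsWithin_le_nhds h2, self_mem_nhdsWithin] with w hw hwS
    exact ⟨hwS.1, hw⟩
  refine HasSphereHomology.of_local_homeomorphism (g := g) (g' := g') (V := V) (V' := V')
    (K := M.allFaces) (fun _ => hs) (Set.mem_univ _) ⟨v, hv⟩ Finset.univ_nonempty hV hV'
    (hgc.mono fun z hz => hz.1) hg'c.continuousOn (fun z hz => hmodel _ ⟨?_, ?_⟩) (fun w hw => ?_)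
    hgb hgb' (fun z hz => ?_) (fun w hw => ?_) (hasSphereHomology_boundary d)
  · exact fun i => (hz.2 i (Finset.mem_univ i)).le
  · rw [hgv z hz.1, sum_toHyperplane]
  · exact mem_polyhedron_closedStar (hg'mem w).1 hw.2
  · simp only [g', hgv z hz.1, ofHyperplane_toHyperplane, sub_add_cancel,
      Homeomorph.symm_apply_apply]
  · rw [hgv _ (hg'mem w)]
    simp only [g', Subtype.coe_eta, Homeomorph.apply_symm_apply, add_sub_cancel_right]
    exact toHyperplane_ofHyperplane hw.1.2

end AbstractSimplicialComplex

/-! ### Poincaré duality for homology manifolds -/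

section HomologyManifold

variable {ι : Type*} [Fintype ι] [DecidableEq ι]

theorem bd_apply (z : Finset ι →₀ ZMod 2) (t : Finset ι) :
    bd z t = ∑ x ∈ tᶜ, z (insert x t) := by
  induction z using Finsupp.induction_linear with
  | zero => simp
  | add f g hf hg => simp [hf, hg, Finset.sum_add_distrib]
  | single s a =>
    have ha : Finsupp.single s a = a • Finsupp.single s (1 : ZMod 2) := by simp
    rw [ha, map_smul, bd_single]
    simp only [Finsupp.smul_apply, ← Finset.smul_sum]
    congr 1
    rw [Finsupp.finsetSum_apply]
    simp only [Finsupp.single_apply]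
    rw [← Finset.sum_filter, ← Finset.sum_filter]
    congr 1
    ext x
    simp only [Finset.mem_filter, Finset.mem_compl]
    constructor
    · rintro ⟨hx, rfl⟩
      exact ⟨Finset.notMem_erase _ _, (Finset.insert_erase hx).symm⟩
    · rintro ⟨hx, rfl⟩
      exact ⟨Finset.mem_insert_self _ _, Finset.erase_insert hx⟩

/-- A homology manifold mod 2 of dimension `d`: all links have the homology of spheres. -/
def IsHomologyManifold {ι : Type*} (K : Set (Finset ι)) (d : ℕ) : Prop :=
  IsLowerSet K ∧ ∀ s ∈ K, s.Nonempty → HasSphereHomology (starBoundary K s) d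

/-- The part of a chain on the simplices that contain `s`. -/
noncomputable def restrictOver (s : Finset ι) (c : Finset ι → ZMod 2) : Finset ι →₀ ZMod 2 :=
  Finsupp.equivFunOnFinite.symm fun t => if s ⊆ t then c t else 0

omit [Fintype ι] [DecidableEq ι] in
theorem closedStar_exactAt (K : Set (Finset ι)) {s : Finset ι} (hs : s.Nonempty) (q : ℕ) :
    ExactAt (closedStar K s) q := by
  classical
  obtain ⟨v, hv⟩ := hs
  refine exactAt_of_cone v (fun u hu => ?_) q
  obtain ⟨T, hT, huT, hsT⟩ := hu
  exact ⟨T, hT, Finset.insert_subset (hsT hv) huT, hsT⟩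

omit [Fintype ι] [DecidableEq ι] in
theorem closedStar_subset {K : Set (Finset ι)} (hK : IsLowerSet K) (s : Finset ι) :
    closedStar K s ⊆ K := fun _ ⟨_, hT, hu, _⟩ => hK hu hT

omit [Fintype ι] [DecidableEq ι] in
theorem starBoundary_subset (K : Set (Finset ι)) (s : Finset ι) :
    starBoundary K s ⊆ closedStar K s := fun _ h => h.1

theorem restrictOver_apply {s t : Finset ι} (c : Finset ι → ZMod 2) (h : s ⊆ t) :
    restrictOver s c t = c t := if_pos h

theorem restrictOver_mem {K : Set (Finset ι)} (s : Finset ι) {c : Finset ι → ZMod 2} {q : ℕ}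
    (hc : ∀ t, c t ≠ 0 → t ∈ K ∧ t.card = q) : restrictOver s c ∈ chains (closedStar K s) q := by
  refine mem_chains.2 fun t ht => ?_
  have h : s ⊆ t := by
    by_contra h
    exact ht (if_neg h)
  rw [restrictOver_apply c h] at ht
  exact ⟨⟨t, (hc t ht).1, Finset.Subset.refl _, h⟩, (hc t ht).2⟩

/-- If `c` is a cycle relative to the complement of the open star of `s`, then the boundary of its
part in the star is supported on the boundary of the star. -/
theorem bd_restrictOver_mem {K : Set (Finset ι)} (s : Finset ι) {c : Finset ι → ZMod 2} {q : ℕ}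
    (hc : ∀ t, c t ≠ 0 → t ∈ K ∧ t.card = q + 1)
    (h0 : ∀ t, s ⊆ t → ∑ x ∈ tᶜ, c (insert x t) = 0) :
    bd (restrictOver s c) ∈ chains (starBoundary K s) q := by
  have h1 := mem_chains.1 (bd_mem_chains (isLowerSet_closedStar K s) (restrictOver_mem s hc))
  refine mem_chains.2 fun t ht => ⟨⟨(h1 t ht).1, fun hst => ht ?_⟩, (h1 t ht).2⟩
  rw [bd_apply, ← h0 t hst]
  exact Finset.sum_congr rfl fun x _ =>
    restrictOver_apply c (hst.trans (Finset.subset_insert _ _))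

omit [Fintype ι] [DecidableEq ι] in
theorem apply_eq_zero_of_mem_starBoundary {K : Set (Finset ι)} {s t : Finset ι}
    {e : Finset ι →₀ ZMod 2} {q : ℕ} (he : e ∈ chains (starBoundary K s) q) (hst : s ⊆ t) :
    e t = 0 := by
  by_contra h
  exact (mem_chains.1 he t h).1.2 hst

namespace IsHomologyManifold

variable {K : Set (Finset ι)} {d : ℕ}

/-- The local homology at a simplex `s` vanishes outside the top dimension. -/
theorem exists_coface_primitive (hK : IsHomologyManifold K d) {s : Finset ι} (hs : s ∈ K)
    (hne : s.Nonempty) {q : ℕ} (hq : q ≠ d + 1) {c : Finset ι → ZMod 2}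
    (hc : ∀ t, c t ≠ 0 → t ∈ K ∧ t.card = q)
    (h0 : ∀ t, s ⊆ t → ∑ x ∈ tᶜ, c (insert x t) = 0) :
    ∃ c' : Finset ι → ZMod 2, (∀ t, c' t ≠ 0 → t ∈ K ∧ t.card = q + 1) ∧
      ∀ t, s ⊆ t → ∑ x ∈ tᶜ, c' (insert x t) = c t := by
  rcases q with _ | q
  · refine ⟨0, fun t h => absurd rfl h, fun t hst => ?_⟩
    have : c t = 0 := by
      by_contra h
      have := (Finset.card_eq_zero.1 (hc t h).2)
      exact (hne.mono hst).ne_empty this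
    simp [this]
  · obtain ⟨e, he, he'⟩ := (hK.2 s hs hne).exactAt q (by omega) _ (bd_restrictOver_mem s hc h0)
      (bd_bd _)
    obtain ⟨f, hf, hf'⟩ := closedStar_exactAt K hne (q + 1) (restrictOver s c + e)
      (add_mem (restrictOver_mem s hc) (chains_mono (starBoundary_subset K s) _ he))
      (by rw [map_add, he', chain_add_self])
    refine ⟨f, fun t ht => ?_, fun t hst => ?_⟩
    · exact ⟨closedStar_subset hK.1 s (mem_chains.1 hf t ht).1, (mem_chains.1 hf t ht).2⟩
    · rw [← bd_apply, hf', Finsupp.add_apply, restrictOver_apply c hst,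
        apply_eq_zero_of_mem_starBoundary he hst, add_zero]

/-- A homology manifold is pure: every simplex lies in a simplex of dimension `d`. -/
theorem exists_facet (hK : IsHomologyManifold K d) {s : Finset ι} (hs : s ∈ K)
    (hne : s.Nonempty) : ∃ T ∈ K, T.card = d + 1 ∧ s ⊆ T := by
  obtain ⟨T, hsT, hT⟩ := (Set.toFinite K).exists_le_maximal hs
  refine ⟨T, hT.prop, ?_, hsT⟩
  by_contra hcard
  -- otherwise a maximal simplex would be a non-trivial class of its local homology
  have hmax (x : ι) (hx : x ∉ T) : insert x T ∉ K := fun h =>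
    hx (hT.le_of_ge h (Finset.subset_insert x T) (Finset.mem_insert_self x T))
  obtain ⟨c', hc', h1⟩ := hK.exists_coface_primitive hT.prop (hne.mono hsT) hcard
    (c := fun t => if t = T then 1 else 0) (fun t ht => by
      have : t = T := by by_contra h; exact ht (if_neg h)
      rw [this]; exact ⟨hT.prop, rfl⟩)
    (fun t hst => Finset.sum_eq_zero fun x hx => if_neg fun h => by
      have h2 : x ∈ t := hst (h ▸ Finset.mem_insert_self x t)
      exact Finset.mem_compl.1 hx h2)
  have h2 := h1 T (Finset.Subset.refl T)
  rw [if_pos rfl, Finset.sum_eq_zero] at h2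
  · exact zero_ne_one h2
  · intro x hx
    by_contra h
    exact hmax x (Finset.mem_compl.1 hx) (hc' _ h).1

theorem card_le (hK : IsHomologyManifold K d) {s : Finset ι} (hs : s ∈ K) : s.card ≤ d + 1 := by
  rcases s.eq_empty_or_nonempty with rfl | hne
  · simp
  · obtain ⟨T, _, hT, hsT⟩ := hK.exists_facet hs hne
    exact hT ▸ Finset.card_le_card hsT

/-- There is at most one non-zero class in the local homology of top dimension at `s`. As there are
no simplices of dimension `d + 1`, it determines the chain on the simplices that contain `s`. -/
theorem eq_of_closed (hK : IsHomologyManifold K d) {s : Finset ι} (hs : s ∈ K)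
    (hne : s.Nonempty) {c₁ c₂ : Finset ι → ZMod 2}
    (hc₁ : ∀ t, c₁ t ≠ 0 → t ∈ K ∧ t.card = d + 1) (hc₂ : ∀ t, c₂ t ≠ 0 → t ∈ K ∧ t.card = d + 1)
    (h₁ : ∀ t, s ⊆ t → ∑ x ∈ tᶜ, c₁ (insert x t) = 0)
    (h₂ : ∀ t, s ⊆ t → ∑ x ∈ tᶜ, c₂ (insert x t) = 0)
    (hn₁ : ∃ T, s ⊆ T ∧ c₁ T ≠ 0) (hn₂ : ∃ T, s ⊆ T ∧ c₂ T ≠ 0) (T : Finset ι) (hT : s ⊆ T) :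
    c₁ T = c₂ T := by
  have hB := starBoundary_subset K s
  have hfill (z e : Finset ι →₀ ZMod 2) (hz : z ∈ chains (closedStar K s) (d + 1))
      (he : e ∈ chains (starBoundary K s) (d + 1)) (h : bd e = bd z) : z = e := by
    obtain ⟨f, hf, hf'⟩ := closedStar_exactAt K hne (d + 1) (z + e)
      (add_mem hz (chains_mono hB _ he)) (by rw [map_add, h, chain_add_self])
    have : f = 0 := chains_eq_zero (fun t ht hcard => by
      have := hK.card_le (closedStar_subset hK.1 s ht); omega) hf
    rw [this, map_zero] at hf'
    exact chain_eq_of_add_eq_zero hf'.symm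
  have hnb (c : Finset ι → ZMod 2) (hc : ∀ t, c t ≠ 0 → t ∈ K ∧ t.card = d + 1)
      (hn : ∃ T, s ⊆ T ∧ c T ≠ 0) :
      ¬ ∃ e ∈ chains (starBoundary K s) (d + 1), bd e = bd (restrictOver s c) := by
    rintro ⟨e, he, he'⟩
    obtain ⟨T, hsT, hT⟩ := hn
    refine hT ?_
    rw [← restrictOver_apply c hsT, hfill _ _ (restrictOver_mem s hc) he he']
    exact apply_eq_zero_of_mem_starBoundary he hsT
  obtain ⟨e, he, he'⟩ := (hK.2 s hs hne).homologous _ (bd_restrictOver_mem s hc₁ h₁) _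
    (bd_restrictOver_mem s hc₂ h₂) (bd_bd _) (bd_bd _) (hnb c₁ hc₁ hn₁) (hnb c₂ hc₂ hn₂)
  have h3 := hfill (restrictOver s c₁ + restrictOver s c₂) e
    (add_mem (restrictOver_mem s hc₁) (restrictOver_mem s hc₂)) he (by rw [he', map_add])
  have h4 := DFunLike.congr_fun h3 T
  rw [Finsupp.add_apply, restrictOver_apply _ hT, restrictOver_apply _ hT,
    apply_eq_zero_of_mem_starBoundary he hT] at h4
  exact CharTwo.add_eq_zero.1 h4

/-- There is a non-zero class in the local homology of top dimension at `s`. -/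
theorem exists_closed (hK : IsHomologyManifold K d) {s : Finset ι} (hs : s ∈ K)
    (hne : s.Nonempty) :
    ∃ c : Finset ι → ZMod 2, (∀ t, c t ≠ 0 → t ∈ K ∧ t.card = d + 1) ∧
      (∀ t, s ⊆ t → ∑ x ∈ tᶜ, c (insert x t) = 0) ∧ ∃ T, s ⊆ T ∧ c T ≠ 0 := by
  obtain ⟨w, hw, hw0, hwb⟩ := (hK.2 s hs hne).exists_cycle
  obtain ⟨f, hf, hf'⟩ := closedStar_exactAt K hne d w
    (chains_mono (starBoundary_subset K s) _ hw) hw0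
  refine ⟨f, fun t ht => ⟨closedStar_subset hK.1 s (mem_chains.1 hf t ht).1,
    (mem_chains.1 hf t ht).2⟩, fun t hst => ?_, ?_⟩
  · rw [← bd_apply, hf', apply_eq_zero_of_mem_starBoundary hw hst]
  · by_contra! hcon
    refine hwb ⟨f, mem_chains.2 fun t ht => ⟨⟨(mem_chains.1 hf t ht).1, fun hst => ?_⟩,
      (mem_chains.1 hf t ht).2⟩, hf'⟩
    exact ht (hcon t hst)

open Classical in
/-- The indicator function of the simplices of dimension `d`, the fundamental cycle. -/
noncomputable def facetIndicator (K : Set (Finset ι)) (d : ℕ) (t : Finset ι) : ZMod 2 :=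
  if t ∈ K ∧ t.card = d + 1 then 1 else 0

omit [Fintype ι] [DecidableEq ι] in
theorem facetIndicator_ne_zero {t : Finset ι} (h : facetIndicator K d t ≠ 0) :
    t ∈ K ∧ t.card = d + 1 := by
  by_contra h'
  exact h (if_neg h')

omit [Fintype ι] [DecidableEq ι] in
theorem facetIndicator_of_mem {t : Finset ι} (h : t ∈ K) (h' : t.card = d + 1) :
    facetIndicator K d t = 1 := if_pos ⟨h, h'⟩

/-- Every simplex of dimension `d - 1` lies in an even number of simplices of dimension `d`: if a
locally closed chain `c` took the value `1` at one of them and `0` at another, then the sum of the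
two simplices would be a second class in local homology. -/
theorem sum_facetIndicator (hK : IsHomologyManifold K d) {t : Finset ι} (hne : t.Nonempty) :
    ∑ x ∈ tᶜ, facetIndicator K d (insert x t) = 0 := by
  by_cases ht : t ∈ K ∧ t.card = d
  swap
  · refine Finset.sum_eq_zero fun x hx => ?_
    by_contra h
    obtain ⟨h1, h2⟩ := facetIndicator_ne_zero h
    rw [Finset.card_insert_of_notMem (Finset.mem_compl.1 hx)] at h2
    exact ht ⟨hK.1 (Finset.subset_insert x t) h1, by omega⟩
  obtain ⟨htK, htd⟩ := ht
  obtain ⟨c, hc, hc0, T₀, htT₀, hT₀⟩ := hK.exists_closed htK hne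
  have hext (T : Finset ι) (htT : t ⊆ T) (hT : T.card = d + 1) : ∃ x, x ∉ t ∧ T = insert x t := by
    obtain ⟨x, hx⟩ := Finset.card_eq_one.1 (show (T \ t).card = 1 by
      rw [Finset.card_sdiff_of_subset htT]; omega)
    have h1 : x ∈ T \ t := hx ▸ Finset.mem_singleton_self x
    refine ⟨x, (Finset.mem_sdiff.1 h1).2, ?_⟩
    rw [← Finset.sdiff_union_of_subset htT, hx, Finset.singleton_union]
  have hone (T : Finset ι) (htT : t ⊆ T) (hT : T.card = d + 1) :
      ∑ x ∈ tᶜ, (if insert x t = T then (1 : ZMod 2) else 0) = 1 := by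
    obtain ⟨x, hx, rfl⟩ := hext T htT hT
    rw [Finset.sum_eq_single x]
    · rw [if_pos rfl]
    · intro y hy hyx
      refine if_neg fun h => hyx ?_
      have : y ∈ insert x t := h ▸ Finset.mem_insert_self y t
      exact (Finset.mem_insert.1 this).resolve_right (Finset.mem_compl.1 hy)
    · exact fun h => absurd (Finset.mem_compl.2 hx) h
  have hall (T : Finset ι) (htT : t ⊆ T) (hT : T ∈ K) (hTd : T.card = d + 1) : c T = 1 := by
    by_contra h1
    have hT0 : c T = 0 := by
      have : ∀ a : ZMod 2, a ≠ 1 → a = 0 := by decide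
      exact this _ h1
    have hne' : T ≠ T₀ := fun h => hT₀ (h ▸ hT0)
    let e : Finset ι → ZMod 2 := fun u => (if u = T₀ then 1 else 0) + if u = T then 1 else 0
    have he (u : Finset ι) (hu : e u ≠ 0) : u ∈ K ∧ u.card = d + 1 := by
      by_cases h2 : u = T₀
      · exact h2 ▸ hc T₀ hT₀
      · by_cases h3 : u = T
        · exact h3 ▸ ⟨hT, hTd⟩
        · exact absurd (by simp [e, h2, h3]) hu
    have hclosed (u : Finset ι) (hu : t ⊆ u) : ∑ x ∈ uᶜ, e (insert x u) = 0 := by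
      by_cases hut : u = t
      · rw [hut, Finset.sum_add_distrib, hone T₀ htT₀ (hc T₀ hT₀).2, hone T htT hTd]
        exact CharTwo.add_self_eq_zero 1
      · refine Finset.sum_eq_zero fun x hx => ?_
        by_contra h2
        have h3 := (he _ h2).2
        rw [Finset.card_insert_of_notMem (Finset.mem_compl.1 hx)] at h3
        exact hut (Finset.eq_of_subset_of_card_le hu (by omega)).symm
    have h4 := hK.eq_of_closed htK hne hc he hc0 hclosed ⟨T₀, htT₀, hT₀⟩
      ⟨T₀, htT₀, by simp [e, hne'.symm]⟩ T htT
    rw [hT0] at h4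
    simp [e, hne'] at h4
  rw [← hc0 t (Finset.Subset.refl t)]
  refine Finset.sum_congr rfl fun x hx => ?_
  by_cases h : insert x t ∈ K ∧ (insert x t).card = d + 1
  · rw [facetIndicator_of_mem h.1 h.2, hall _ (Finset.subset_insert x t) h.1 h.2]
  · rw [facetIndicator, if_neg h]
    by_contra h'
    exact h (hc _ (Ne.symm h'))

/-- The local homology in the top dimension is generated by the fundamental cycle. -/
theorem exists_eq_const (hK : IsHomologyManifold K d) {s : Finset ι} (hs : s ∈ K)
    (hne : s.Nonempty) {c : Finset ι → ZMod 2} (hc : ∀ t, c t ≠ 0 → t ∈ K ∧ t.card = d + 1)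
    (h0 : ∀ t, s ⊆ t → ∑ x ∈ tᶜ, c (insert x t) = 0) :
    ∃ a : ZMod 2, ∀ T ∈ K, T.card = d + 1 → s ⊆ T → c T = a := by
  by_cases h : ∃ T, s ⊆ T ∧ c T ≠ 0
  · refine ⟨1, fun T hT hTd hsT => ?_⟩
    obtain ⟨T₁, hT₁, hT₁d, hsT₁⟩ := hK.exists_facet hs hne
    rw [hK.eq_of_closed hs hne hc (fun t ht => facetIndicator_ne_zero ht) h0
      (fun t ht => hK.sum_facetIndicator (hne.mono ht)) h
      ⟨T₁, hsT₁, by rw [facetIndicator_of_mem hT₁ hT₁d]; exact one_ne_zero⟩ T hsT]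
    exact facetIndicator_of_mem hT hTd
  · push Not at h
    exact ⟨0, fun T _ _ hsT => h T hsT⟩

end IsHomologyManifold

/-- The coboundary in the first variable of a function on pairs of simplices `s ⊆ t`. -/
def cobdry (G : Finset ι → Finset ι → ZMod 2) (s t : Finset ι) : ZMod 2 :=
  ∑ x ∈ s, G (s.erase x) t

/-- The boundary in the second variable of a function on pairs of simplices `s ⊆ t`. -/
def bdry (G : Finset ι → Finset ι → ZMod 2) (s t : Finset ι) : ZMod 2 :=
  ∑ x ∈ tᶜ, G s (insert x t)

open Classical in
/-- A contraction of `cobdry`: for fixed `t`, the complex of cochains of the simplex `t` is coned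
off from a vertex of `t`. -/
noncomputable def cocone (G : Finset ι → Finset ι → ZMod 2) (s t : Finset ι) : ZMod 2 :=
  if ht : t.Nonempty then if ht.choose ∈ s then 0 else G (insert ht.choose s) t else 0

theorem cobdry_bdry (G : Finset ι → Finset ι → ZMod 2) (s t : Finset ι) :
    cobdry (bdry G) s t = bdry (cobdry G) s t := Finset.sum_comm

omit [Fintype ι] in
theorem cobdry_add (G H : Finset ι → Finset ι → ZMod 2) (s t : Finset ι) :
    cobdry (G + H) s t = cobdry G s t + cobdry H s t := Finset.sum_add_distrib

theorem bdry_add (G H : Finset ι → Finset ι → ZMod 2) (s t : Finset ι) :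
    bdry (G + H) s t = bdry G s t + bdry H s t := Finset.sum_add_distrib

theorem bdry_bdry (G : Finset ι → Finset ι → ZMod 2) (s t : Finset ι) :
    bdry (bdry G) s t = 0 := by
  have h1 (u : Finset ι) (c : Finset ι → ZMod 2) :
      ∑ x ∈ uᶜ, c (insert x u) = bd (Finsupp.equivFunOnFinite.symm c) u :=
    (bd_apply (Finsupp.equivFunOnFinite.symm c) u).symm
  have h2 := DFunLike.congr_fun (bd_bd (Finsupp.equivFunOnFinite.symm (G s))) t
  rw [bd_apply] at h2
  unfold bdry
  simp only [h1 _ (G s)]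
  exact h2

omit [Fintype ι] in
theorem cobdry_cobdry (G : Finset ι → Finset ι → ZMod 2) (s t : Finset ι) :
    cobdry (cobdry G) s t = 0 := by
  have key (z : Finset ι →₀ ZMod 2) :
      Finsupp.linearCombination (ZMod 2) (fun u => G u t) (bd z) =
        Finsupp.linearCombination (ZMod 2) (fun u => cobdry G u t) z := by
    induction z using Finsupp.induction_linear with
    | zero => simp
    | add f g hf hg => simp [hf, hg]
    | single s a =>
      have ha : Finsupp.single s a = a • Finsupp.single s (1 : ZMod 2) := by simp
      rw [ha, map_smul, map_smul, map_smul, bd_single]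
      simp [cobdry]
  have h := key (bd (Finsupp.single s 1))
  rw [bd_bd, map_zero, bd_single] at h
  rw [cobdry, h]
  simp

omit [Fintype ι] in
/-- The rows of the double complex are exact. -/
theorem cobdry_cocone {G : Finset ι → Finset ι → ZMod 2} {t : Finset ι} (ht : t.Nonempty)
    (h0 : ∀ s ⊆ t, cobdry G s t = 0) {s : Finset ι} (hs : s ⊆ t) :
    cobdry (cocone G) s t = G s t := by
  have hc (u : Finset ι) :
      cocone G u t = if ht.choose ∈ u then 0 else G (insert ht.choose u) t := dif_pos ht
  set v := ht.choose
  have hv : v ∈ t := ht.choose_spec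
  rw [cobdry]
  simp only [hc]
  by_cases hvs : v ∈ s
  · rw [Finset.sum_eq_single v]
    · rw [if_neg (Finset.notMem_erase _ _), Finset.insert_erase hvs]
    · intro y _ hy
      exact if_pos (Finset.mem_erase.2 ⟨hy.symm, hvs⟩)
    · exact fun h => absurd hvs h
  · have h1 := h0 (insert v s) (Finset.insert_subset hv hs)
    rw [cobdry, Finset.sum_insert hvs, Finset.erase_insert hvs, CharTwo.add_eq_zero] at h1
    rw [h1]
    refine Finset.sum_congr rfl fun y hy => ?_
    have hne : v ≠ y := fun e => hvs (e ▸ hy)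
    rw [if_neg (fun h => hvs (Finset.mem_of_mem_erase h)), Finset.erase_insert_of_ne hne]

omit [Fintype ι] in
theorem exists_of_cocone_ne_zero {G : Finset ι → Finset ι → ZMod 2}
    {s t : Finset ι} (h : cocone G s t ≠ 0) : ∃ v ∈ t, G (insert v s) t ≠ 0 := by
  by_cases ht : t.Nonempty
  · rw [cocone, dif_pos ht] at h
    by_cases hv : ht.choose ∈ s
    · exact absurd (if_pos hv) h
    · rw [if_neg hv] at h
      exact ⟨_, ht.choose_spec, h⟩
  · exact absurd (dif_neg ht) h

/-- The zigzag through the double complex of functions on pairs of simplices `s ⊆ t` that starts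
with `φ` times the fundamental cycle and alternates between the contraction `cocone` of the rows
and the boundary `bdry` of the columns. After `j` steps `s` has lost `j` vertices and so has `t`. -/
noncomputable def zigzag (K : Set (Finset ι)) (d : ℕ) (φ : Finset ι → ZMod 2) :
    ℕ → Finset ι → Finset ι → ZMod 2
  | 0 => fun s t => φ s * IsHomologyManifold.facetIndicator K d t
  | j + 1 => bdry (cocone (zigzag K d φ j))

section Zigzag

variable {K : Set (Finset ι)} {d : ℕ} {φ : Finset ι → ZMod 2}

theorem zigzag_support {j : ℕ} (hK : IsLowerSet K) {s t : Finset ι}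
    (h : zigzag K d φ j s t ≠ 0) : t ∈ K ∧ t.card + j = d + 1 := by
  induction j generalizing s t with
  | zero =>
    have := IsHomologyManifold.facetIndicator_ne_zero (right_ne_zero_of_mul h)
    exact this
  | succ j ih =>
    obtain ⟨x, hx, hx'⟩ := Finset.exists_ne_zero_of_sum_ne_zero h
    obtain ⟨v, -, hv⟩ := exists_of_cocone_ne_zero hx'
    obtain ⟨h1, h2⟩ := ih hv
    rw [Finset.card_insert_of_notMem (Finset.mem_compl.1 hx)] at h2
    exact ⟨hK (Finset.subset_insert x t) h1, by omega⟩

/-- The zigzag stays close to the support of `φ`. -/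
theorem zigzag_near {j : ℕ} {s t : Finset ι} (hst : s ⊆ t) (h : zigzag K d φ j s t ≠ 0) :
    ∃ s₀, φ s₀ ≠ 0 ∧ ∃ T ∈ K, T.card = d + 1 ∧ s₀ ⊆ T ∧ t ⊆ T := by
  induction j generalizing s t with
  | zero =>
    have := IsHomologyManifold.facetIndicator_ne_zero (right_ne_zero_of_mul h)
    exact ⟨s, left_ne_zero_of_mul h, t, this.1, this.2, hst, Finset.Subset.refl t⟩
  | succ j ih =>
    obtain ⟨x, hx, hx'⟩ := Finset.exists_ne_zero_of_sum_ne_zero h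
    obtain ⟨v, hvt, hv⟩ := exists_of_cocone_ne_zero hx'
    obtain ⟨s₀, h1, T, h2, h3, h4, h5⟩ :=
      ih (Finset.insert_subset hvt (hst.trans (Finset.subset_insert x t))) hv
    exact ⟨s₀, h1, T, h2, h3, h4, (Finset.subset_insert x t).trans h5⟩

theorem bdry_zigzag (hK : IsHomologyManifold K d) (j : ℕ) (s : Finset ι) {t : Finset ι}
    (ht : t.Nonempty) : bdry (zigzag K d φ j) s t = 0 := by
  cases j with
  | zero =>
    simp only [bdry, zigzag, ← Finset.mul_sum, hK.sum_facetIndicator ht, mul_zero]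
  | succ j => exact bdry_bdry _ s t

theorem cobdry_zigzag (hK : IsHomologyManifold K d) {k : ℕ}
    (hφ : ∀ s, φ s ≠ 0 → s ∈ K ∧ s.card = k + 1)
    (hcoc : ∀ u ∈ K, u.card = k + 2 → ∑ x ∈ u, φ (u.erase x) = 0) (j : ℕ) {t : Finset ι}
    (ht : t.Nonempty) : ∀ s ⊆ t, cobdry (zigzag K d φ j) s t = 0 := by
  induction j generalizing t with
  | zero =>
    intro s hs
    simp only [cobdry, zigzag, ← Finset.sum_mul]
    by_cases h : t ∈ K
    · rw [show ∑ x ∈ s, φ (s.erase x) = 0 from ?_, zero_mul]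
      by_cases hcard : s.card = k + 2
      · exact hcoc s (hK.1 hs h) hcard
      · refine Finset.sum_eq_zero fun x hx => ?_
        by_contra h'
        have := (hφ _ h').2
        rw [Finset.card_erase_of_mem hx] at this
        omega
    · rw [show IsHomologyManifold.facetIndicator K d t = 0 from if_neg fun h' => h h'.1, mul_zero]
  | succ j ih =>
    intro s hs
    rw [zigzag, cobdry_bdry, ← bdry_zigzag (φ := φ) hK j s ht]
    refine Finset.sum_congr rfl fun x _ => ?_
    exact cobdry_cocone (Finset.insert_nonempty x t) (ih (Finset.insert_nonempty x t))
      (hs.trans (Finset.subset_insert x t))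

/-- **Poincaré duality.** A `k`-cocycle `φ` has a dual `(d - k)`-cycle `z` that lies close to the
support of `φ` and that is not a boundary unless `φ` is a coboundary. -/
theorem exists_dual_cycle (hK : IsHomologyManifold K d) {k : ℕ} (hk : 0 < k) (hkd : k < d)
    (hφ : ∀ s, φ s ≠ 0 → s ∈ K ∧ s.card = k + 1)
    (hcoc : ∀ u ∈ K, u.card = k + 2 → ∑ x ∈ u, φ (u.erase x) = 0) :
    ∃ z : Finset ι → ZMod 2, (∀ t, z t ≠ 0 → t ∈ K ∧ t.card = d - k + 1) ∧
      (∀ t, t.Nonempty → ∑ x ∈ tᶜ, z (insert x t) = 0) ∧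
      (∀ t, z t ≠ 0 → ∃ s, φ s ≠ 0 ∧ ∃ T ∈ K, T.card = d + 1 ∧ s ⊆ T ∧ t ⊆ T) ∧
      ∀ y : Finset ι → ZMod 2, (∀ t, y t ≠ 0 → t ∈ K ∧ t.card = d - k + 2) →
        (∀ t, t.Nonempty → ∑ x ∈ tᶜ, y (insert x t) = z t) →
        ∃ ψ : Finset ι → ZMod 2, ∀ s ∈ K, s.card = k + 1 → ∑ x ∈ s, ψ (s.erase x) = φ s := by
  have hrow (j : ℕ) {s t : Finset ι} (ht : t.Nonempty) (hs : s ⊆ t) :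
      cobdry (cocone (zigzag K d φ j)) s t = zigzag K d φ j s t :=
    cobdry_cocone ht (cobdry_zigzag hK hφ hcoc j ht) hs
  refine ⟨cocone (zigzag K d φ k) ∅, fun t ht => ?_, fun t ht => ?_, fun t ht => ?_,
    fun y hy hyz => ?_⟩
  · obtain ⟨v, -, hv⟩ := exists_of_cocone_ne_zero ht
    have := zigzag_support hK.1 hv
    exact ⟨this.1, by omega⟩
  · obtain ⟨v, hv⟩ := ht
    have h := cobdry_zigzag hK hφ hcoc (k + 1) ⟨v, hv⟩ {v} (Finset.singleton_subset_iff.2 hv)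
    rw [cobdry, Finset.sum_singleton, Finset.erase_singleton] at h
    exact h
  · obtain ⟨v, hvt, hv⟩ := exists_of_cocone_ne_zero ht
    exact zigzag_near (Finset.insert_subset hvt (Finset.empty_subset t)) hv
  -- the zigzag back, by descending induction on the position `j` in the first zigzag
  have hzig (i : ℕ) (hi : i < k) : ∃ W E : Finset ι → Finset ι → ZMod 2,
      (∀ s t, W s t ≠ 0 → t ∈ K ∧ t.card + (k - i) = d + 2) ∧
      (∀ s t, t.Nonempty → s ⊆ t → cobdry E s t = zigzag K d φ (k - i) s t) ∧
      ∀ s t, s.card = i → t.Nonempty → s ⊆ t → bdry W s t = E s t := by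
    induction i with
    | zero =>
      refine ⟨fun s t => if s = ∅ then y t else 0, cocone (zigzag K d φ k), fun s t h => ?_,
        fun s t ht hs => hrow k ht hs, fun s t hs ht _ => ?_⟩
      · have hs : s = ∅ := by by_contra h'; exact h (if_neg h')
        simp only [if_pos hs] at h
        exact ⟨(hy t h).1, by have := (hy t h).2; omega⟩
      · rw [Finset.card_eq_zero.1 hs]
        simp only [bdry, if_true]
        exact hyz t ht
    | succ i ih =>
      obtain ⟨W, E, hW, hE, hWE⟩ := ih (by omega)
      obtain ⟨j, hj⟩ : ∃ j, k - i = j + 1 := ⟨k - i - 1, by omega⟩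
      have hj' : k - (i + 1) = j := by omega
      rw [hj] at hW hE
      rw [hj']
      set E' := cocone (zigzag K d φ j) + cobdry W with hE'
      have hsupp (s t : Finset ι) (h : E' s t ≠ 0) : t ∈ K ∧ t.card = d + 1 - j := by
        by_cases h1 : cocone (zigzag K d φ j) s t = 0
        · have h2 : cobdry W s t ≠ 0 := fun h2 => h (by
            rw [hE', Pi.add_apply, Pi.add_apply, h1, h2, add_zero])
          obtain ⟨x, -, hx⟩ := Finset.exists_ne_zero_of_sum_ne_zero h2
          exact ⟨(hW _ _ hx).1, by have := (hW _ _ hx).2; omega⟩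
        · obtain ⟨v, -, hv⟩ := exists_of_cocone_ne_zero h1
          have := zigzag_support hK.1 hv
          exact ⟨this.1, by omega⟩
      have hclosed (s t : Finset ι) (hs : s.card = i + 1) (hst : s ⊆ t) : bdry E' s t = 0 := by
        have ht : t.Nonempty := (Finset.card_pos.1 (by omega : 0 < s.card)).mono hst
        rw [hE', bdry_add, ← cobdry_bdry]
        have h1 : cobdry (bdry W) s t = cobdry E s t := Finset.sum_congr rfl fun x hx =>
          hWE _ t (by rw [Finset.card_erase_of_mem hx]; omega) ht
            ((Finset.erase_subset x s).trans hst)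
        rw [h1, hE s t ht hst]
        exact CharTwo.add_self_eq_zero _
      have hprim (s : Finset ι) : ∃ w : Finset ι → ZMod 2,
          (∀ t, w t ≠ 0 → t ∈ K ∧ t.card + j = d + 2) ∧
          (s.card = i + 1 → ∀ t, s ⊆ t → ∑ x ∈ tᶜ, w (insert x t) = E' s t) := by
        by_cases hs : s ∈ K ∧ s.card = i + 1
        · obtain ⟨w, hw, hw'⟩ := hK.exists_coface_primitive hs.1
            (Finset.card_pos.1 (by omega : 0 < s.card)) (q := d + 1 - j) (by omega) (hsupp s)
            (fun t hst => hclosed s t hs.2 hst)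
          exact ⟨w, fun t ht => ⟨(hw t ht).1, by have := (hw t ht).2; omega⟩, fun _ => hw'⟩
        · refine ⟨0, fun t h => absurd rfl h, fun hcard t hst => ?_⟩
          have : E' s t = 0 := by
            by_contra h
            exact hs ⟨hK.1 hst (hsupp s t h).1, hcard⟩
          simp [this]
      choose W' hW' hWE' using hprim
      refine ⟨W', E', hW', fun s t ht hst => ?_, fun s t hs _ hst => hWE' s hs t hst⟩
      rw [hE', cobdry_add, hrow j ht hst, cobdry_cobdry, add_zero]
  obtain ⟨W, E, hW, hE, hWE⟩ := hzig (k - 1) (by omega)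
  have hk1 : k - (k - 1) = 1 := by omega
  rw [hk1] at hW hE
  set E' := cocone (zigzag K d φ 0) + cobdry W with hE'
  have hsupp (s t : Finset ι) (h : E' s t ≠ 0) : t ∈ K ∧ t.card = d + 1 := by
    by_cases h1 : cocone (zigzag K d φ 0) s t = 0
    · have h2 : cobdry W s t ≠ 0 := fun h2 => h (by
        rw [hE', Pi.add_apply, Pi.add_apply, h1, h2, add_zero])
      obtain ⟨x, -, hx⟩ := Finset.exists_ne_zero_of_sum_ne_zero h2
      exact ⟨(hW _ _ hx).1, by have := (hW _ _ hx).2; omega⟩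
    · obtain ⟨v, -, hv⟩ := exists_of_cocone_ne_zero h1
      exact zigzag_support hK.1 hv
  have hclosed (s t : Finset ι) (hs : s.card = k) (hst : s ⊆ t) : bdry E' s t = 0 := by
    have ht : t.Nonempty := (Finset.card_pos.1 (by omega : 0 < s.card)).mono hst
    rw [hE', bdry_add, ← cobdry_bdry]
    have h1 : cobdry (bdry W) s t = cobdry E s t := Finset.sum_congr rfl fun x hx =>
      hWE _ t (by rw [Finset.card_erase_of_mem hx]; omega) ht
        ((Finset.erase_subset x s).trans hst)
    rw [h1, hE s t ht hst]
    exact CharTwo.add_self_eq_zero _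
  have hconst (s : Finset ι) : ∃ a : ZMod 2,
      s ∈ K → s.card = k → ∀ T ∈ K, T.card = d + 1 → s ⊆ T → E' s T = a := by
    by_cases hs : s ∈ K ∧ s.card = k
    · obtain ⟨a, ha⟩ := hK.exists_eq_const hs.1 (Finset.card_pos.1 (by omega : 0 < s.card))
        (hsupp s) (fun t hst => hclosed s t hs.2 hst)
      exact ⟨a, fun _ _ => ha⟩
    · exact ⟨0, fun h1 h2 => absurd ⟨h1, h2⟩ hs⟩
  choose ψ hψ using hconst
  refine ⟨ψ, fun s hs hcard => ?_⟩
  obtain ⟨T, hT, hTd, hsT⟩ := hK.exists_facet hs (Finset.card_pos.1 (by omega : 0 < s.card))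
  have hTne : T.Nonempty := Finset.card_pos.1 (by omega)
  have h1 : cobdry E' s T = φ s := by
    rw [hE', cobdry_add, hrow 0 hTne hsT, cobdry_cobdry, add_zero]
    simp only [zigzag, IsHomologyManifold.facetIndicator_of_mem hT hTd, mul_one]
  rw [← h1]
  exact Finset.sum_congr rfl fun x hx => (hψ _ (hK.1 (Finset.erase_subset x s) hs)
    (by rw [Finset.card_erase_of_mem hx]; omega) T hT hTd
    ((Finset.erase_subset x s).trans hsT)).symm

end Zigzag

end HomologyManifold

/-! ### Correctable regions of a CSS code -/

section Correctable

variable {α β γ : Type*} [Fintype α] [Fintype β] [Fintype γ]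

/-- A set `R` of qubits is correctable for the complex `P, Q` if every cycle supported on `R` is a
boundary. -/
def Correctable (P : Matrix α β (ZMod 2)) (Q : Matrix β γ (ZMod 2)) (R : Set β) : Prop :=
  ∀ v, P.mulVec v = 0 → (∀ i, i ∉ R → v i = 0) → ∃ y, Q.mulVec y = v

omit [Fintype α] in
theorem Correctable.mono {P : Matrix α β (ZMod 2)} {Q : Matrix β γ (ZMod 2)} {R R' : Set β}
    (h : Correctable P Q R) (hR : R' ⊆ R) : Correctable P Q R' :=
  fun v hv hs => h v hv fun i hi => hs i fun hi' => hi (hR hi')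

theorem exists_dotProduct_ne_zero {W : Submodule (ZMod 2) (β → ZMod 2)} {v : β → ZMod 2}
    (hv : v ∉ W) : ∃ u : β → ZMod 2, u ⬝ᵥ v ≠ 0 ∧ ∀ w ∈ W, u ⬝ᵥ w = 0 := by
  classical
  obtain ⟨f, hf, hW⟩ := Submodule.exists_le_ker_of_notMem hv
  have key (w : β → ZMod 2) : (fun i => f (Pi.single i 1)) ⬝ᵥ w = f w := by
    rw [LinearMap.pi_apply_eq_sum_univ f w]
    refine Finset.sum_congr rfl fun i _ => ?_
    have : (Pi.single i 1 : β → ZMod 2) = fun j => if i = j then 1 else 0 := by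
      funext j; simp [Pi.single_apply, eq_comm]
    rw [smul_eq_mul, mul_comm, ← this]
  exact ⟨_, by rwa [key], fun w hw => by rw [key]; exact hW hw⟩

theorem exists_dotProduct_ne_zero_of_not_range {Q : Matrix β γ (ZMod 2)} {v : β → ZMod 2}
    (hv : ¬ ∃ y, Q.mulVec y = v) :
    ∃ u : β → ZMod 2, Q.transpose.mulVec u = 0 ∧ u ⬝ᵥ v ≠ 0 := by
  classical
  obtain ⟨u, hu, hW⟩ := exists_dotProduct_ne_zero (W := LinearMap.range Q.mulVecLin) (v := v)
    (fun ⟨y, hy⟩ => hv ⟨y, hy⟩)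
  refine ⟨u, ?_, hu⟩
  rw [Matrix.mulVec_transpose]
  refine dotProduct_eq_zero _ fun y => ?_
  rw [← Matrix.dotProduct_mulVec]
  exact hW _ ⟨y, rfl⟩

/-- Cleaning: cycles can be moved off a region that is correctable for the dual complex. -/
theorem Correctable.exists_clean {P : Matrix α β (ZMod 2)} {Q : Matrix β γ (ZMod 2)} {R : Set β}
    (h : Correctable Q.transpose P.transpose R) {v : β → ZMod 2} (hv : P.mulVec v = 0) :
    ∃ y, ∀ i ∈ R, (v + Q.mulVec y) i = 0 := by
  classical
  let ρ : (β → ZMod 2) →ₗ[ZMod 2] (β → ZMod 2) :=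
    { toFun := fun w => R.indicator w
      map_add' := fun w w' => Set.indicator_add R w w'
      map_smul' := fun a w => Set.indicator_const_smul R a w }
  have hρ (w : β → ZMod 2) (i : β) : ρ w i = R.indicator w i := rfl
  have hadj (u w : β → ZMod 2) : u ⬝ᵥ ρ w = ρ u ⬝ᵥ w := by
    refine Finset.sum_congr rfl fun i _ => ?_
    rw [hρ, hρ]
    by_cases hi : i ∈ R <;> simp [hi]
  by_contra hcon
  push Not at hcon
  have hnot : ρ v ∉ LinearMap.range (ρ ∘ₗ Q.mulVecLin) := by
    rintro ⟨y, hy⟩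
    obtain ⟨i, hi, hne⟩ := hcon y
    refine hne ?_
    have h1 := congrFun hy i
    rw [LinearMap.comp_apply, hρ, hρ, Set.indicator_of_mem hi, Set.indicator_of_mem hi,
      Matrix.mulVecLin_apply] at h1
    rw [Pi.add_apply, h1]
    exact CharTwo.add_self_eq_zero _
  obtain ⟨u, hu, hW⟩ := exists_dotProduct_ne_zero hnot
  rw [hadj] at hu
  have hker : Q.transpose.mulVec (ρ u) = 0 := by
    rw [Matrix.mulVec_transpose]
    refine dotProduct_eq_zero _ fun y => ?_
    rw [← Matrix.dotProduct_mulVec, ← hadj]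
    exact hW _ ⟨y, rfl⟩
  obtain ⟨w, hw⟩ := h (ρ u) hker fun i hi => by rw [hρ, Set.indicator_of_notMem hi]
  rw [← hw, Matrix.mulVec_transpose, ← Matrix.dotProduct_mulVec, hv, dotProduct_zero] at hu
  exact hu rfl

theorem correctable_of_clean {P : Matrix α β (ZMod 2)} {Q : Matrix β γ (ZMod 2)} {R : Set β}
    (h : ∀ v, P.mulVec v = 0 → ∃ y, ∀ i ∈ R, (v + Q.mulVec y) i = 0) :
    Correctable Q.transpose P.transpose R := by
  intro u hu hR
  by_contra hcon
  obtain ⟨v, hv, huv⟩ := exists_dotProduct_ne_zero_of_not_range hcon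
  rw [Matrix.transpose_transpose] at hv
  obtain ⟨y, hy⟩ := h v hv
  refine huv ?_
  have h1 : (v + Q.mulVec y) ⬝ᵥ u = 0 := by
    refine Finset.sum_eq_zero fun i _ => ?_
    by_cases hi : i ∈ R
    · rw [hy i hi, zero_mul]
    · rw [hR i hi, mul_zero]
  have h2 : Q.mulVec y ⬝ᵥ u = 0 := by
    rw [dotProduct_comm, Matrix.dotProduct_mulVec, ← Matrix.mulVec_transpose, hu, zero_dotProduct]
  rwa [add_dotProduct, h2, add_zero] at h1

omit [Fintype α] in
theorem mulVec_indicator_eq_zero {P : Matrix α β (ZMod 2)} {v : β → ZMod 2} {I : Set β}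
    (hv : P.mulVec v = 0)
    (hsep : ∀ r i j, i ∈ I → j ∉ I → v i ≠ 0 → v j ≠ 0 → P r i ≠ 0 → P r j = 0) :
    P.mulVec (I.indicator v) = 0 := by
  classical
  funext r
  by_cases h : ∃ i ∈ I, v i ≠ 0 ∧ P r i ≠ 0
  · obtain ⟨i, hi, hvi, hri⟩ := h
    rw [← congrFun hv r]
    refine Finset.sum_congr rfl fun j _ => ?_
    by_cases hj : j ∈ I
    · simp [hj]
    · by_cases hvj : v j = 0
      · simp [hj, hvj]
      · simp [hsep r i j hi hj hvi hvj hri]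
  · push Not at h
    refine Finset.sum_eq_zero fun j _ => ?_
    by_cases hj : j ∈ I
    · by_cases hvj : v j = 0
      · simp [hj, hvj]
      · simp [h j hj hvj]
    · simp [hj]

/-- Expansion: a correctable region `I` may be enlarged by a correctable shell `T` that separates
it from its complement: after cleaning a cycle off the shell, its inner part is a cycle by itself,
hence a boundary. -/
theorem Correctable.expand {P : Matrix α β (ZMod 2)} {Q : Matrix β γ (ZMod 2)}
    (hPQ : P * Q = 0) {I T : Set β} (hI : Correctable P Q I)
    (hT : Correctable Q.transpose P.transpose T)
    (hsep : ∀ r, ∀ i ∈ I, ∀ j, j ∉ I → j ∉ T → P r i ≠ 0 → P r j = 0) :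
    Correctable Q.transpose P.transpose (I ∪ T) := by
  refine correctable_of_clean fun v hv => ?_
  obtain ⟨y, hy⟩ := hT.exists_clean hv
  set x := v + Q.mulVec y with hx
  have hx0 : P.mulVec x = 0 := by
    rw [hx, Matrix.mulVec_add, hv, Matrix.mulVec_mulVec, hPQ, Matrix.zero_mulVec, add_zero]
  obtain ⟨y', hy'⟩ := hI (I.indicator x)
    (mulVec_indicator_eq_zero hx0 fun r i j hi hj _ hxj hri =>
      hsep r i hi j hj (fun hjT => hxj (hy j hjT)) hri)
    (fun i hi => Set.indicator_of_notMem hi x)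
  refine ⟨y + y', fun i hi => ?_⟩
  rw [Matrix.mulVec_add, ← add_assoc, ← hx, hy', Pi.add_apply]
  by_cases hiI : i ∈ I
  · rw [Set.indicator_of_mem hiI]; exact CharTwo.add_self_eq_zero _
  · rw [Set.indicator_of_notMem hiI, add_zero]
    exact hy i (hi.resolve_left hiI)

omit [Fintype α] in
/-- A union of correctable regions is correctable if no check meets two of them. -/
theorem correctable_of_components {κ : Type*} {P : Matrix α β (ZMod 2)} {Q : Matrix β γ (ZMod 2)}
    {R : Set β} (l : β → κ) (hl : ∀ c, Correctable P Q {i | i ∈ R ∧ l i = c})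
    (hsep : ∀ r, ∀ i ∈ R, ∀ j ∈ R, P r i ≠ 0 → P r j ≠ 0 → l i = l j) : Correctable P Q R := by
  classical
  intro v hv hR
  have hcomp (c : κ) : ∃ y, Q.mulVec y = {i | l i = c}.indicator v := by
    refine hl c _ (mulVec_indicator_eq_zero hv fun r i j hi hj hvi hvj hri => ?_) fun i hi => ?_
    · by_contra hrj
      have hiR : i ∈ R := by by_contra h; exact hvi (hR i h)
      have hjR : j ∈ R := by by_contra h; exact hvj (hR j h)
      exact hj ((hsep r i hiR j hjR hri hrj).symm.trans hi)
    · by_cases hc : l i = c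
      · have : i ∉ R := fun h => hi ⟨h, hc⟩
        rw [Set.indicator_of_mem (show i ∈ {i | l i = c} from hc), hR i this]
      · exact Set.indicator_of_notMem (show i ∉ {i | l i = c} from hc) v
  choose y hy using hcomp
  refine ⟨∑ c ∈ Finset.univ.image l, y c, ?_⟩
  rw [Matrix.mulVec_sum]
  simp only [hy]
  funext i
  rw [Finset.sum_apply, Finset.sum_eq_single (l i)]
  · exact Set.indicator_of_mem (show i ∈ {j | l j = l i} from rfl) v
  · intro c _ hc
    exact Set.indicator_of_notMem (show i ∉ {j | l j = c} from fun h => hc h.symm) v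
  · exact fun h => absurd (Finset.mem_image_of_mem l (Finset.mem_univ i)) h

omit [Fintype α] in
/-- Regions with fewer qubits than the distance are correctable. -/
theorem correctable_of_card_lt {P : Matrix α β (ZMod 2)} {Q : Matrix β γ (ZMod 2)}
    {R : Set β} {s : Finset β} (hs : ∀ i ∈ R, i ∈ s) (hR : s.card < minWeight P Q) :
    Correctable P Q R := by
  intro v hv hvR
  by_contra hcon
  have h1 : minWeight P Q ≤ hammingNorm v :=
    Nat.sInf_le ⟨v, LinearMap.mem_ker.2 hv, fun ⟨y, hy⟩ => hcon ⟨y, hy⟩, rfl⟩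
  have h2 : hammingNorm v ≤ s.card := by
    refine Finset.card_le_card fun i hi => hs i ?_
    by_contra h
    exact (Finset.mem_filter.1 hi).2 (hvR i h)
  omega

/-- If the qubits outside `C` are the union of a region that is correctable for the complex and of
one that is correctable for the dual complex, then the code has dimension at most `#C`. -/
theorem homologyDim_le_card {P : Matrix α β (ZMod 2)} {Q : Matrix β γ (ZMod 2)}
    (hPQ : P * Q = 0) {A B : Set β} {C : Finset β} (hA : Correctable Q.transpose P.transpose A)
    (hB : Correctable P Q B) (hABC : ∀ i, i ∈ A ∨ i ∈ B ∨ i ∈ C) :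
    homologyDim P Q ≤ C.card := by
  classical
  let S : Submodule (ZMod 2) (β → ZMod 2) :=
    LinearMap.ker P.mulVecLin ⊓
      { carrier := {v | ∀ i ∈ A, v i = 0}
        add_mem' := fun {v w} hv hw i hi => by simp [hv i hi, hw i hi]
        zero_mem' := fun _ _ => rfl
        smul_mem' := fun a v hv i hi => by simp [hv i hi] }
  let W := (LinearMap.range Q.mulVecLin).submoduleOf (LinearMap.ker P.mulVecLin)
  let π : S →ₗ[ZMod 2] (↥(LinearMap.ker P.mulVecLin) ⧸ W) :=
    W.mkQ ∘ₗ Submodule.inclusion inf_le_left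
  let res : S →ₗ[ZMod 2] (C → ZMod 2) :=
    (LinearMap.funLeft (ZMod 2) (ZMod 2) (Subtype.val : C → β)) ∘ₗ S.subtype
  have hπ : LinearMap.range π = ⊤ := by
    rw [LinearMap.range_eq_top]
    intro q
    obtain ⟨⟨v, hv⟩, rfl⟩ := W.mkQ_surjective q
    obtain ⟨y, hy⟩ := hA.exists_clean (LinearMap.mem_ker.1 hv)
    have hker : v + Q.mulVec y ∈ LinearMap.ker P.mulVecLin := by
      rw [LinearMap.mem_ker, Matrix.mulVecLin_apply, Matrix.mulVec_add, Matrix.mulVec_mulVec, hPQ,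
        Matrix.zero_mulVec, add_zero]
      exact LinearMap.mem_ker.1 hv
    refine ⟨⟨v + Q.mulVec y, hker, hy⟩, ?_⟩
    refine (Submodule.Quotient.eq W).2 ?_
    refine ⟨y, ?_⟩
    simp
  have hle : LinearMap.ker res ≤ LinearMap.ker π := by
    rintro ⟨v, hv, hvA⟩ hres
    have hC (i : β) (hi : i ∈ C) : v i = 0 := congrFun (LinearMap.mem_ker.1 hres) ⟨i, hi⟩
    obtain ⟨y, hy⟩ := hB v (LinearMap.mem_ker.1 hv) fun i hi => by
      rcases hABC i with h | h | h
      · exact hvA i h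
      · exact absurd h hi
      · exact hC i h
    rw [LinearMap.mem_ker]
    refine (Submodule.Quotient.mk_eq_zero W).2 ⟨y, hy⟩
  have h1 := LinearMap.finrank_range_add_finrank_ker π
  have h2 := LinearMap.finrank_range_add_finrank_ker res
  have h3 := Submodule.finrank_mono hle
  have h4 := Submodule.finrank_le (LinearMap.range res)
  rw [hπ, finrank_top] at h1
  rw [Module.finrank_fintype_fun_eq_card, Fintype.card_coe] at h4
  have h5 : homologyDim P Q = Module.finrank (ZMod 2) (↥(LinearMap.ker P.mulVecLin) ⧸ W) := rfl
  omega

theorem homologyDim_le {P : Matrix α β (ZMod 2)} {Q : Matrix β γ (ZMod 2)} (hPQ : P * Q = 0) :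
    homologyDim P Q ≤ Fintype.card β := by
  refine homologyDim_le_card (A := ∅) (B := ∅) (C := Finset.univ) hPQ ?_ ?_ (by simp)
  · exact fun v _ hv => ⟨0, by rw [Matrix.mulVec_zero]; exact (funext fun i => hv i id).symm⟩
  · exact fun v _ hv => ⟨0, by rw [Matrix.mulVec_zero]; exact (funext fun i => hv i id).symm⟩

end Correctable

/-! ### Codes with local checks on a lattice -/

section Lattice

theorem add_pow_succ_le (b e n : ℕ) :
    (b + e) ^ (n + 1) ≤ b ^ (n + 1) + (n + 1) * e * (b + e) ^ n := by
  induction n with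
  | zero => simp
  | succ n ih =>
    calc (b + e) ^ (n + 1 + 1) = (b + e) ^ (n + 1) * b + (b + e) ^ (n + 1) * e := by ring
      _ ≤ (b ^ (n + 1) + (n + 1) * e * (b + e) ^ n) * b + (b + e) ^ (n + 1) * e := by gcongr
      _ = b ^ (n + 1 + 1) + (n + 1) * e * (b + e) ^ n * b + (b + e) ^ (n + 1) * e := by ring
      _ ≤ b ^ (n + 1 + 1) + (n + 1) * e * (b + e) ^ n * (b + e) + (b + e) ^ (n + 1) * e := by
        gcongr; omega
      _ = b ^ (n + 1 + 1) + (n + 1 + 1) * e * (b + e) ^ (n + 1) := by ring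
      _ = _ := by ring

variable {α β γ : Type*} [Fintype α] [Fintype β] [Fintype γ] {n : ℕ}

/-- The checks of `P` are local of range `t` for the positions `f` of the qubits. -/
def LocalChecks (t : ℕ) (f : β → Fin n → ℤ) (P : Matrix α β (ZMod 2)) : Prop :=
  ∀ r i j, P r i ≠ 0 → P r j ≠ 0 → ∀ l, |f i l - f j l| ≤ t

/-- The qubits in the box of side length `2r` around `c`. -/
def boxRegion (f : β → Fin n → ℤ) (c : Fin n → ℤ) (r : ℕ) : Set β :=
  {i | ∀ l, c l - r ≤ f i l ∧ f i l < c l + r}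

theorem card_filter_position_le {m : ℕ} {f : β → Fin n → ℤ}
    (hm : ∀ p, (Finset.univ.filter fun i => f i = p).card ≤ m) (s : Finset (Fin n → ℤ)) :
    (Finset.univ.filter fun i => f i ∈ s).card ≤ m * s.card := by
  refine Finset.card_le_mul_card_image_of_maps_to (f := f)
    (fun i hi => (Finset.mem_filter.1 hi).2) m fun p _ => ?_
  refine (Finset.card_le_card fun i hi => ?_).trans (hm p)
  exact Finset.mem_filter.2 ⟨Finset.mem_univ _, (Finset.mem_filter.1 hi).2⟩

/-- Large boxes are correctable if their surface contains fewer qubits than the distance, since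
they grow from the empty box by correctable shells. -/
theorem correctable_boxRegion {P : Matrix α β (ZMod 2)} {Q : Matrix β γ (ZMod 2)}
    (hPQ : P * Q = 0) {m t D J : ℕ} {f : β → Fin n → ℤ} (hn : 1 ≤ n)
    (hm : ∀ p, (Finset.univ.filter fun i => f i = p).card ≤ m)
    (hP : LocalChecks t f P) (hQ : LocalChecks t f Q.transpose)
    (hD : D ≤ minWeight P Q) (hD' : D ≤ minWeight Q.transpose P.transpose)
    (hJ : m * (n * (2 * t) * (2 * (J * t)) ^ (n - 1)) < D) (c : Fin n → ℤ) (j : ℕ) (hj : j ≤ J) :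
    Correctable P Q (boxRegion f c (j * t)) ∧
      Correctable Q.transpose P.transpose (boxRegion f c (j * t)) := by
  classical
  obtain ⟨n, rfl⟩ : ∃ k, n = k + 1 := ⟨n - 1, by omega⟩
  induction j with
  | zero =>
    have hempty (i : β) : i ∉ boxRegion f c (0 * t) := fun hi => by
      have := hi 0
      push_cast at this
      omega
    exact ⟨correctable_of_card_lt (s := ∅) (fun i hi => absurd hi (hempty i))
        (by rw [Finset.card_empty]; omega),
      correctable_of_card_lt (s := ∅) (fun i hi => absurd hi (hempty i))
        (by rw [Finset.card_empty]; omega)⟩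
  | succ j ih =>
    obtain ⟨ih1, ih2⟩ := ih (by omega)
    set I := boxRegion f c (j * t) with hI
    set T : Set β := {i | i ∈ boxRegion f c ((j + 1) * t) ∧ i ∉ I} with hT
    have hjt : (j + 1) * t = j * t + t := by ring
    have hcast : (((j + 1) * t : ℕ) : ℤ) = (j * t : ℕ) + t := by rw [hjt]; push_cast; ring
    have hIT : I ∪ T = boxRegion f c ((j + 1) * t) := by
      ext i
      constructor
      · rintro (hi | hi)
        · intro l
          have := hi l
          rw [hcast]
          omega
        · exact hi.1
      · intro hi
        by_cases h : i ∈ I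
        · exact Or.inl h
        · exact Or.inr ⟨hi, h⟩
    let box (r : ℕ) : Finset (Fin (n + 1) → ℤ) :=
      Fintype.piFinset fun l => Finset.Ico (c l - r) (c l + r)
    have hbox (r : ℕ) (p : Fin (n + 1) → ℤ) :
        p ∈ box r ↔ ∀ l, c l - r ≤ p l ∧ p l < c l + r := by
      simp [box, Fintype.mem_piFinset]
    have hcard (r : ℕ) : (box r).card = (2 * r) ^ (n + 1) := by
      have (l : Fin (n + 1)) : (Finset.Ico (c l - r) (c l + r)).card = 2 * r := by
        rw [Int.card_Ico]; omega
      simp only [box, Fintype.card_piFinset, this, Finset.prod_const, Finset.card_univ,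
        Fintype.card_fin]
    have hsub : box (j * t) ⊆ box ((j + 1) * t) := fun p hp => (hbox _ _).2 fun l => by
      have := (hbox _ _).1 hp l
      rw [hcast]
      omega
    let s := Finset.univ.filter fun i => f i ∈ box ((j + 1) * t) \ box (j * t)
    have hTs (i : β) (hi : i ∈ T) : i ∈ s := by
      refine Finset.mem_filter.2 ⟨Finset.mem_univ _, Finset.mem_sdiff.2 ⟨(hbox _ _).2 hi.1, ?_⟩⟩
      exact fun h => hi.2 ((hbox _ _).1 h)
    have hs : s.card < D := by
      refine lt_of_le_of_lt ((card_filter_position_le hm _).trans ?_) hJ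
      refine Nat.mul_le_mul_left m ?_
      rw [Finset.card_sdiff_of_subset hsub, hcard, hcard]
      have h1 := add_pow_succ_le (2 * (j * t)) (2 * t) n
      have h2 : 2 * (j * t) + 2 * t = 2 * ((j + 1) * t) := by ring
      rw [h2] at h1
      have h3 : 2 * ((j + 1) * t) ≤ 2 * (J * t) := by gcongr
      have h4 : (n + 1) * (2 * t) * (2 * ((j + 1) * t)) ^ n ≤
          (n + 1) * (2 * t) * (2 * (J * t)) ^ n := by gcongr
      rw [Nat.add_sub_cancel]
      omega
    have hfar (i k : β) (hi : i ∈ I) (hk : k ∉ I) (hkT : k ∉ T) :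
        ∃ l, (t : ℤ) < |f i l - f k l| := by
      have hk' : k ∉ boxRegion f c ((j + 1) * t) := fun h => hkT ⟨h, hk⟩
      simp only [boxRegion, Set.mem_ofPred_eq, not_forall] at hk'
      obtain ⟨l, hl⟩ := hk'
      rw [hcast] at hl
      have := hi l
      refine ⟨l, ?_⟩
      rw [lt_abs]
      omega
    rw [← hIT]
    constructor
    · have := Correctable.expand (P := Q.transpose) (Q := P.transpose) (I := I) (T := T)
        (by rw [← Matrix.transpose_mul, hPQ, Matrix.transpose_zero]) ih2
        (by
          rw [Matrix.transpose_transpose, Matrix.transpose_transpose]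
          exact correctable_of_card_lt hTs (hs.trans_le hD))
        (fun r i hi k hk hkT hri => by
          by_contra hrk
          obtain ⟨l, hl⟩ := hfar i k hi hk hkT
          exact absurd (hQ r i k hri hrk l) (not_le.2 hl))
      rwa [Matrix.transpose_transpose, Matrix.transpose_transpose] at this
    · exact Correctable.expand hPQ ih1 (correctable_of_card_lt hTs (hs.trans_le hD'))
        (fun r i hi k hk hkT hri => by
          by_contra hrk
          obtain ⟨l, hl⟩ := hfar i k hi hk hkT
          exact absurd (hP r i k hri hrk l) (not_le.2 hl))

/-- The coordinate `x` belongs to a wall, of thickness `t`, of the grid of mesh `N`. -/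
def nearWall (N t : ℕ) (x : ℤ) : Prop := x % N < t

/-- The coordinate `x` has distance at most `t` from a wall, of thickness `t`, of the grid of mesh
`N`. -/
def nearWall' (N t : ℕ) (x : ℤ) : Prop := (x + t) % N < 3 * t

theorem floor_eq_of_not_nearWall {N t : ℕ} (hN : 0 < N) {x y : ℤ} (hx : ¬ nearWall N t x)
    (hy : ¬ nearWall N t y) (hxy : |x - y| ≤ t) : x / N = y / N := by
  rw [nearWall, not_lt] at hx hy
  have hN' : (0 : ℤ) < N := by exact_mod_cast hN
  have h1 := Int.emod_add_mul_ediv x N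
  have h2 := Int.emod_add_mul_ediv y N
  have h3 := Int.emod_lt_of_pos x hN'
  have h4 := Int.emod_lt_of_pos y hN'
  rw [abs_le] at hxy
  rcases lt_trichotomy (x / N) (y / N) with h | h | h
  · have : (N : ℤ) * (x / N) + N ≤ N * (y / N) := by nlinarith
    omega
  · exact h
  · have : (N : ℤ) * (y / N) + N ≤ N * (x / N) := by nlinarith
    omega

theorem floor_eq_of_nearWall {N t : ℕ} (hN : 3 * t ≤ N) (ht : 0 < t) {x y : ℤ}
    (hx : nearWall N t x) (hy : nearWall N t y) (hxy : |x - y| ≤ t) : x / N = y / N := by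
  rw [nearWall] at hx hy
  have hN' : (3 * t : ℤ) ≤ N := by exact_mod_cast hN
  have hN0 : (0 : ℤ) < N := by omega
  have h1 := Int.emod_add_mul_ediv x N
  have h2 := Int.emod_add_mul_ediv y N
  have h3 := Int.emod_nonneg x hN0.ne'
  have h4 := Int.emod_nonneg y hN0.ne'
  rw [abs_le] at hxy
  rcases lt_trichotomy (x / N) (y / N) with h | h | h
  · have : (N : ℤ) * (x / N) + N ≤ N * (y / N) := by nlinarith
    omega
  · exact h
  · have : (N : ℤ) * (y / N) + N ≤ N * (x / N) := by nlinarith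
    omega

theorem nearWall'_of_nearWall {N t : ℕ} (hN : 3 * t ≤ N) {x y : ℤ} (hx : nearWall N t x)
    (hxy : |x - y| ≤ t) : nearWall' N t y := by
  rw [nearWall] at hx
  rw [nearWall']
  have hN' : (3 * t : ℤ) ≤ N := by exact_mod_cast hN
  rcases Nat.eq_zero_or_pos N with rfl | hN0
  · have : t = 0 := by omega
    subst this
    simp at hx hxy ⊢
    omega
  have hN0' : (0 : ℤ) < N := by exact_mod_cast hN0
  have h1 := Int.emod_add_mul_ediv x N
  have h3 := Int.emod_nonneg x hN0'.ne'
  rw [abs_le] at hxy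
  have h5 : y + t = (y + t - N * (x / N)) + N * (x / N) := by ring
  rw [h5, Int.add_mul_emod_self_left, Int.emod_eq_of_lt (by omega) (by omega)]
  omega

theorem floor_eq_of_not_nearWall' {N t : ℕ} (hN : 3 * t ≤ N) (ht : 0 < t) {x y : ℤ}
    (hx : ¬ nearWall' N t x) (hy : ¬ nearWall' N t y) (hxy : |x - y| ≤ t) : x / N = y / N := by
  refine floor_eq_of_not_nearWall (by omega) (fun h => hx ?_) (fun h => hy ?_) hxy
  · exact nearWall'_of_nearWall hN h (by simp)
  · exact nearWall'_of_nearWall hN h (by simp)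

open Classical in
/-- A local code has dimension at most the number of qubits near the codimension-two skeleton of a
grid, provided that the walls between the cells of the grid are thinner than the distance: the
cells are correctable since their surfaces are small, and the pieces of the walls away from the
codimension-two skeleton are correctable since they contain few qubits. -/
theorem homologyDim_le_card_codim_two {P : Matrix α β (ZMod 2)} {Q : Matrix β γ (ZMod 2)}
    (hPQ : P * Q = 0) {m t D J : ℕ} {f : β → Fin n → ℤ} (hn : 1 ≤ n) (ht : 0 < t) (hJ1 : 1 ≤ J)
    (hm : ∀ p, (Finset.univ.filter fun i => f i = p).card ≤ m)
    (hP : LocalChecks t f P) (hQ : LocalChecks t f Q.transpose)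
    (hD : D ≤ minWeight P Q) (hD' : D ≤ minWeight Q.transpose P.transpose)
    (hJ : m * (n * (2 * t) * ((2 * J + 1) * t) ^ (n - 1)) < D) :
    homologyDim P Q ≤ (Finset.univ.filter fun i => ∃ l l', l ≠ l' ∧
      nearWall' ((2 * J + 1) * t) t (f i l) ∧ nearWall' ((2 * J + 1) * t) t (f i l')).card := by
  set N := (2 * J + 1) * t with hNdef
  have hN : 3 * t ≤ N := Nat.mul_le_mul_right t (by omega)
  have hN0 : 0 < N := by omega
  have hN' : (0 : ℤ) < N := by exact_mod_cast hN0
  have hNJ : N = 2 * (J * t) + t := by rw [hNdef]; ring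
  have hNJ' : (N : ℤ) = 2 * (J * t : ℕ) + t := by rw [hNJ]; push_cast; ring
  set C := Finset.univ.filter fun i => ∃ l l', l ≠ l' ∧ nearWall' N t (f i l) ∧
    nearWall' N t (f i l') with hC
  set A : Set β := {i | ∀ l, ¬ nearWall N t (f i l)} with hA
  set B : Set β := {i | (∃ l, nearWall N t (f i l)) ∧ i ∉ C} with hB
  have hbox : m * (n * (2 * t) * (2 * (J * t)) ^ (n - 1)) < D := by
    refine lt_of_le_of_lt ?_ hJ
    gcongr
    omega
  refine homologyDim_le_card (A := A) (B := B) (C := C) hPQ ?_ ?_ ?_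
  · refine correctable_of_components (fun i l => f i l / N) (fun c => ?_) ?_
    · refine (correctable_boxRegion hPQ hn hm hP hQ hD hD' hbox
        (fun l => N * c l + t + (J * t : ℕ)) J le_rfl).2.mono ?_
      rintro i ⟨hi, hic⟩ l
      have h1 := hi l
      rw [nearWall, not_lt] at h1
      have h2 := Int.emod_add_mul_ediv (f i l) N
      have h3 := Int.emod_lt_of_pos (f i l) hN'
      rw [congrFun hic l] at h2
      beta_reduce
      constructor <;> omega
    · intro r i hi j hj hri hrj
      funext l
      exact floor_eq_of_not_nearWall hN0 (hi l) (hj l) (hQ r i j hri hrj l)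
  · refine correctable_of_components (fun i l => (nearWall N t (f i l), f i l / N)) (fun c => ?_) ?_
    · by_cases hne : ∃ i, i ∈ B ∧ (fun l => (nearWall N t (f i l), f i l / (N : ℤ))) = c
      · obtain ⟨i₀, hi₀, rfl⟩ := hne
        obtain ⟨l₀, hl₀⟩ := hi₀.1
        -- the component lies in a slab of thickness `t`
        let s : Finset (Fin n → ℤ) := Fintype.piFinset fun l =>
          if l = l₀ then Finset.Ico (N * (f i₀ l / N)) (N * (f i₀ l / N) + t)
          else Finset.Ico (N * (f i₀ l / N)) (N * (f i₀ l / N) + N)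
        have hs : s.card = t * N ^ (n - 1) := by
          have hcard (l : Fin n) : (if l = l₀ then
              Finset.Ico (N * (f i₀ l / N)) (N * (f i₀ l / N) + t)
              else Finset.Ico (N * (f i₀ l / N)) (N * (f i₀ l / N) + N)).card =
              if l = l₀ then t else N := by
            split_ifs <;> rw [Int.card_Ico] <;> omega
          rw [Fintype.card_piFinset, Finset.prod_congr rfl fun l _ => hcard l,
            ← Finset.mul_prod_erase _ _ (Finset.mem_univ l₀), if_pos rfl,
            Finset.prod_congr rfl fun l hl => if_neg (Finset.ne_of_mem_erase hl),
            Finset.prod_const, Finset.card_erase_of_mem (Finset.mem_univ _), Finset.card_univ,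
            Fintype.card_fin]
        refine correctable_of_card_lt (s := Finset.univ.filter fun i => f i ∈ s) ?_ ?_
        · rintro i ⟨-, hic⟩
          refine Finset.mem_filter.2 ⟨Finset.mem_univ _, Fintype.mem_piFinset.2 fun l => ?_⟩
          have h0 := congrFun hic l
          rw [Prod.mk.injEq] at h0
          have h2 := Int.emod_add_mul_ediv (f i l) N
          have h3 := Int.emod_lt_of_pos (f i l) hN'
          have h4 := Int.emod_nonneg (f i l) hN'.ne'
          rw [h0.2] at h2
          split_ifs with hl
          · have h5 : nearWall N t (f i l) := by rw [h0.1, hl]; exact hl₀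
            rw [nearWall] at h5
            rw [Finset.mem_Ico]
            omega
          · rw [Finset.mem_Ico]
            omega
        · refine lt_of_le_of_lt (card_filter_position_le hm s) (lt_of_lt_of_le ?_ hD)
          refine lt_of_le_of_lt ?_ hJ
          rw [hs]
          gcongr
          nlinarith
      · push Not at hne
        refine correctable_of_card_lt (s := ∅) (fun i hi => absurd hi.2 (hne i hi.1)) ?_
        rw [Finset.card_empty]
        omega
    · intro r i hi j hj hri hrj
      have hloc (l : Fin n) := hP r i j hri hrj l
      have hloc' (l : Fin n) : |f j l - f i l| ≤ t := by rw [abs_sub_comm]; exact hloc l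
      have huniq (k : β) (hk : k ∈ B) (l l' : Fin n) (h : nearWall' N t (f k l))
          (h' : nearWall' N t (f k l')) : l = l' := by
        by_contra hll
        exact hk.2 (Finset.mem_filter.2 ⟨Finset.mem_univ _, l, l', hll, h, h'⟩)
      have hself {x : ℤ} (h : nearWall N t x) : nearWall' N t x :=
        nearWall'_of_nearWall hN h (by simp)
      obtain ⟨li, hli⟩ := hi.1
      obtain ⟨lj, hlj⟩ := hj.1
      have hl : li = lj := huniq j hj _ _ (nearWall'_of_nearWall hN hli (hloc li)) (hself hlj)
      subst hl
      have hoffi (l : Fin n) (h : l ≠ li) : ¬ nearWall' N t (f i l) := fun h' =>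
        h (huniq i hi _ _ h' (hself hli))
      have hoffj (l : Fin n) (h : l ≠ li) : ¬ nearWall' N t (f j l) := fun h' =>
        h (huniq j hj _ _ h' (hself hlj))
      funext l
      by_cases h : l = li
      · rw [h, Prod.mk.injEq]
        exact ⟨propext ⟨fun _ => hlj, fun _ => hli⟩, floor_eq_of_nearWall hN ht hli hlj (hloc li)⟩
      · rw [Prod.mk.injEq]
        exact ⟨propext ⟨fun h' => absurd (hself h') (hoffi l h),
          fun h' => absurd (hself h') (hoffj l h)⟩,
          floor_eq_of_not_nearWall' hN ht (hoffi l h) (hoffj l h) (hloc l)⟩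
  · intro i
    by_cases h1 : ∃ l, nearWall N t (f i l)
    · by_cases h2 : i ∈ C
      · exact Or.inr (Or.inr h2)
      · exact Or.inr (Or.inl ⟨h1, h2⟩)
    · push Not at h1
      exact Or.inl h1

open Classical in
theorem card_nearWall'_le (N t : ℕ) (x : ℤ) :
    ((Finset.range N).filter fun v => nearWall' N t (x + (v : ℕ))).card ≤ 3 * t := by
  rcases Nat.eq_zero_or_pos N with rfl | hN
  · simp
  have hN' : (0 : ℤ) < N := by exact_mod_cast hN
  rw [← Finset.card_range (3 * t)]
  refine Finset.card_le_card_of_injOn (fun v => ((x + (v : ℕ) + t) % N).toNat) ?_ ?_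
  · intro v hv
    have h1 := (Finset.mem_filter.1 hv).2
    rw [nearWall'] at h1
    have h2 := Int.emod_nonneg (x + (v : ℕ) + t) hN'.ne'
    rw [Finset.mem_coe, Finset.mem_range]
    show ((x + (v : ℕ) + t) % N).toNat < 3 * t
    omega
  · intro v hv v' hv' h
    have h1 := Finset.mem_range.1 (Finset.mem_filter.1 hv).1
    have h2 := Finset.mem_range.1 (Finset.mem_filter.1 hv').1
    have h3 := Int.emod_nonneg (x + (v : ℕ) + t) hN'.ne'
    have h4 := Int.emod_nonneg (x + (v' : ℕ) + t) hN'.ne'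
    have h5 : (x + (v : ℕ) + t) % N = (x + (v' : ℕ) + t) % N := by
      simp only at h
      omega
    have h6 : (v : ℤ) ≡ v' [ZMOD N] := by
      have h7 : x + (v : ℤ) + t ≡ x + v' + t [ZMOD N] := h5
      have h8 := (h7.sub_right (x + t))
      ring_nf at h8
      exact h8
    have h9 := Int.natCast_modEq_iff.1 h6
    rwa [Nat.ModEq, Nat.mod_eq_of_lt h1, Nat.mod_eq_of_lt h2] at h9

open Classical in
/-- For most translations a given point is far from the codimension-two skeleton of the grid. -/
theorem card_translations_le (N t : ℕ) (x : Fin n → ℤ) :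
    ((Fintype.piFinset fun _ : Fin n => Finset.range N).filter fun u => ∃ l l', l ≠ l' ∧
      nearWall' N t (x l + (u l : ℕ)) ∧ nearWall' N t (x l' + (u l' : ℕ))).card * N ^ 2 ≤
      n ^ 2 * (3 * t) ^ 2 * N ^ n := by
  let g : Fin n → Finset ℕ := fun k =>
    (Finset.range N).filter fun v => nearWall' N t (x k + (v : ℕ))
  let S : Fin n × Fin n → Finset (Fin n → ℕ) := fun p =>
    Fintype.piFinset fun k => if k ∈ ({p.1, p.2} : Finset (Fin n)) then g k else Finset.range N
  have hS (p : Fin n × Fin n) (hp : p.1 ≠ p.2) : (S p).card * N ^ 2 ≤ (3 * t) ^ 2 * N ^ n := by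
    have hpair : ({p.1, p.2} : Finset (Fin n)).card = 2 := Finset.card_pair hp
    have hcompl : ({p.1, p.2} : Finset (Fin n))ᶜ.card = n - 2 := by
      rw [Finset.card_compl, hpair, Fintype.card_fin]
    have hn2 : 2 ≤ n := by
      have := Finset.card_le_univ ({p.1, p.2} : Finset (Fin n))
      rwa [hpair, Fintype.card_fin] at this
    rw [Fintype.card_piFinset, ← Finset.prod_mul_prod_compl ({p.1, p.2} : Finset (Fin n))]
    have h1 : ∏ k ∈ ({p.1, p.2} : Finset (Fin n)), (if k ∈ ({p.1, p.2} : Finset (Fin n)) then g k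
        else Finset.range N).card ≤ (3 * t) ^ 2 := by
      rw [← hpair]
      refine Finset.prod_le_pow_card _ _ _ fun k hk => ?_
      rw [if_pos hk]
      exact card_nearWall'_le N t (x k)
    have h2 : ∏ k ∈ ({p.1, p.2} : Finset (Fin n))ᶜ, (if k ∈ ({p.1, p.2} : Finset (Fin n)) then g k
        else Finset.range N).card = N ^ (n - 2) := by
      rw [← hcompl, ← Finset.prod_const]
      refine Finset.prod_congr rfl fun k hk => ?_
      rw [if_neg (Finset.mem_compl.1 hk), Finset.card_range]
    rw [h2]
    calc _ ≤ (3 * t) ^ 2 * N ^ (n - 2) * N ^ 2 := by gcongr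
      _ = (3 * t) ^ 2 * N ^ n := by rw [mul_assoc, ← pow_add, Nat.sub_add_cancel hn2]
  let T : Finset (Fin n × Fin n) := Finset.univ.filter fun p => p.1 ≠ p.2
  have hT : T.card ≤ n ^ 2 := by
    refine (Finset.card_le_univ T).trans ?_
    rw [Fintype.card_prod, Fintype.card_fin, sq]
  calc _ ≤ (T.biUnion S).card * N ^ 2 := by
        gcongr
        intro u hu
        obtain ⟨hu, l, l', hll, h1, h2⟩ := Finset.mem_filter.1 hu
        rw [Fintype.mem_piFinset] at hu
        refine Finset.mem_biUnion.2 ⟨(l, l'), Finset.mem_filter.2 ⟨Finset.mem_univ _, hll⟩, ?_⟩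
        refine Fintype.mem_piFinset.2 fun k => ?_
        split_ifs with hk
        · refine Finset.mem_filter.2 ⟨hu k, ?_⟩
          rcases Finset.mem_insert.1 hk with rfl | hk
          · exact h1
          · rw [Finset.mem_singleton.1 hk]; exact h2
        · exact hu k
    _ ≤ (∑ p ∈ T, (S p).card) * N ^ 2 := by gcongr; exact Finset.card_biUnion_le
    _ = ∑ p ∈ T, (S p).card * N ^ 2 := Finset.sum_mul _ _ _
    _ ≤ ∑ _p ∈ T, (3 * t) ^ 2 * N ^ n :=
        Finset.sum_le_sum fun p hp => hS p (Finset.mem_filter.1 hp).2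
    _ = T.card * ((3 * t) ^ 2 * N ^ n) := by rw [Finset.sum_const, smul_eq_mul]
    _ ≤ n ^ 2 * ((3 * t) ^ 2 * N ^ n) := by gcongr
    _ = _ := by ring

/-- Averaging over all translations of the grid. -/
theorem homologyDim_mul_sq_le {P : Matrix α β (ZMod 2)} {Q : Matrix β γ (ZMod 2)}
    (hPQ : P * Q = 0) {m t D J : ℕ} {f : β → Fin n → ℤ} (hn : 1 ≤ n) (ht : 0 < t) (hJ1 : 1 ≤ J)
    (hm : ∀ p, (Finset.univ.filter fun i => f i = p).card ≤ m)
    (hP : LocalChecks t f P) (hQ : LocalChecks t f Q.transpose)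
    (hD : D ≤ minWeight P Q) (hD' : D ≤ minWeight Q.transpose P.transpose)
    (hJ : m * (n * (2 * t) * ((2 * J + 1) * t) ^ (n - 1)) < D) :
    homologyDim P Q * ((2 * J + 1) * t) ^ 2 ≤ n ^ 2 * (3 * t) ^ 2 * Fintype.card β := by
  classical
  set N := (2 * J + 1) * t with hNdef
  have hN0 : 0 < N := by positivity
  let U := Fintype.piFinset fun _ : Fin n => Finset.range N
  have hU : U.card = N ^ n := by simp [U, Fintype.card_piFinset]
  let R : (Fin n → ℕ) → β → Prop := fun u i => ∃ l l', l ≠ l' ∧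
    nearWall' N t (f i l + (u l : ℕ)) ∧ nearWall' N t (f i l' + (u l' : ℕ))
  have h1 (u : Fin n → ℕ) : homologyDim P Q ≤ (Finset.univ.filter fun i => R u i).card := by
    have hshift : ∀ p, (Finset.univ.filter fun i =>
        (fun l => f i l + (u l : ℤ)) = p).card ≤ m := fun p => by
      refine (Finset.card_le_card fun i hi => ?_).trans (hm fun l => p l - u l)
      refine Finset.mem_filter.2 ⟨Finset.mem_univ _, funext fun l => ?_⟩
      rw [← congrFun (Finset.mem_filter.1 hi).2 l]
      ring
    refine homologyDim_le_card_codim_two (f := fun i l => f i l + (u l : ℤ)) hPQ hn ht hJ1 hshift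
      (fun r i j hi hj l => ?_) (fun r i j hi hj l => ?_) hD hD' hJ
    · rw [add_sub_add_right_eq_sub]; exact hP r i j hi hj l
    · rw [add_sub_add_right_eq_sub]; exact hQ r i j hi hj l
  have h2 : N ^ n * homologyDim P Q ≤ ∑ u ∈ U, (Finset.univ.filter fun i => R u i).card := by
    rw [← hU, ← smul_eq_mul]
    exact Finset.card_nsmul_le_sum U _ _ fun u _ => h1 u
  have h3 : ∑ u ∈ U, (Finset.univ.filter fun i => R u i).card =
      ∑ i : β, (U.filter fun u => R u i).card := by
    simp only [Finset.card_filter]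
    exact Finset.sum_comm
  refine Nat.le_of_mul_le_mul_left ?_ (pow_pos hN0 n)
  calc N ^ n * (homologyDim P Q * N ^ 2) = (N ^ n * homologyDim P Q) * N ^ 2 := by ring
    _ ≤ (∑ i : β, (U.filter fun u => R u i).card) * N ^ 2 := by rw [← h3]; gcongr
    _ = ∑ i : β, (U.filter fun u => R u i).card * N ^ 2 := Finset.sum_mul _ _ _
    _ ≤ ∑ _i : β, n ^ 2 * (3 * t) ^ 2 * N ^ n :=
        Finset.sum_le_sum fun i _ => card_translations_le N t (f i)
    _ = N ^ n * (n ^ 2 * (3 * t) ^ 2 * Fintype.card β) := by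
        rw [Finset.sum_const, smul_eq_mul, Finset.card_univ]; ring

end Lattice

/-- The tradeoff between dimension and distance for complexes with local checks on a lattice and
bounded density of qubits. The mesh of the grid is chosen of the order of the power `1/(n-1)` of
the distance. -/
theorem exists_dim_distance_bound (n : ℕ) (hn : 2 ≤ n) (m t : ℕ) (hm0 : 0 < m) (ht : 0 < t) :
    ∃ K : ℝ, 0 < K ∧ ∀ {α β γ : Type*} [Fintype α] [Fintype β] [Fintype γ]
      (P : Matrix α β (ZMod 2)) (Q : Matrix β γ (ZMod 2)) (f : β → Fin n → ℤ), P * Q = 0 →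
      (∀ p, (Finset.univ.filter fun i => f i = p).card ≤ m) →
      LocalChecks t f P → LocalChecks t f Q.transpose →
      (homologyDim P Q : ℝ) * ((min (minWeight P Q) (minWeight Q.transpose P.transpose) : ℕ) : ℝ) ^
        ((2 : ℝ) / ((n : ℝ) - 1)) ≤
          K * ((Fintype.card β : ℕ) : ℝ) := by
  have hn1 : (0 : ℝ) < (n : ℝ) - 1 := by
    have : (2 : ℝ) ≤ n := by exact_mod_cast hn
    linarith
  set e : ℝ := (2 : ℝ) / ((n : ℝ) - 1) with he
  have he0 : 0 < e := by positivity
  set a : ℝ := m * (n * (2 * t)) with ha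
  have hn0 : (0 : ℝ) < n := by linarith
  have ha0 : 0 < a := by positivity
  have ht0 : (0 : ℝ) < t := by exact_mod_cast ht
  refine ⟨(5 * t) ^ 2 * a ^ e + 36 * n ^ 2 * t ^ 2 * a ^ e, by positivity, ?_⟩
  intro α β γ _ _ _ P Q f hPQ hm hP hQ
  set D := min (minWeight P Q) (minWeight Q.transpose P.transpose) with hD
  set V : ℝ := ((Fintype.card β : ℕ) : ℝ) with hV
  have hV0 : 0 ≤ V := by positivity
  -- `y` is the mesh for which the walls of the cells would just have as many qubits as the distance
  set y : ℝ := ((D : ℝ) / a) ^ (1 / ((n : ℝ) - 1)) with hy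
  have hDa : 0 ≤ (D : ℝ) / a := by positivity
  have hy0 : 0 ≤ y := by positivity
  have hy2 : (D : ℝ) ^ e = y ^ 2 * a ^ e := by
    rw [hy, ← Real.rpow_natCast, ← Real.rpow_mul hDa, Nat.cast_ofNat,
      show 1 / ((n : ℝ) - 1) * 2 = e by rw [he]; ring, ← Real.mul_rpow hDa ha0.le,
      div_mul_cancel₀ _ ha0.ne']
  have hyn : y ^ (n - 1) = (D : ℝ) / a := by
    rw [hy, ← Real.rpow_natCast, ← Real.rpow_mul hDa, Nat.cast_sub (by omega), Nat.cast_one,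
      one_div_mul_cancel hn1.ne', Real.rpow_one]
  rw [hy2]
  by_cases hsmall : y ≤ 5 * t
  · have h1 : (homologyDim P Q : ℝ) ≤ V := by rw [hV]; exact_mod_cast homologyDim_le hPQ
    calc (homologyDim P Q : ℝ) * (y ^ 2 * a ^ e) ≤ V * ((5 * t) ^ 2 * a ^ e) := by gcongr
      _ ≤ ((5 * t) ^ 2 * a ^ e + 36 * n ^ 2 * t ^ 2 * a ^ e) * V := by
        have : 0 ≤ 36 * n ^ 2 * t ^ 2 * a ^ e * V := by positivity
        nlinarith
  · push Not at hsmall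
    have hyt : 5 < y / t := by rwa [lt_div_iff₀ ht0]
    set J := ⌈(y / t - 3) / 2⌉₊ with hJ
    have hJ1 : (y / t - 3) / 2 ≤ J := Nat.le_ceil _
    have hJ2 : (J : ℝ) < (y / t - 3) / 2 + 1 := Nat.ceil_lt_add_one (by linarith)
    have hJ0 : 1 ≤ J := by
      have : (0 : ℝ) < J := by linarith
      exact_mod_cast this
    have hlt : ((2 * J + 1 : ℝ)) * t < y := by
      rw [← lt_div_iff₀ ht0]; linarith
    have hge : y ≤ 2 * ((2 * J + 1) * t) := by
      have h1 : y / t ≤ 2 * (2 * J + 1) := by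
        have : (1 : ℝ) ≤ J := by exact_mod_cast hJ0
        linarith
      rw [div_le_iff₀ ht0] at h1
      linarith
    have hcond : m * (n * (2 * t) * ((2 * J + 1) * t) ^ (n - 1)) < D := by
      have h1 : a * (((2 * J + 1 : ℝ)) * t) ^ (n - 1) < D := by
        have h2 : (((2 * J + 1 : ℝ)) * t) ^ (n - 1) < y ^ (n - 1) :=
          pow_lt_pow_left₀ hlt (by positivity) (by omega)
        rw [hyn, lt_div_iff₀ ha0] at h2
        linarith
      have h3 : ((m * (n * (2 * t) * ((2 * J + 1) * t) ^ (n - 1)) : ℕ) : ℝ) < D := by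
        push_cast
        rw [ha] at h1
        linarith
      exact_mod_cast h3
    have hmain := homologyDim_mul_sq_le hPQ (by omega) ht hJ0 hm hP hQ (min_le_left _ _)
      (min_le_right _ _) hcond
    have hmain' : (homologyDim P Q : ℝ) * ((2 * J + 1) * t) ^ 2 ≤ n ^ 2 * (3 * t) ^ 2 * V := by
      rw [hV]; exact_mod_cast hmain
    calc (homologyDim P Q : ℝ) * (y ^ 2 * a ^ e)
        ≤ (homologyDim P Q : ℝ) * ((2 * ((2 * J + 1) * t)) ^ 2 * a ^ e) := by gcongr
      _ = 4 * ((homologyDim P Q : ℝ) * ((2 * J + 1) * t) ^ 2) * a ^ e := by ring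
      _ ≤ 4 * (n ^ 2 * (3 * t) ^ 2 * V) * a ^ e := by gcongr
      _ ≤ ((5 * t) ^ 2 * a ^ e + 36 * n ^ 2 * t ^ 2 * a ^ e) * V := by
        have : 0 ≤ (5 * t) ^ 2 * a ^ e * V := by positivity
        nlinarith

/-! ### Coarse maps to Euclidean space -/

section Cells

variable {n : ℕ}

/-- Every point lies in a closed simplex of the standard triangulation with vertices in the unit
cube at its integral part: it is the mean over `θ ∈ (0, 1]` of the vertices obtained by rounding up
the coordinates whose fractional part is at least `θ`. -/
theorem exists_mem_standardCell (y : EuclideanSpace ℝ (Fin n)) :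
    ∃ c : Finset (Fin n → ℤ), (∀ x ∈ c, ∀ l, ⌊y l⌋ ≤ x l ∧ x l ≤ ⌊y l⌋ + 1) ∧
      y ∈ convexHull ℝ (latticePoint '' (c : Set (Fin n → ℤ))) ∧
      convexHull ℝ (latticePoint '' (c : Set (Fin n → ℤ))) ∈ standardCells n := by
  classical
  let g : ℝ → (Fin n → ℤ) := fun θ l => ⌊y l⌋ + if θ ≤ Int.fract (y l) then 1 else 0
  have hg (θ : ℝ) (l : Fin n) : ⌊y l⌋ ≤ g θ l ∧ g θ l ≤ ⌊y l⌋ + 1 := by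
    simp only [g]; split_ifs <;> omega
  have hanti {θ θ' : ℝ} (h : θ ≤ θ') : g θ' ≤ g θ := fun l => by
    simp only [g]
    split_ifs with h1 h2
    · exact le_rfl
    · exact absurd (h.trans h1) h2
    · omega
    · exact le_rfl
  let cube : Finset (Fin n → ℤ) := Fintype.piFinset fun l => Finset.Icc ⌊y l⌋ (⌊y l⌋ + 1)
  let c : Finset (Fin n → ℤ) := cube.filter fun x => ∃ θ, g θ = x
  have hgc (θ : ℝ) : g θ ∈ c := Finset.mem_filter.2
    ⟨Fintype.mem_piFinset.2 fun l => Finset.mem_Icc.2 (hg θ l), θ, rfl⟩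
  have hc (x : Fin n → ℤ) (hx : x ∈ c) (l : Fin n) : ⌊y l⌋ ≤ x l ∧ x l ≤ ⌊y l⌋ + 1 := by
    obtain ⟨-, θ, rfl⟩ := Finset.mem_filter.1 hx
    exact hg θ l
  refine ⟨c, hc, ?_, c, ⟨_, hgc 0⟩, ?_, fun x hx x' hx' l => ?_, rfl⟩
  · let μ : Measure ℝ := volume.restrict (Set.Ioc 0 1)
    have : IsProbabilityMeasure μ := ⟨by simp [μ]⟩
    have hcoord (l : Fin n) : (fun θ => latticePoint (g θ) l) =
        fun θ => (⌊y l⌋ : ℝ) + (Set.Iic (Int.fract (y l))).indicator (fun _ => (1 : ℝ)) θ := by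
      funext θ
      simp only [latticePoint, g, Set.indicator, Set.mem_Iic]
      push_cast
      rfl
    have hint (l : Fin n) : Integrable (fun θ => latticePoint (g θ) l) μ := by
      rw [hcoord]
      exact (integrable_const _).add ((integrable_const _).indicator measurableSet_Iic)
    have hmean : ∫ θ, latticePoint (g θ) ∂μ = y := by
      ext l
      rw [eval_integral_piLp hint, hcoord, integral_add (integrable_const _)
        ((integrable_const _).indicator measurableSet_Iic), integral_const,
        integral_indicator_const _ measurableSet_Iic]
      have h0 := Int.fract_nonneg (y l)
      have h1 := (Int.fract_lt_one (y l)).le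
      have h2 : μ.real (Set.Iic (Int.fract (y l))) = Int.fract (y l) := by
        rw [Measure.real, Measure.restrict_apply measurableSet_Iic, Set.inter_comm,
          Set.Ioc_inter_Iic, min_eq_right h1, Real.volume_Ioc, sub_zero, ENNReal.toReal_ofReal h0]
      rw [h2]
      simp
    rw [← hmean]
    exact (convex_convexHull ℝ _).integral_mem ((c.finite_toSet.image _).isClosed_convexHull ℝ)
      (Filter.Eventually.of_forall fun θ => subset_convexHull ℝ _ ⟨_, hgc θ, rfl⟩)
      (Integrable.of_eval_piLp hint)
  · intro x hx x' hx' _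
    obtain ⟨-, θ, rfl⟩ := Finset.mem_filter.1 hx
    obtain ⟨-, θ', rfl⟩ := Finset.mem_filter.1 hx'
    exact (le_total θ θ').symm.imp hanti hanti
  · have h1 := hc x hx l
    have h2 := hc x' hx' l
    omega

/-- Every standard simplex lies in a slab of width one. -/
theorem exists_slab {τ : Set (EuclideanSpace ℝ (Fin n))} (hτ : τ ∈ standardCells n) (l : Fin n) :
    ∃ j : ℤ, ∀ y ∈ τ, (j : ℝ) ≤ y l ∧ y l ≤ j + 1 := by
  obtain ⟨c, hne, -, hc, rfl⟩ := hτ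
  obtain ⟨x₀, hx₀, hmin⟩ := c.exists_min_image (fun x => x l) hne
  have hconv : Convex ℝ {y : EuclideanSpace ℝ (Fin n) | y l ∈ Set.Icc (x₀ l : ℝ) (x₀ l + 1)} :=
    (convex_Icc _ _).linear_preimage
      (EuclideanSpace.proj l : EuclideanSpace ℝ (Fin n) →L[ℝ] ℝ).toLinearMap
  refine ⟨x₀ l, fun y hy => convexHull_min ?_ hconv hy⟩
  rintro _ ⟨x, hx, rfl⟩
  have h1 := hmin x hx
  have h2 := hc x₀ hx₀ x hx l
  have h3 : x l ≤ x₀ l + 1 := by omega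
  constructor
  · simpa [latticePoint] using h1
  · simp only [latticePoint]
    exact_mod_cast h3

/-- The image of a convex set on which a continuous map meets at most `A` standard simplices has
width less than `A + 2` in each coordinate. -/
theorem coordinate_sub_lt {E : Type*} [NormedAddCommGroup E] [NormedSpace ℝ E] {S : Set E}
    (hS : Convex ℝ S) {F : E → EuclideanSpace ℝ (Fin n)} (hF : ContinuousOn F S) {A : ℕ}
    (hA : {τ ∈ standardCells n | (τ ∩ F '' S).Nonempty}.encard ≤ A) (l : Fin n) {a b : E}
    (ha : a ∈ S) (hb : b ∈ S) : F b l - F a l < A + 2 := by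
  by_contra! hcon
  have hcont : ContinuousOn (fun z => F z l) S :=
    (EuclideanSpace.proj l : EuclideanSpace ℝ (Fin n) →L[ℝ] ℝ).continuous.comp_continuousOn hF
  have hconn := (hS.isPreconnected.image _ hcont).ordConnected
  -- the coordinate takes `A + 1` successive half-integral values, in different simplices
  have hval (j : Fin (A + 1)) : ∃ z ∈ S, F z l = ⌊F a l⌋ + 3 / 2 + (j : ℕ) := by
    have hj : ((j : ℕ) : ℝ) ≤ A := by exact_mod_cast Nat.lt_succ_iff.1 j.2
    have hj0 : (0 : ℝ) ≤ (j : ℕ) := by positivity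
    have h1 := Int.floor_le (F a l)
    have h2 := Int.lt_floor_add_one (F a l)
    have := hconn.out ⟨a, ha, rfl⟩ ⟨b, hb, rfl⟩
      (show (⌊F a l⌋ + 3 / 2 + (j : ℕ) : ℝ) ∈ Set.Icc _ _ from ⟨by linarith, by linarith⟩)
    exact this
  choose z hz hzval using hval
  choose c hc1 hc2 hc3 using fun j => exists_mem_standardCell (F (z j))
  have hinj : Function.Injective fun j =>
      convexHull ℝ (latticePoint '' (c j : Set (Fin n → ℤ))) := by
    intro i j hij
    obtain ⟨q, hq⟩ := exists_slab (hc3 i) l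
    have h1 := hq _ (hc2 i)
    have h2 := hq (F (z j)) (by
      have := hc2 j
      simp only at hij
      rwa [hij])
    rw [hzval] at h1 h2
    have h3 : (q : ℝ) - ⌊F a l⌋ - 3 / 2 ≤ (i : ℕ) ∧ ((i : ℕ) : ℝ) ≤ q - ⌊F a l⌋ - 1 / 2 := by
      constructor <;> linarith
    have h4 : (q : ℝ) - ⌊F a l⌋ - 3 / 2 ≤ (j : ℕ) ∧ ((j : ℕ) : ℝ) ≤ q - ⌊F a l⌋ - 1 / 2 := by
      constructor <;> linarith
    have h5 (k : Fin (A + 1)) (h : (q : ℝ) - ⌊F a l⌋ - 3 / 2 ≤ (k : ℕ) ∧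
        ((k : ℕ) : ℝ) ≤ q - ⌊F a l⌋ - 1 / 2) : ((k : ℕ) : ℤ) = q - ⌊F a l⌋ - 1 := by
      have h6 : (q - ⌊F a l⌋ - 2 : ℝ) < (k : ℕ) := by linarith
      have h7 : ((k : ℕ) : ℝ) < q - ⌊F a l⌋ := by linarith
      have h8 : (q - ⌊F a l⌋ - 2 : ℤ) < (k : ℕ) := by exact_mod_cast h6
      have h9 : ((k : ℕ) : ℤ) < q - ⌊F a l⌋ := by exact_mod_cast h7
      omega
    have h6 := (h5 i h3).trans (h5 j h4).symm
    exact Fin.ext (by exact_mod_cast h6)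
  have hsub : Set.range (fun j => convexHull ℝ (latticePoint '' (c j : Set (Fin n → ℤ)))) ⊆
      {τ ∈ standardCells n | (τ ∩ F '' S).Nonempty} := by
    rintro _ ⟨j, rfl⟩
    exact ⟨hc3 j, F (z j), hc2 j, z j, hz j, rfl⟩
  have h1 := (Set.encard_le_encard hsub).trans hA
  rw [← Set.image_univ, hinj.encard_image, Set.encard_univ, ENat.card_eq_coe_fintype_card,
    Fintype.card_fin] at h1
  have h2 : A + 1 ≤ A := by exact_mod_cast h1
  omega

theorem abs_floor_sub_floor_le {a b : ℝ} {t : ℕ} (h : |a - b| ≤ t) : |⌊a⌋ - ⌊b⌋| ≤ (t : ℤ) + 1 := by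
  have h1 := abs_le.1 h
  have h2 := Int.floor_le a
  have h3 := Int.lt_floor_add_one a
  have h4 := Int.floor_le b
  have h5 := Int.lt_floor_add_one b
  have h6 : (⌊a⌋ : ℝ) - ⌊b⌋ < t + 1 := by linarith
  have h7 : (⌊b⌋ : ℝ) - ⌊a⌋ < t + 1 := by linarith
  have h8 : ⌊a⌋ - ⌊b⌋ < (t : ℤ) + 1 := by exact_mod_cast h6
  have h9 : ⌊b⌋ - ⌊a⌋ < (t : ℤ) + 1 := by exact_mod_cast h7
  exact abs_le.2 ⟨by omega, by omega⟩

end Cells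

section Coarse

variable {ι : Type*} [Fintype ι] {M : AbstractSimplicialComplex ι} {n A : ℕ}
  {F : (ι → ℝ) → EuclideanSpace ℝ (Fin n)}

theorem closedSimplex_injective :
    Function.Injective (closedSimplex : Finset ι → Set (ι → ℝ)) := by
  classical
  have key {s t : Finset ι} (h : closedSimplex s =
      closedSimplex t) : s ⊆ t := by
    intro i hi
    have hmem : Pi.single i (1 : ℝ) ∈ closedSimplex s := by
      refine ⟨single_mem_stdSimplex ℝ i, fun j hj => Pi.single_eq_of_ne ?_ _⟩
      rintro rfl
      exact hj hi
    rw [h] at hmem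
    by_contra hit
    have := hmem.2 i hit
    simp at this
  exact fun s t h => Finset.Subset.antisymm (key h) (key h.symm)

/-- At most `A` simplices have a point over a given standard simplex. -/
theorem IsCoarse.card_le (hF : IsCoarse A M.cells (standardCells n) F)
    {τ : Set (EuclideanSpace ℝ (Fin n))} (hτ : τ ∈ standardCells n) {S : Finset (Finset ι)}
    (hS : ∀ s ∈ S, s ∈ M.faces ∧ ∃ x ∈ closedSimplex s, F x ∈ τ) :
    S.card ≤ A := by
  have h1 : (closedSimplex '' (S : Set (Finset ι))) ⊆
      {σ ∈ M.cells | (σ ∩ F ⁻¹' τ).Nonempty} := by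
    rintro _ ⟨s, hs, rfl⟩
    obtain ⟨hs1, x, hx, hxτ⟩ := hS s hs
    exact ⟨⟨s, hs1, rfl⟩, x, hx, hxτ⟩
  have h2 := (Set.encard_le_encard h1).trans (hF.2 τ hτ)
  rw [closedSimplex_injective.encard_image, Set.encard_coe_eq_coe_finsetCard] at h2
  exact_mod_cast h2

/-- A simplex is contained in at most `A` simplices. -/
theorem IsCoarse.card_cofaces_le (hF : IsCoarse A M.cells (standardCells n) F) {s : Finset ι}
    (hs : s.Nonempty) {S : Finset (Finset ι)} (hS : ∀ T ∈ S, T ∈ M.faces ∧ s ⊆ T) :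
    S.card ≤ A := by
  obtain ⟨c, -, hc, hcell⟩ := exists_mem_standardCell (F (barycentre s))
  exact hF.card_le hcell fun T hT => ⟨(hS T hT).1, barycentre s,
    closedSimplex_mono (hS T hT).2 (barycentre_mem_closedSimplex hs), hc⟩

/-- The position of a simplex: the integral part of the image of its barycentre. -/
noncomputable def simplexPosition (F : (ι → ℝ) → EuclideanSpace ℝ (Fin n)) (s : Finset ι)
    (l : Fin n) : ℤ := ⌊F (barycentre s) l⌋

/-- A bounded number of simplices has a given position, since there is a bounded number of
standard simplices in a unit cube. -/
theorem IsCoarse.card_position_le (hF : IsCoarse A M.cells (standardCells n) F) {p : Fin n → ℤ}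
    {S : Finset (Finset ι)} (hS : ∀ s ∈ S, s ∈ M.faces ∧ simplexPosition F s = p) :
    S.card ≤ A * 2 ^ 2 ^ n := by
  classical
  choose c hc1 hc2 hc3 using fun s => exists_mem_standardCell (F (barycentre s))
  let cube : Finset (Fin n → ℤ) := Fintype.piFinset fun l => Finset.Icc (p l) (p l + 1)
  have hcube : cube.card = 2 ^ n := by
    have (a : ℤ) : (Finset.Icc a (a + 1)).card = 2 := by rw [Int.card_Icc]; omega
    simp only [cube, Fintype.card_piFinset, this, Finset.prod_const, Finset.card_univ,
      Fintype.card_fin]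
  rw [← hcube, ← Finset.card_powerset]
  refine Finset.card_le_mul_card_image_of_maps_to (f := c) (fun s hs => ?_) A fun b _ => ?_
  · refine Finset.mem_powerset.2 fun x hx => Fintype.mem_piFinset.2 fun l => Finset.mem_Icc.2 ?_
    rw [← congrFun (hS s hs).2 l]
    exact hc1 s x hx l
  · rcases Finset.eq_empty_or_nonempty (S.filter fun s => c s = b) with h | ⟨s₀, hs₀⟩
    · rw [h, Finset.card_empty]; exact Nat.zero_le _
    · have hb := hc3 s₀
      rw [(Finset.mem_filter.1 hs₀).2] at hb
      refine hF.card_le hb fun s hs => ?_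
      obtain ⟨hs, hsb⟩ := Finset.mem_filter.1 hs
      refine ⟨(hS s hs).1, barycentre s,
        barycentre_mem_closedSimplex
          (AbstractSimplicialComplex.nonempty_of_mem_faces (hS s hs).1), ?_⟩
      have := hc2 s
      rwa [hsb] at this

/-- Incident simplices have images of their barycentres at bounded distance. -/
theorem IsCoarse.abs_sub_le (hF : IsCoarse A M.cells (standardCells n) F)
    (hcont : ContinuousOn F M.realization) {s t : Finset ι} (hs : s ∈ M.faces) (ht : t ∈ M.faces)
    (hst : s ⊆ t) (l : Fin n) : |F (barycentre s) l - F (barycentre t) l| ≤ A + 2 := by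
  have hcell : closedSimplex t ∈ M.cells := ⟨t, ht, rfl⟩
  have h1 := closedSimplex_mono hst
    (barycentre_mem_closedSimplex (AbstractSimplicialComplex.nonempty_of_mem_faces hs))
  have h2 := barycentre_mem_closedSimplex (AbstractSimplicialComplex.nonempty_of_mem_faces ht)
  have key {a b : ι → ℝ} (ha : a ∈ closedSimplex t)
      (hb : b ∈ closedSimplex t) : F b l - F a l < A + 2 :=
    coordinate_sub_lt (convex_closedSimplex t) (hcont.mono fun x hx => ⟨_, hcell, hx⟩)
      (hF.1 _ hcell) l ha hb
  rw [abs_le]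
  constructor
  · linarith [key h1 h2]
  · linarith [key h2 h1]

/-- Simplices that are incident to a common simplex have positions at bounded distance. -/
theorem IsCoarse.abs_position_sub_le (hF : IsCoarse A M.cells (standardCells n) F)
    (hcont : ContinuousOn F M.realization) {r s t : Finset ι} (hr : r ∈ M.faces) (hs : s ∈ M.faces)
    (ht : t ∈ M.faces) (h : r ⊆ s ∧ r ⊆ t ∨ s ⊆ r ∧ t ⊆ r) (l : Fin n) :
    |simplexPosition F s l - simplexPosition F t l| ≤ ((2 * A + 5 : ℕ) : ℤ) := by
  have key : |F (barycentre s) l - F (barycentre t) l| ≤ ((2 * A + 4 : ℕ) : ℝ) := by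
    push_cast
    rcases h with ⟨h1, h2⟩ | ⟨h1, h2⟩
    · have h3 := abs_le.1 (hF.abs_sub_le hcont hr hs h1 l)
      have h4 := abs_le.1 (hF.abs_sub_le hcont hr ht h2 l)
      exact abs_le.2 ⟨by linarith, by linarith⟩
    · have h3 := abs_le.1 (hF.abs_sub_le hcont hs hr h1 l)
      have h4 := abs_le.1 (hF.abs_sub_le hcont ht hr h2 l)
      exact abs_le.2 ⟨by linarith, by linarith⟩
  have := abs_floor_sub_floor_le key
  rw [simplexPosition, simplexPosition]
  push_cast at this ⊢
  linarith

end Coarse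

/-! ### Systoles of triangulated manifolds -/

namespace AbstractSimplicialComplex

section ExtendChain

variable {ι : Type*} {M : AbstractSimplicialComplex ι} {k : ℕ}

open Classical in
/-- A chain, as a function on all finite sets of vertices that vanishes outside the
`k`-simplices. -/
noncomputable def extendChain (z : M.Simplex k → ZMod 2) (s : Finset ι) : ZMod 2 :=
  if h : s ∈ M.faces ∧ s.card = k + 1 then z ⟨s, h⟩ else 0

theorem extendChain_apply (z : M.Simplex k → ZMod 2) (σ : M.Simplex k) :
    extendChain z σ.1 = z σ := dif_pos σ.2

theorem mem_faces_of_extendChain_ne_zero {z : M.Simplex k → ZMod 2} {s : Finset ι}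
    (hs : extendChain z s ≠ 0) : s ∈ M.faces ∧ s.card = k + 1 := by
  by_contra h
  exact hs (dif_neg h)

theorem erase_mem_faces [DecidableEq ι] {s : Finset ι} (hs : s ∈ M.faces) (hcard : 2 ≤ s.card)
    {x : ι} (hx : x ∈ s) : s.erase x ∈ M.faces :=
  (M.isRelLowerSet_faces hs).2 (Finset.erase_subset x s)
    (Finset.card_pos.1 (by rw [Finset.card_erase_of_mem hx]; omega))

end ExtendChain

variable {ι : Type*} [Fintype ι] {M : AbstractSimplicialComplex ι} {k d A : ℕ}

theorem transpose_boundary_mulVec [DecidableEq ι] (hk : 0 < k) (ψ : Finset ι → ZMod 2)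
    (u : M.Simplex k) :
    (M.boundary k).transpose.mulVec (fun τ => ψ τ.1) u = ∑ x ∈ u.1, ψ (u.1.erase x) := by
  classical
  simp only [Matrix.mulVec, dotProduct, Matrix.transpose_apply, boundary, ite_mul, one_mul,
    zero_mul]
  rw [← Finset.sum_filter]
  have hface (x : ι) (hx : x ∈ u.1) :
      u.1.erase x ∈ M.faces ∧ (u.1.erase x).card = k - 1 + 1 :=
    ⟨erase_mem_faces u.2.1 (by rw [u.2.2]; omega) hx, by
      rw [Finset.card_erase_of_mem hx, u.2.2]; omega⟩
  symm
  refine Finset.sum_bij (fun x hx => (⟨u.1.erase x, hface x hx⟩ : M.Simplex (k - 1)))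
    (fun x hx => Finset.mem_filter.2 ⟨Finset.mem_univ _, Finset.erase_ssubset hx⟩)
    (fun x hx y hy h => Finset.erase_injOn u.1 hx hy (congrArg Subtype.val h)) (fun τ hτ => ?_)
    (fun x hx => rfl)
  obtain ⟨x, hx, hsub⟩ := Finset.ssubset_iff_exists_subset_erase.1 (Finset.mem_filter.1 hτ).2
  refine ⟨x, hx, Subtype.ext (Finset.eq_of_subset_of_card_le hsub ?_).symm⟩
  rw [(hface x hx).2, τ.2.2]

theorem boundary_mulVec [DecidableEq ι] (hk : 0 < k) {z : Finset ι → ZMod 2}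
    (hz : ∀ s, z s ≠ 0 → s ∈ M.faces ∧ s.card = k + 1) (t : M.Simplex (k - 1)) :
    (M.boundary k).mulVec (fun σ => z σ.1) t = ∑ x ∈ t.1ᶜ, z (insert x t.1) := by
  classical
  simp only [Matrix.mulVec, dotProduct, boundary, ite_mul, one_mul, zero_mul]
  rw [← Finset.sum_filter, ← Finset.sum_filter_ne_zero]
  nth_rewrite 2 [← Finset.sum_filter_ne_zero]
  have hmem {x : ι} (hx : x ∈ t.1ᶜ.filter fun x => z (insert x t.1) ≠ 0) : x ∉ t.1 :=
    Finset.mem_compl.1 (Finset.mem_filter.1 hx).1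
  symm
  refine Finset.sum_bij (fun x hx => (⟨insert x t.1, hz _ (Finset.mem_filter.1 hx).2⟩ :
    M.Simplex k)) (fun x hx => ?_) (fun x hx y hy h => ?_) (fun σ hσ => ?_) (fun x hx => rfl)
  · exact Finset.mem_filter.2 ⟨Finset.mem_filter.2 ⟨Finset.mem_univ _,
      Finset.ssubset_insert (hmem hx)⟩, (Finset.mem_filter.1 hx).2⟩
  · have h1 : insert x t.1 = insert y t.1 := congrArg Subtype.val h
    have h2 : x ∈ insert y t.1 := h1 ▸ Finset.mem_insert_self x t.1
    exact (Finset.mem_insert.1 h2).resolve_right (hmem hx)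
  · obtain ⟨hσ, hne⟩ := Finset.mem_filter.1 hσ
    obtain ⟨x, hx, hsub⟩ := Finset.ssubset_iff.1 (Finset.mem_filter.1 hσ).2
    have heq : insert x t.1 = σ.1 := by
      refine Finset.eq_of_subset_of_card_le hsub ?_
      rw [Finset.card_insert_of_notMem hx, σ.2.2, t.2.2]
      omega
    exact ⟨x, Finset.mem_filter.2 ⟨Finset.mem_compl.2 hx, by rwa [heq]⟩, Subtype.ext heq⟩

theorem boundary_mul_boundary (M : AbstractSimplicialComplex ι) (hk : 0 < k) :
    HMul.hMul (β := Matrix (M.Simplex k) (M.Simplex (k + 1)) (ZMod 2))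
      (M.boundary k) (M.boundary (k + 1)) = 0 := by
  classical
  ext τ ρ
  refine Eq.trans ?_ ((transpose_boundary_mulVec (M := M) k.succ_pos
    (fun s => if τ.1 ⊂ s then (1 : ZMod 2) else 0) ρ).trans ?_)
  · simp only [Matrix.mul_apply, Matrix.mulVec, dotProduct, Matrix.transpose_apply, boundary]
    exact Finset.sum_congr rfl fun _ _ => mul_comm _ _
  rw [Matrix.zero_apply]
  have hτ := τ.2.2
  have hρ := ρ.2.2
  rw [Finset.sum_ite, Finset.sum_const_zero, add_zero, Finset.sum_const, nsmul_eq_mul, mul_one]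
  by_cases hsub : τ.1 ⊆ ρ.1
  · have h3 : (ρ.1.filter fun x => τ.1 ⊂ ρ.1.erase x) = ρ.1 \ τ.1 := by
      ext x
      rw [Finset.mem_filter, Finset.mem_sdiff]
      refine and_congr_right fun hx => ⟨fun h hxτ => ?_, fun h => ?_⟩
      · exact Finset.notMem_erase x ρ.1 (h.1 hxτ)
      · refine ⟨Finset.subset_erase.2 ⟨hsub, h⟩, fun h' => ?_⟩
        have h4 := Finset.card_le_card h'
        rw [Finset.card_erase_of_mem hx, hρ, hτ] at h4
        omega
    rw [h3, Finset.card_sdiff_of_subset hsub, hρ, hτ,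
      show k + 1 + 1 - (k - 1 + 1) = 2 by omega]
    rfl
  · rw [Finset.filter_false_of_mem, Finset.card_empty, Nat.cast_zero]
    exact fun x _ h => hsub (h.1.trans (Finset.erase_subset x ρ.1))

theorem IsTriangulatedManifold.isHomologyManifold [DecidableEq ι]
    (hM : M.IsTriangulatedManifold d) : IsHomologyManifold M.allFaces d :=
  ⟨M.isLowerSet_allFaces, fun _ hs hne => hM.hasSphereHomology ((mem_allFaces hne).1 hs)⟩

/-- The number of `k`-simplices is bounded by the volume. -/
theorem IsTriangulatedManifold.card_simplex_le (hM : M.IsTriangulatedManifold d) :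
    Fintype.card (M.Simplex k) ≤ 2 ^ (d + 1) * M.vol d := by
  classical
  have hex (σ : M.Simplex k) : ∃ T : M.Simplex d, σ.1 ⊆ T.1 := by
    have hne := nonempty_of_mem_faces σ.2.1
    obtain ⟨T, hT, hcard, hsub⟩ :=
      hM.isHomologyManifold.exists_facet ((mem_allFaces hne).2 σ.2.1) hne
    exact ⟨⟨T, hT (hne.mono hsub), hcard⟩, hsub⟩
  choose T hT using hex
  rw [← Finset.card_univ, vol, ← Finset.card_univ]
  refine Finset.card_le_mul_card_image_of_maps_to (f := T) (fun _ _ => Finset.mem_univ _) _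
    fun t _ => ?_
  rw [← t.2.2, ← Finset.card_powerset]
  refine Finset.card_le_card_of_injOn Subtype.val (fun σ hσ => ?_)
    fun _ _ _ _ h => Subtype.val_injective h
  rw [Finset.mem_coe, Finset.mem_powerset, ← (Finset.mem_filter.1 hσ).2]
  exact hT σ

/-- By Poincaré duality the systole of dimension `d - k` is bounded by a multiple of the weight of
the smallest nontrivial cocycle of dimension `k`. -/
theorem IsTriangulatedManifold.systole_le (hM : M.IsTriangulatedManifold d) (hk : 0 < k)
    (hkd : k < d)
    (hA : ∀ s : Finset ι, s.Nonempty → ∀ S : Finset (Finset ι),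
      (∀ T ∈ S, T ∈ M.faces ∧ s ⊆ T) → S.card ≤ A)
    (hH : M.bettiTwo k ≠ 0) :
    M.systole (d - k) ≤
      A * 2 ^ (d + 1) * minWeight (M.boundary (k + 1)).transpose (M.boundary k).transpose := by
  classical
  have hne : {w : ℕ | ∃ v : M.Simplex k → ZMod 2,
      v ∈ LinearMap.ker (M.boundary (k + 1)).transpose.mulVecLin ∧
      v ∉ LinearMap.range (M.boundary k).transpose.mulVecLin ∧ hammingNorm v = w}.Nonempty := by
    by_contra hcon
    refine hH (Nat.eq_zero_of_le_zero ?_)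
    refine homologyDim_le_card (A := Set.univ) (B := ∅) (C := ∅) (M.boundary_mul_boundary hk)
      (fun v hv _ => ?_) (fun v _ hv => ⟨0, ?_⟩) fun i => Or.inl trivial
    · by_contra h
      exact hcon ⟨_, v, LinearMap.mem_ker.2 hv, fun ⟨y, hy⟩ => h ⟨y, hy⟩, rfl⟩
    · rw [Matrix.mulVec_zero]; exact (funext fun i => hv i id).symm
  obtain ⟨φ, hφ1, hφ2, hφ3⟩ := Nat.sInf_mem hne
  replace hφ3 : hammingNorm φ =
      minWeight (M.boundary (k + 1)).transpose (M.boundary k).transpose := hφ3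
  have hφE : (fun σ : M.Simplex k => extendChain φ σ.1) = φ := funext fun σ => extendChain_apply φ σ
  obtain ⟨z, hz1, hz2, hz3, hz4⟩ := exists_dual_cycle hM.isHomologyManifold hk hkd
    (φ := extendChain φ) (fun s hs => (mem_faces_of_extendChain_ne_zero hs).imp_left fun h _ => h)
    (fun u hu hcard => by
      have hune : u.Nonempty := Finset.card_pos.1 (by omega)
      have h1 := transpose_boundary_mulVec (M := M) k.succ_pos (extendChain φ) ⟨u, hu hune, hcard⟩
      rw [← h1]
      exact congrFun ((congrArg _ hφE).trans (LinearMap.mem_ker.1 hφ1)) _)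
  have hzface (t : Finset ι) (ht : z t ≠ 0) : t ∈ M.faces ∧ t.card = d - k + 1 :=
    ⟨(hz1 t ht).1 (Finset.card_pos.1 (by rw [(hz1 t ht).2]; omega)), (hz1 t ht).2⟩
  have hmem : hammingNorm (fun σ : M.Simplex (d - k) => z σ.1) ∈ {w : ℕ | ∃ v,
      v ∈ LinearMap.ker (M.boundary (d - k)).mulVecLin ∧
      v ∉ LinearMap.range (M.boundary (d - k + 1)).mulVecLin ∧ hammingNorm v = w} := by
    refine ⟨_, LinearMap.mem_ker.2 (funext fun t => ?_), ?_, rfl⟩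
    · rw [Matrix.mulVecLin_apply, boundary_mulVec (by omega) hzface]
      exact hz2 _ (nonempty_of_mem_faces t.2.1)
    · rintro ⟨y, hy⟩
      have hyE : (fun σ : M.Simplex (d - k + 1) => extendChain y σ.1) = y :=
        funext fun σ => extendChain_apply y σ
      obtain ⟨ψ, hψ⟩ := hz4 (extendChain y)
        (fun s hs => (mem_faces_of_extendChain_ne_zero hs).imp_left fun h _ => h) fun t htne => by
          by_cases ht : t ∈ M.faces ∧ t.card = d - k + 1
          · have h1 := boundary_mulVec (M := M) (d - k).succ_pos
              (fun s hs => mem_faces_of_extendChain_ne_zero (z := y) hs) ⟨t, ht⟩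
            rw [← h1]
            exact (congrFun (congrArg _ hyE) _).trans (congrFun hy (⟨t, ht⟩ : M.Simplex (d - k)))
          · have h1 : z t = 0 := by by_contra h; exact ht (hzface t h)
            rw [h1]
            refine Finset.sum_eq_zero fun x hx => ?_
            by_contra h
            obtain ⟨h2, h3⟩ := mem_faces_of_extendChain_ne_zero h
            rw [Finset.card_insert_of_notMem (Finset.mem_compl.1 hx)] at h3
            exact ht ⟨(M.isRelLowerSet_faces h2).2 (Finset.subset_insert x t) htne, by omega⟩
      refine hφ2 ⟨fun τ => ψ τ.1, funext fun s => ?_⟩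
      rw [Matrix.mulVecLin_apply, transpose_boundary_mulVec hk, hψ s.1 (fun _ => s.2.1) s.2.2,
        extendChain_apply]
  refine (Nat.sInf_le hmem).trans ?_
  let facets : Finset ι → Finset (Finset ι) := fun s =>
    Finset.univ.filter fun T => T ∈ M.faces ∧ T.card = d + 1 ∧ s ⊆ T
  let W : Finset (Finset ι) := (Finset.univ.filter fun σ : M.Simplex k => φ σ ≠ 0).biUnion fun σ =>
    (facets σ.1).biUnion Finset.powerset
  have hW : W.card ≤ hammingNorm φ * (A * 2 ^ (d + 1)) := by
    refine Finset.card_biUnion_le_card_mul _ _ _ fun σ _ => ?_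
    refine (Finset.card_biUnion_le_card_mul _ _ (2 ^ (d + 1)) fun T hT => ?_).trans ?_
    · rw [Finset.card_powerset, (Finset.mem_filter.1 hT).2.2.1]
    · refine Nat.mul_le_mul_right _ (hA σ.1 (nonempty_of_mem_faces σ.2.1) _ fun T hT => ?_)
      exact ⟨(Finset.mem_filter.1 hT).2.1, (Finset.mem_filter.1 hT).2.2.2⟩
  rw [← hφ3, mul_comm]
  refine le_trans (Finset.card_le_card_of_injOn Subtype.val (fun σ hσ => ?_)
    fun _ _ _ _ h => Subtype.val_injective h) hW
  obtain ⟨s, hs, T, hT, hcard, hsT, htT⟩ := hz3 σ.1 (Finset.mem_filter.1 hσ).2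
  have hs' := mem_faces_of_extendChain_ne_zero hs
  refine Finset.mem_biUnion.2 ⟨⟨s, hs'⟩, Finset.mem_filter.2 ⟨Finset.mem_univ _, ?_⟩,
    Finset.mem_biUnion.2 ⟨T, Finset.mem_filter.2 ⟨Finset.mem_univ _, ?_, hcard, hsT⟩,
      Finset.mem_powerset.2 htT⟩⟩
  · rwa [← extendChain_apply φ ⟨s, hs'⟩]
  · exact hT (Finset.card_pos.1 (by omega))

end AbstractSimplicialComplex

/-! ### The tradeoff for local codes and local manifolds -/

/-- The tradeoff between dimension and distance of local codes. -/
theorem CSSCode.exists_dim_mul_dist_le (n : ℕ) (hn : 2 ≤ n) (A : ℝ) : ∃ K : ℝ, 0 < K ∧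
    ∀ {ι₂ ι₁ ι₀ : Type*} [Fintype ι₂] [Fintype ι₁] [Fintype ι₀] (C : CSSCode ι₂ ι₁ ι₀),
      C.IsLocal n A →
        (C.dim : ℝ) * (C.dist : ℝ) ^ ((2 : ℝ) / ((n : ℝ) - 1)) ≤ K * (C.size : ℝ) := by
  -- the density is `1` as the positions of the qubits are distinct
  obtain ⟨K, hK, h⟩ := exists_dim_distance_bound n hn 1 (max 1 ⌈A⌉₊) one_pos (by simp)
  refine ⟨K, hK, ?_⟩
  rintro ι₂ ι₁ ι₀ _ _ _ C ⟨f, hf, -, hloc⟩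
  classical
  have key (i j : ι₁) (hij : i ≠ j → C.PartOfCheck i j) (l : Fin n) :
      |f i l - f j l| ≤ ((max 1 ⌈A⌉₊ : ℕ) : ℤ) := by
    by_cases h0 : i = j
    · rw [h0, sub_self, abs_zero]; positivity
    have h1 : |(f i l : ℝ) - f j l| ≤ A :=
      (Finset.single_le_sum (f := fun l => |(f i l : ℝ) - f j l|) (fun _ _ => abs_nonneg _)
        (Finset.mem_univ l)).trans (hloc i j (hij h0))
    have h2 : A ≤ ((max 1 ⌈A⌉₊ : ℕ) : ℝ) :=
      (Nat.le_ceil A).trans (by exact_mod_cast le_max_right _ _)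
    exact_mod_cast h1.trans h2
  refine h C.H₁ C.H₂.transpose f C.mul_transpose (fun p => ?_)
    (fun r i j hi hj => key i j fun hij => ⟨hij, Or.inl ⟨r, hi, hj⟩⟩)
    (fun r i j hi hj => key i j fun hij => ⟨hij, Or.inr ⟨r, hi, hj⟩⟩)
  refine Finset.card_le_one.2 fun i hi j hj => hf ?_
  rw [(Finset.mem_filter.1 hi).2, (Finset.mem_filter.1 hj).2]

/-- Solving the tradeoff for the dimension, when the distance is of order `V ^ ((n - 1) / n)` up to
a power of `log V`. The constants are absorbed by a power of `log V`, as `log V ≥ log 3 > 1`. -/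
theorem exists_polylog_bound {n : ℕ} (hn : 2 ≤ n) {K a c : ℝ} (ha : 0 < a)
    (hc : 0 < c) : ∃ b : ℝ, 0 < b ∧ ∀ k D V : ℝ, 0 ≤ k → 3 ≤ V →
      k * D ^ ((2 : ℝ) / ((n : ℝ) - 1)) ≤ K * V →
      c * (V ^ (((n : ℝ) - 1) / n) * Real.log V ^ (-a)) ≤ D →
      k ≤ V ^ (((n : ℝ) - 2) / n) * Real.log V ^ b := by
  have hn' : (2 : ℝ) ≤ n := by exact_mod_cast hn
  have hn1 : 0 < (n : ℝ) - 1 := by linarith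
  have hn0 : (0 : ℝ) < n := by linarith
  set e : ℝ := (2 : ℝ) / ((n : ℝ) - 1) with he
  have he0 : 0 < e := by positivity
  set B : ℝ := max 1 (K / c ^ e) with hB
  have hB1 : 1 ≤ B := le_max_left _ _
  have hlog3 : 1 < Real.log 3 := by
    rw [Real.lt_log_iff_exp_lt (by norm_num)]
    exact Real.exp_one_lt_d9.trans (by norm_num)
  have hll : 0 < Real.log (Real.log 3) := Real.log_pos hlog3
  refine ⟨a * e + Real.log B / Real.log (Real.log 3),
    add_pos_of_pos_of_nonneg (by positivity) (div_nonneg (Real.log_nonneg hB1) hll.le), ?_⟩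
  intro k D V hk hV hKV hD
  have hV0 : 0 < V := by linarith
  set L := Real.log V with hL
  have hL3 : Real.log 3 ≤ L := Real.log_le_log (by norm_num) hV
  have hL0 : 0 < L := by linarith
  have hBL : B ≤ L ^ (Real.log B / Real.log (Real.log 3)) := by
    calc B = Real.log 3 ^ (Real.log B / Real.log (Real.log 3)) := by
          rw [Real.rpow_def_of_pos (by linarith), mul_div_cancel₀ _ hll.ne',
            Real.exp_log (by linarith)]
      _ ≤ _ := Real.rpow_le_rpow (by linarith) hL3 (div_nonneg (Real.log_nonneg hB1) hll.le)
  have hce : 0 < c ^ e := Real.rpow_pos_of_pos hc e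
  have hpow : (c * (V ^ (((n : ℝ) - 1) / n) * L ^ (-a))) ^ e =
      c ^ e * (V ^ (2 / (n : ℝ)) * L ^ (-(a * e))) := by
    rw [Real.mul_rpow hc.le (by positivity), Real.mul_rpow (by positivity) (by positivity),
      ← Real.rpow_mul hV0.le, ← Real.rpow_mul hL0.le, neg_mul]
    have hexp : ((n : ℝ) - 1) / n * e = 2 / n := by rw [he]; field_simp
    rw [hexp]
  have h1 : k * (c ^ e * (V ^ (2 / (n : ℝ)) * L ^ (-(a * e)))) ≤ K * V := by
    refine le_trans ?_ hKV
    rw [← hpow]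
    gcongr
  have hX : 0 < V ^ (2 / (n : ℝ)) * L ^ (-(a * e)) := by positivity
  have h2 : k * (V ^ (2 / (n : ℝ)) * L ^ (-(a * e))) ≤ K / c ^ e * V := by
    rw [div_mul_eq_mul_div, le_div_iff₀ hce]
    linarith
  have h3 : V = V ^ (((n : ℝ) - 2) / n) * V ^ (2 / (n : ℝ)) := by
    rw [← Real.rpow_add hV0, ← add_div, sub_add_cancel, div_self hn0.ne', Real.rpow_one]
  have h4 : L ^ (a * e) * L ^ (-(a * e)) = 1 := by
    rw [← Real.rpow_add hL0, add_neg_cancel, Real.rpow_zero]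
  refine le_of_mul_le_mul_right (h2.trans ?_) hX
  calc K / c ^ e * V ≤ L ^ (Real.log B / Real.log (Real.log 3)) * V := by
        gcongr
        exact (le_max_right _ _).trans hBL
    _ = (V ^ (((n : ℝ) - 2) / n) * V ^ (2 / (n : ℝ))) * (L ^ (a * e) * L ^ (-(a * e))) *
        L ^ (Real.log B / Real.log (Real.log 3)) := by rw [← h3, h4]; ring
    _ = _ := by rw [Real.rpow_add hL0]; ring

/-- The tradeoff between Betti number and systoles of local manifolds. -/
theorem AbstractSimplicialComplex.exists_bettiTwo_mul_systole_le (n d k : ℕ) (hn : 2 ≤ n)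
    (hk : 0 < k) (hkd : k < d) (A : ℕ) : ∃ K : ℝ, 0 < K ∧
    ∀ {ι : Type*} [Fintype ι] (M : AbstractSimplicialComplex ι),
      M.IsTriangulatedManifold d → M.IsLocal d n A →
        (M.bettiTwo k : ℝ) * ((min (M.systole k) (M.systole (d - k)) : ℕ) : ℝ) ^
          ((2 : ℝ) / ((n : ℝ) - 1)) ≤ K * (M.vol d : ℝ) := by
  have hn1 : 0 < (n : ℝ) - 1 := by
    have : (2 : ℝ) ≤ n := by exact_mod_cast hn
    linarith
  set e : ℝ := (2 : ℝ) / ((n : ℝ) - 1) with he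
  have he0 : 0 < e := by positivity
  obtain ⟨K, hK, h⟩ := exists_dim_distance_bound n hn (A * 2 ^ 2 ^ n + 1) (2 * A + 5)
    (by positivity) (by positivity)
  -- the systole exceeds the weight of a smallest nontrivial cocycle by at most this factor
  set a : ℕ := A * 2 ^ (d + 1) + 1 with ha
  refine ⟨(a : ℝ) ^ e * (K * 2 ^ (d + 1)), by positivity, ?_⟩
  rintro ι _ M hM ⟨F, -, -, hcont, -, -, hF⟩
  classical
  have hbd {i : ℕ} {τ : M.Simplex (i - 1)} {σ : M.Simplex i} (hne : M.boundary i τ σ ≠ 0) :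
      τ.1 ⊆ σ.1 := by
    by_contra hcon
    exact hne (if_neg fun hss => hcon hss.1)
  have hmain := h (M.boundary k) (M.boundary (k + 1)) (fun σ => simplexPosition F σ.1)
    (M.boundary_mul_boundary hk) (fun p => ?_)
    (fun r i j hi hj l => hF.abs_position_sub_le hcont r.2.1 i.2.1 j.2.1
      (Or.inl ⟨hbd hi, hbd hj⟩) l)
    (fun r i j hi hj l => hF.abs_position_sub_le hcont r.2.1 i.2.1 j.2.1
      (Or.inr ⟨hbd (i := k + 1) (τ := i) hi, hbd (i := k + 1) (τ := j) hj⟩) l)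
  · by_cases hH : M.bettiTwo k = 0
    · rw [hH, Nat.cast_zero, zero_mul]; positivity
    have hdual := hM.systole_le hk hkd
      (fun s hs S hS => hF.card_cofaces_le hs hS) hH
    set D := min (minWeight (M.boundary k) (M.boundary (k + 1)))
      (minWeight (M.boundary (k + 1)).transpose (M.boundary k).transpose) with hD
    have hmin : min (M.systole k) (M.systole (d - k)) ≤ a * D := by
      rcases min_choice (minWeight (M.boundary k) (M.boundary (k + 1)))
        (minWeight (M.boundary (k + 1)).transpose (M.boundary k).transpose) with h1 | h1
      · rw [hD, h1]
        exact (min_le_left _ _).trans (Nat.le_mul_of_pos_left _ (by positivity))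
      · rw [hD, h1]
        exact (min_le_right _ _).trans (hdual.trans (Nat.mul_le_mul_right _ (Nat.le_succ _)))
    have hmin' : ((min (M.systole k) (M.systole (d - k)) : ℕ) : ℝ) ≤ a * D := by
      exact_mod_cast hmin
    have hcard : (Fintype.card (M.Simplex k) : ℝ) ≤ 2 ^ (d + 1) * M.vol d := by
      exact_mod_cast hM.card_simplex_le
    calc _ ≤ (M.bettiTwo k : ℝ) * (a * D : ℝ) ^ e := by gcongr
      _ = (a : ℝ) ^ e * ((M.bettiTwo k : ℝ) * (D : ℝ) ^ e) := by
        rw [Real.mul_rpow (by positivity) (by positivity)]; ring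
      _ ≤ (a : ℝ) ^ e * (K * Fintype.card (M.Simplex k)) :=
        mul_le_mul_of_nonneg_left hmain (by positivity)
      _ ≤ (a : ℝ) ^ e * (K * (2 ^ (d + 1) * M.vol d)) := by gcongr
      _ = _ := by ring
  · refine le_trans (Finset.card_le_card_of_injOn
      (t := Finset.univ.filter fun s => s ∈ M.faces ∧ simplexPosition F s = p) Subtype.val
      (fun σ hσ => ?_) fun _ _ _ _ h => Subtype.val_injective h)
      ((hF.card_position_le (p := p) fun s hs => (Finset.mem_filter.1 hs).2).trans (Nat.le_succ _))
    exact Finset.mem_filter.2 ⟨Finset.mem_univ _, σ.2.1, (Finset.mem_filter.1 hσ).2⟩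

theorem mainTheorem6 :
    -- the bound on the dimension and the distance of local codes
    (∀ (n : ℕ), 2 ≤ n → ∀ (w : ℕ) (A : ℝ), ∃ K : ℝ, 0 < K ∧
      ∀ {ι₂ ι₁ ι₀ : Type*} [Fintype ι₂] [Fintype ι₁] [Fintype ι₀] (C : CSSCode ι₂ ι₁ ι₀),
        C.IsLDPC w → C.IsLocal n A →
          (C.dim : ℝ) * (C.dist : ℝ) ^ ((2 : ℝ) / ((n : ℝ) - 1)) ≤ K * (C.size : ℝ)) ∧
    -- distance at least `V^((n-1)/n)` up to polylog forces dimension at most `V^((n-2)/n)` up to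
    -- polylog
    (∀ (n : ℕ), 2 ≤ n → ∀ (w : ℕ) (A : ℝ), ∀ a c : ℝ, 0 < a → 0 < c → ∃ b : ℝ, 0 < b ∧
      ∀ {ι₂ ι₁ ι₀ : Type*} [Fintype ι₂] [Fintype ι₁] [Fintype ι₀] (C : CSSCode ι₂ ι₁ ι₀),
        C.IsLDPC w → C.IsLocal n A → 3 ≤ C.size →
        c * ((C.size : ℝ) ^ (((n : ℝ) - 1) / n) * Real.log C.size ^ (-a)) ≤ (C.dist : ℝ) →
          (C.dim : ℝ) ≤ (C.size : ℝ) ^ (((n : ℝ) - 2) / n) * Real.log C.size ^ b) ∧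
    -- the bound for local triangulated manifolds
    (∀ (n d k : ℕ), 2 ≤ n → 2 ≤ d → 0 < k → k < d → ∀ A : ℕ, ∃ K : ℝ, 0 < K ∧
      ∀ {ι : Type*} [Fintype ι] (M : AbstractSimplicialComplex ι),
        M.IsTriangulatedManifold d → M.IsLocal d n A →
          (M.bettiTwo k : ℝ) *
              (min (M.systole k) (M.systole (d - k)) : ℝ) ^ ((2 : ℝ) / ((n : ℝ) - 1)) ≤
            K * (M.vol d : ℝ)) := by
  refine ⟨fun n hn w A => ?_, fun n hn w A a c ha hc => ?_, fun n d k hn _ hk hkd A => ?_⟩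
  · obtain ⟨K, hK, h⟩ := CSSCode.exists_dim_mul_dist_le n hn A
    exact ⟨K, hK, fun C _ hC => h C hC⟩
  · obtain ⟨K, hK, h⟩ := CSSCode.exists_dim_mul_dist_le n hn A
    obtain ⟨b, hb, h'⟩ := exists_polylog_bound (K := K) hn ha hc
    exact ⟨b, hb, fun C _ hC hV hD =>
      h' _ _ _ (Nat.cast_nonneg _) (by exact_mod_cast hV) (h C hC) hD⟩
  · obtain ⟨K, hK, h⟩ := AbstractSimplicialComplex.exists_bettiTwo_mul_systole_le n d k hn hk hkd A
    refine ⟨K, hK, fun M hM hloc => ?_⟩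
    have := h M hM hloc
    rwa [Nat.cast_min] at this
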